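/- Let $\rho>0$. For each integer $K\ge 1$ let $N=N_K$ be an integer, where $N\to\infty$ as $K\to\infty$ and $0<\liminf K/N\le\limsup K/N<\infty$. Let $\boldsymbol\Psi_K$ be a Hermitian nonnegative $N\times N$ matrix with spectral decomposition $\boldsymbol\Psi_K=\mathbf U_K\mathbf D_K\mathbf U_K^*$ ($\mathbf D_K$ real diagonal), let $p_0>0$ and $p_1,\dots,p_K\ge 0$ be deterministic powers (possibly depending on $K$), $\mathbf P=\mathrm{diag}(p_0,\dots,p_K)$, $\widetilde{\mathbf D}_K=\mathrm{diag}(p_1,\dots,p_K)$, and let $\mathbf W$ be an $N\times(K+1)$ random matrix with i.i.d. standard circular complex Gaussian entries (mean $0$, variance $1$). Consider the received vector $\mathbf r=\boldsymbol\Sigma\mathbf s+\mathbf n$, where $\boldsymbol\Sigma=K^{-1/2}\boldsymbol\Psi_K^{1/2}\mathbf W\mathbf P^{1/2}$, $\mathbb E\,\mathbf s\mathbf s^*=\mathbf I$, $\mathbb E\,\mathbf n\mathbf n^*=\rho\mathbf I$, $\mathbb E\,\mathbf s\mathbf n^*=0$, and $(\mathbf s,\mathbf n)$ is independent of the channel.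 Let $\mathbf y$ be the first column of $\boldsymbol\Sigma$, let $\mathbf r_{\rm in}=\mathbf r-s_0\mathbf y$, let $\mathbf g$ be the LMMSE receiver, i.e. the minimiser over $\mathbf h\in\mathbb C^N$ of $\mathbb E|\mathbf h^*\mathbf r-s_0|^2$ (expectation over $\mathbf s,\mathbf n$ for a given channel), and let $$\beta_K=\frac{|\mathbf g^*\mathbf y|^2}{\mathbb E|\mathbf g^*\mathbf r_{\rm in}|^2}$$ be its output SNR (expectation over $\mathbf s,\mathbf n$); this is a random variable through $\mathbf W$. Assume that the spectral norms satisfy $\sup_K\|\mathbf D_K\|<\infty$, $\sup_K\|\widetilde{\mathbf D}_K\|<\infty$, and that $\inf_K\frac1K\mathrm{Tr}\,\mathbf D_K>0$, $\inf_K\frac1K\mathrm{Tr}\,\widetilde{\mathbf D}_K>0$. Then for every $K\ge1$ the system $$\delta=\tfrac1K\mathrm{Tr}\,\mathbf D_K\big(\mathbf I+\tfrac1\rho\tilde\delta\,\mathbf D_K\big)^{-1},\qquad \tilde\delta=\tfrac1K\mathrm{Tr}\,\widetilde{\mathbf D}_K\big(\mathbf I+\tfrac1\rho\delta\,\widetilde{\mathbf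 D}_K\big)^{-1}$$ has exactly one solution $(\delta_K,\tilde\delta_K)$ with $\delta_K>0$ and $\tilde\delta_K>0$, and $\beta_K$ has finite moments up to order $3$. Put $\mathbf T=(\mathbf I+\frac1\rho\tilde\delta_K\mathbf D_K)^{-1}$, $\widetilde{\mathbf T}=(\mathbf I+\frac1\rho\delta_K\widetilde{\mathbf D}_K)^{-1}$, $\gamma=\frac1K\mathrm{Tr}\,\mathbf D^2\mathbf T^2$, $\tilde\gamma=\frac1K\mathrm{Tr}\,\widetilde{\mathbf D}^2\widetilde{\mathbf T}^2$, and $$\Omega_K^2=\frac{\gamma}{\rho^2}\Big(\frac{\gamma\tilde\gamma}{\rho^2-\gamma\tilde\gamma}+1\Big),\qquad \nu_K=\frac{2\rho^3}{K(\rho^2-\gamma\tilde\gamma)^3}\Big[\mathrm{Tr}\,\mathbf D^3\mathbf T^3-\frac{\gamma^3}{\rho^3}\mathrm{Tr}\,\widetilde{\mathbf D}^3\widetilde{\mathbf T}^3\Big].$$ As $K\to\infty$: 1. $\delta_K/\rho=\mathcal O(1)$ and $\mathbb E(\beta_K/p_0)-\delta_K/\rho\to0$; 2. $\Omega_K=\mathcal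 O(1)$ and $K\,\mathbb E\big(\beta_K/p_0-\mathbb E(\beta_K/p_0)\big)^2-\Omega_K^2\to0$; 3. $\nu_K=\mathcal O(1)$ and $K^2\,\mathbb E\big(\beta_K/p_0-\mathbb E(\beta_K/p_0)\big)^3-\nu_K\to0$. -/

import Mathlib

open MeasureTheory ProbabilityTheory Filter Asymptotics Topology
open scoped ENNReal Matrix MatrixOrder ComplexOrder

namespace LMMSE

/-! ### The random channel, the receiver and its output SNR -/

/-- The standard circular complex Gaussian law (centred, unit variance): the real and imaginary
parts are independent real Gaussian variables with mean `0` and variance `1 / 2`. -/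
noncomputable def stdComplexGaussian : Measure ℂ :=
  ((gaussianReal 0 (1 / 2)).prod (gaussianReal 0 (1 / 2))).map (fun x : ℝ × ℝ => (⟨x.1, x.2⟩ : ℂ))

/-- `W` is a random matrix whose entries are i.i.d. standard complex Gaussian. -/
structure IsStdGaussianMatrix {Ω : Type*} [MeasurableSpace Ω] {m n : ℕ}
    (W : Ω → Matrix (Fin m) (Fin n) ℂ) (P : Measure Ω) : Prop where
  hasLaw : ∀ i j, HasLaw (fun ω => W ω i j) stdComplexGaussian P
  indep : iIndepFun (fun (ij : Fin m × Fin n) ω => W ω ij.1 ij.2) P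

/-- Second-order model of the transmitted symbols `s = (s₀, …, s_K)` and of the noise `n`:
`𝔼 s s* = I`, `𝔼 n n* = ρ I`, and `s` and `n` are uncorrelated. -/
structure IsSignalNoise {Ω' : Type*} [MeasurableSpace Ω'] {K N : ℕ} (ρ : ℝ)
    (s : Ω' → Fin (K + 1) → ℂ) (n : Ω' → Fin N → ℂ) (Q : Measure Ω') : Prop where
  memLp_signal : ∀ k, MemLp (fun ω => s ω k) 2 Q
  memLp_noise : ∀ i, MemLp (fun ω => n ω i) 2 Q
  signal_cov : ∀ k l, ∫ ω, s ω k * star (s ω l) ∂Q = if k = l then 1 else 0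
  noise_cov : ∀ i j, ∫ ω, n ω i * star (n ω j) ∂Q = if i = j then (ρ : ℂ) else 0
  cross_cov : ∀ k i, ∫ ω, s ω k * star (n ω i) ∂Q = 0

/-- The channel matrix `Σ = K^{-1/2} Ψ^{1/2} W P^{1/2}`, with `Ψ^{1/2}` the positive semidefinite
square root of `Ψ` and `P = diag(p₀, …, p_K)`. -/
noncomputable def channel {K N : ℕ} (Ψ : Matrix (Fin N) (Fin N) ℂ) (p : Fin (K + 1) → ℝ)
    (W : Matrix (Fin N) (Fin (K + 1)) ℂ) : Matrix (Fin N) (Fin (K + 1)) ℂ :=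
  ((1 / √(K : ℝ) : ℝ) : ℂ) • (CFC.sqrt Ψ * W * Matrix.diagonal (fun k => ((√(p k) : ℝ) : ℂ)))

/-- The received vector `r = Σ s + n`. -/
def received {K N : ℕ} (S : Matrix (Fin N) (Fin (K + 1)) ℂ) (s : Fin (K + 1) → ℂ)
    (n : Fin N → ℂ) : Fin N → ℂ :=
  S *ᵥ s + n

/-- The signature `y` of the user of interest: the column of index `0` of the channel matrix. -/
def signature {K N : ℕ} (S : Matrix (Fin N) (Fin (K + 1)) ℂ) : Fin N → ℂ :=
  fun i => S i 0

/-- The mean-square error `𝔼 |h* r - s₀|²` of the linear receiver `h`, for the channel `S`; the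
expectation is over the symbols and the noise. -/
noncomputable def mse {Ω' : Type*} [MeasurableSpace Ω'] {K N : ℕ} (Q : Measure Ω')
    (s : Ω' → Fin (K + 1) → ℂ) (n : Ω' → Fin N → ℂ) (S : Matrix (Fin N) (Fin (K + 1)) ℂ)
    (h : Fin N → ℂ) : ℝ :=
  ∫ ω, ‖star h ⬝ᵥ received S (s ω) (n ω) - s ω 0‖ ^ 2 ∂Q

/-- `g` is the LMMSE receiver for the channel `S`: it minimises the mean-square error among all
linear receivers. -/
def IsLMMSE {Ω' : Type*} [MeasurableSpace Ω'] {K N : ℕ} (Q : Measure Ω')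
    (s : Ω' → Fin (K + 1) → ℂ) (n : Ω' → Fin N → ℂ) (S : Matrix (Fin N) (Fin (K + 1)) ℂ)
    (g : Fin N → ℂ) : Prop :=
  ∀ h : Fin N → ℂ, mse Q s n S g ≤ mse Q s n S h

/-- The output SNR `|g* y|² / 𝔼 |g* r_in|²` of the linear receiver `g`, where `r = s₀ y + r_in`;
the expectation is over the symbols and the noise. -/
noncomputable def outputSNR {Ω' : Type*} [MeasurableSpace Ω'] {K N : ℕ} (Q : Measure Ω')
    (s : Ω' → Fin (K + 1) → ℂ) (n : Ω' → Fin N → ℂ) (S : Matrix (Fin N) (Fin (K + 1)) ℂ)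
    (g : Fin N → ℂ) : ℝ :=
  ‖star g ⬝ᵥ signature S‖ ^ 2 /
    ∫ ω, ‖star g ⬝ᵥ (received S (s ω) (n ω) - s ω 0 • signature S)‖ ^ 2 ∂Q

/-! ### The deterministic quantities -/

/-- The spectral norm of a real square matrix. -/
noncomputable def specNorm {n : ℕ} (A : Matrix (Fin n) (Fin n) ℝ) : ℝ :=
  ‖Matrix.toEuclideanCLM (n := Fin n) (𝕜 := ℝ) A‖

/-- The matrix `(I + t x D)⁻¹`. With `x = δ̃` it is `T`; with `x = δ` and `D̃` for `D` it
is `T̃`. -/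
noncomputable def tMat {n : ℕ} (t x : ℝ) (D : Matrix (Fin n) (Fin n) ℝ) :
    Matrix (Fin n) (Fin n) ℝ :=
  (1 + (t * x) • D)⁻¹

/-- `(δ, δ̃)` is a positive solution of the system `δ = K⁻¹ Tr D (I + t δ̃ D)⁻¹`,
`δ̃ = K⁻¹ Tr D̃ (I + t δ D̃)⁻¹`. -/
structure IsPosSolution {K N : ℕ} (t : ℝ) (D : Matrix (Fin N) (Fin N) ℝ)
    (D' : Matrix (Fin K) (Fin K) ℝ) (δ δ' : ℝ) : Prop where
  pos : 0 < δ
  pos' : 0 < δ'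
  eq : δ = 1 / (K : ℝ) * (D * tMat t δ' D).trace
  eq' : δ' = 1 / (K : ℝ) * (D' * tMat t δ D').trace

/-- `K⁻¹ Tr D² T²` with `T = (I + t x D)⁻¹`: this is `γ` for `(x, D) = (δ̃, D)` and `γ̃` for
`(x, D) = (δ, D̃)`. -/
noncomputable def gam {n : ℕ} (K : ℕ) (t x : ℝ) (D : Matrix (Fin n) (Fin n) ℝ) : ℝ :=
  1 / (K : ℝ) * (D ^ 2 * tMat t x D ^ 2).trace

/-- `Ω_K² = (γ / ρ²) (γ γ̃ / (ρ² - γ γ̃) + 1)`, evaluated at `t = 1 / ρ`. -/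
noncomputable def omegaSq {K N : ℕ} (ρ : ℝ) (D : Matrix (Fin N) (Fin N) ℝ)
    (D' : Matrix (Fin K) (Fin K) ℝ) (δ δ' : ℝ) : ℝ :=
  let γ := gam K (1 / ρ) δ' D
  let γ' := gam K (1 / ρ) δ D'
  γ / ρ ^ 2 * (γ * γ' / (ρ ^ 2 - γ * γ') + 1)

/-- `ν_K = 2ρ³ / (K (ρ² - γ γ̃)³) · [Tr D³T³ - (γ³ / ρ³) Tr D̃³T̃³]`, evaluated at `t = 1 / ρ`. -/
noncomputable def nu {K N : ℕ} (ρ : ℝ) (D : Matrix (Fin N) (Fin N) ℝ)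
    (D' : Matrix (Fin K) (Fin K) ℝ) (δ δ' : ℝ) : ℝ :=
  let γ := gam K (1 / ρ) δ' D
  let γ' := gam K (1 / ρ) δ D'
  2 * ρ ^ 3 / (K * (ρ ^ 2 - γ * γ') ^ 3) *
    ((D ^ 3 * tMat (1 / ρ) δ' D ^ 3).trace -
      γ ^ 3 / ρ ^ 3 * (D' ^ 3 * tMat (1 / ρ) δ D' ^ 3).trace)

end LMMSE

open LMMSE

/-! Write B = Ψ^{1/2}, τ_k = p_k/K, and x_0, …, x_K for the columns of W. Orthogonality of symbols
and noise turns the error of a receiver h into |h*y − 1|² + h*Ah with A = B(∑_{k≥1} τ_k x_k x_k*)B +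
ρ, so the optimal output SNR is y*A⁻¹y (`IsLMMSE.outputSNR_eq_qform`). Hence β/p₀ = K⁻¹ x_0* M x_0,
where M = B A⁻¹ B is independent of x_0 (`outputSNR_channel`). Since the law of x_0 is unitarily
invariant, x_0* M x_0 has, given M, mean Tr M, variance Tr M² and third central moment 2 Tr M³. It
remains to find the limits of K⁻¹ E Tr M^j for j = 1, 2, 3 and to show that the fluctuations of Tr M
do not contribute.

Fluctuations: by the rank-one formula, resampling one column moves Tr M by O(1), with variance
O(1/K). An Efron–Stein argument (`moments_pi_le`) then bounds the second and third central moments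
of Tr M by constants (`ResSetup.moments_reTr`).

Means: all three traces come from a single function. Adding t·I to the Gram sum gives M_t, and M_0 −
M_t = t M_0 M_t. So f(t) = K⁻¹ E Tr M_t equals f(0) − t K⁻¹ E Tr M² + t² K⁻¹ E Tr M³ up to O(t³). A
leave-one-out computation (`ResSetup.abs_reTr_resolv_sub_integral_le`) shows f(t) = F(t + G(f(t))) +
O(K^{-1/2}), where F(x) = K⁻¹ ∑ d_i/(ρ + x d_i) and G(e) = K⁻¹ ∑ p_k/(1 + e p_k). The exact solution
of e = F(t + G(e)) expands as e − L t + Q t² + O(t³) with e = δ/ρ, L = Ω², 2Q = ν. The equation is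
stable, so f(t) lies within O(K^{-1/2} + t³) of this expansion (`exists_expansion_bound`). Comparing
at t = 0, u, 2u with u = K^{-1/8} identifies the three coefficients up to O(u)
(`exists_moment_bound`).

Existence for the deterministic system comes from the intermediate value theorem, uniqueness from
the same stability estimate with zero residuals. -/

namespace LMMSE

set_option linter.unusedSectionVars false

/-! ### Quadratic forms, traces and the compressed resolvent. -/

section MatrixAlgebra

open scoped Matrix.Norms.L2Operator

variable {n : Type*} [Fintype n] [DecidableEq n]

/-- The real part of the quadratic form `x* A x`. -/
noncomputable def qform (A : Matrix n n ℂ) (x : n → ℂ) : ℝ := (star x ⬝ᵥ A *ᵥ x).re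

/-- The real part of the trace. -/
noncomputable def reTr (A : Matrix n n ℂ) : ℝ := A.trace.re

/-- The rank-one matrix `x x*`. -/
def outer (x : n → ℂ) : Matrix n n ℂ := Matrix.vecMulVec x (star x)

/-- The compressed resolvent `B (B H B + ρ)⁻¹ B`. -/
noncomputable def resolv (B : Matrix n n ℂ) (ρ : ℝ) (H : Matrix n n ℂ) : Matrix n n ℂ :=
  B * (B * H * B + (ρ : ℂ) • 1)⁻¹ * B

lemma reTr_add (A B : Matrix n n ℂ) : reTr (A + B) = reTr A + reTr B := by
  simp [reTr, Matrix.trace_add]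

lemma reTr_sub (A B : Matrix n n ℂ) : reTr (A - B) = reTr A - reTr B := by
  simp [reTr, Matrix.trace_sub]

lemma reTr_smul (r : ℝ) (A : Matrix n n ℂ) : reTr ((r : ℂ) • A) = r * reTr A := by
  simp [reTr, Matrix.trace_smul]

lemma qform_add (A B : Matrix n n ℂ) (x : n → ℂ) : qform (A + B) x = qform A x + qform B x := by
  simp [qform, Matrix.add_mulVec, dotProduct_add]

lemma qform_smul (r : ℝ) (A : Matrix n n ℂ) (x : n → ℂ) :
    qform ((r : ℂ) • A) x = r * qform A x := by
  simp [qform, Matrix.smul_mulVec, dotProduct_smul]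

lemma star_dotProduct_mulVec_star (A : Matrix n n ℂ) (x : n → ℂ) :
    star (star x ⬝ᵥ A *ᵥ x) = star x ⬝ᵥ Aᴴ *ᵥ x := by
  rw [← Matrix.star_dotProduct_star, star_star, Matrix.star_mulVec, dotProduct_comm,
    Matrix.dotProduct_mulVec]
  exact dotProduct_comm _ _

lemma qform_conjTranspose (A : Matrix n n ℂ) (x : n → ℂ) : qform Aᴴ x = qform A x := by
  rw [qform, ← star_dotProduct_mulVec_star, qform]; simp

lemma reTr_conjTranspose (A : Matrix n n ℂ) : reTr Aᴴ = reTr A := by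
  simp [reTr, Matrix.trace_conjTranspose]

lemma coe_qform {A : Matrix n n ℂ} (hA : A.IsHermitian) (x : n → ℂ) :
    (qform A x : ℂ) = star x ⬝ᵥ A *ᵥ x := by
  have h := star_dotProduct_mulVec_star A x
  rw [hA.eq] at h
  exact Complex.conj_eq_iff_re.mp h

lemma qform_nonneg {A : Matrix n n ℂ} (hA : A.PosSemidef) (x : n → ℂ) : 0 ≤ qform A x :=
  (RCLike.nonneg_iff.mp (hA.dotProduct_mulVec_nonneg x)).1

lemma norm_star_dotProduct_mulVec_le (A : Matrix n n ℂ) (x : n → ℂ) :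
    ‖star x ⬝ᵥ A *ᵥ x‖ ≤ ‖A‖ * (star x ⬝ᵥ x).re := by
  have h1 : star x ⬝ᵥ A *ᵥ x
      = inner ℂ (WithLp.toLp 2 x) (WithLp.toLp 2 (A *ᵥ x)) := by
    rw [EuclideanSpace.inner_eq_star_dotProduct, dotProduct_comm]
  have h2 : (star x ⬝ᵥ x).re = ‖WithLp.toLp 2 x‖ * ‖WithLp.toLp 2 x‖ := by
    rw [← inner_self_eq_norm_mul_norm (𝕜 := ℂ), EuclideanSpace.inner_eq_star_dotProduct,
      dotProduct_comm]
    rfl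
  rw [h1, h2]
  refine (norm_inner_le_norm _ _).trans ?_
  have := Matrix.l2_opNorm_mulVec A (WithLp.toLp 2 x)
  calc _ ≤ ‖WithLp.toLp 2 x‖ * (‖A‖ * ‖WithLp.toLp 2 x‖) := by
        gcongr
        exact this
    _ = _ := by ring

lemma abs_qform_le (A : Matrix n n ℂ) (x : n → ℂ) :
    |qform A x| ≤ ‖A‖ * (star x ⬝ᵥ x).re :=
  (Complex.abs_re_le_norm _).trans (norm_star_dotProduct_mulVec_le A x)

lemma abs_reTr_le (A : Matrix n n ℂ) : |reTr A| ≤ Fintype.card n * ‖A‖ := by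
  have h : reTr A = ∑ i, qform A (Pi.single i 1) := by
    simp only [reTr, Matrix.trace, Complex.re_sum, qform]
    refine Finset.sum_congr rfl fun i _ => ?_
    rw [← Pi.single_star]
    simp
  rw [h]
  refine (Finset.abs_sum_le_sum_abs _ _).trans ?_
  rw [← nsmul_eq_mul, ← Finset.card_univ]
  refine Finset.sum_le_card_nsmul _ _ _ fun i _ => ?_
  refine (abs_qform_le A _).trans (le_of_eq ?_)
  rw [← Pi.single_star]
  simp

lemma qform_mul_self_eq {M : Matrix n n ℂ} (hM : M.IsHermitian) (A : Matrix n n ℂ) (x : n → ℂ) :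
    qform (M * A * M) x = qform A (M *ᵥ x) := by
  rw [qform, qform, Matrix.star_mulVec, hM.eq, ← Matrix.dotProduct_mulVec, Matrix.mulVec_mulVec,
    Matrix.mulVec_mulVec, Matrix.mul_assoc]

/-- Since x*MAMx = (Mx)*A(Mx), it suffices that M² ≤ cM, which is read off from the square root of
M. Bounding by x*Mx rather than by |x|² lets the denominator 1 + τ x*Mx of the rank-one formula
absorb the numerator. -/
lemma abs_qform_conj_le {M : Matrix n n ℂ} (hM : M.PosSemidef) {c : ℝ} (hc : ‖M‖ ≤ c)
    (A : Matrix n n ℂ) (x : n → ℂ) :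
    |qform (M * A * M) x| ≤ ‖A‖ * c * qform M x := by
  rw [qform_mul_self_eq hM.1]
  refine (abs_qform_le _ _).trans ?_
  have h1 : (star (M *ᵥ x) ⬝ᵥ M *ᵥ x).re = qform (M * 1 * M) x := by
    rw [qform_mul_self_eq hM.1, qform, Matrix.one_mulVec]
  set S := CFC.sqrt M with hS
  have hSS : S * S = M := CFC.sqrt_mul_sqrt_self M (Matrix.nonneg_iff_posSemidef.mpr hM)
  have hSp : S.PosSemidef := Matrix.nonneg_iff_posSemidef.mp (CFC.sqrt_nonneg M)
  have h2 : qform (M * 1 * M) x ≤ c * qform M x := by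
    have e0 : M = S * 1 * S := by rw [Matrix.mul_one, hSS]
    have e1 : M * 1 * M = S * (M * 1) * S := by
      rw [← hSS]; simp only [Matrix.mul_one, Matrix.mul_assoc]
    have e2 : qform M x = (star (S *ᵥ x) ⬝ᵥ S *ᵥ x).re := by
      calc qform M x = qform (S * 1 * S) x := congrArg (qform · x) e0
        _ = _ := by rw [qform_mul_self_eq hSp.1, qform, Matrix.one_mulVec]
    rw [e1, qform_mul_self_eq hSp.1, e2, Matrix.mul_one]
    refine (le_abs_self _).trans ((abs_qform_le _ _).trans ?_)
    gcongr
    have := qform_nonneg (Matrix.PosSemidef.one (n := n) (R := ℂ)) (S *ᵥ x)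
    rwa [qform, Matrix.one_mulVec] at this
  rw [h1, mul_assoc ‖A‖]
  exact mul_le_mul_of_nonneg_left h2 (norm_nonneg A)

lemma outer_posSemidef (x : n → ℂ) : (outer x).PosSemidef :=
  Matrix.posSemidef_vecMulVec_self_star x

variable {B : Matrix n n ℂ} {ρ : ℝ} {H H₁ H₂ : Matrix n n ℂ}

lemma smul_one_posDef (hρ : 0 < ρ) : ((ρ : ℂ) • (1 : Matrix n n ℂ)).PosDef :=
  Matrix.PosDef.one.smul (by exact_mod_cast hρ)

lemma mul_mul_self_posSemidef (hB : B.IsHermitian) (hH : H.PosSemidef) :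
    (B * H * B).PosSemidef := by
  simpa [hB.eq] using hH.conjTranspose_mul_mul_same B

lemma resolv_aux_posDef (hB : B.IsHermitian) (hρ : 0 < ρ) (hH : H.PosSemidef) :
    (B * H * B + (ρ : ℂ) • 1).PosDef :=
  Matrix.PosDef.posSemidef_add (mul_mul_self_posSemidef hB hH) (smul_one_posDef hρ)

lemma resolv_posSemidef (hB : B.IsHermitian) (hρ : 0 < ρ) (hH : H.PosSemidef) :
    (resolv B ρ H).PosSemidef :=
  mul_mul_self_posSemidef hB (resolv_aux_posDef hB hρ hH).inv.posSemidef

/-- With R the inverse, 1/ρ − R = R(H²/ρ + H)R is positive semidefinite, and R is nonnegative. -/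
lemma norm_inv_add_smul_one_le (hρ : 0 < ρ) (hH : H.PosSemidef) :
    ‖(H + (ρ : ℂ) • 1)⁻¹‖ ≤ 1 / ρ := by
  have hpd : (H + (ρ : ℂ) • 1).PosDef := Matrix.PosDef.posSemidef_add hH (smul_one_posDef hρ)
  set R := (H + (ρ : ℂ) • 1)⁻¹ with hR
  have hRp : R.PosDef := hpd.inv
  have hdet := (Matrix.isUnit_iff_isUnit_det _).mp hpd.isUnit
  have h1 : (H + (ρ : ℂ) • 1) * R = 1 := Matrix.mul_nonsing_inv _ hdet
  have h2 : R * (H + (ρ : ℂ) • 1) = 1 := Matrix.nonsing_inv_mul _ hdet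
  have h0 : 0 ≤ R := Matrix.nonneg_iff_posSemidef.mpr hRp.posSemidef
  rw [CStarAlgebra.norm_le_iff_le_algebraMap R (by positivity) h0]
  rw [Matrix.le_iff]
  have hHH : (H * H).PosSemidef := by
    have := mul_mul_self_posSemidef hH.1 (Matrix.PosSemidef.one (n := n) (R := ℂ))
    simpa using this
  have hkey : (algebraMap ℝ (Matrix n n ℂ)) (1 / ρ) - R
      = R * (((1 / ρ : ℝ) : ℂ) • (H * H) + H) * R := by
    have e1 : ((1 / ρ : ℝ) : ℂ) • (H * H) + H = ((1 / ρ : ℝ) : ℂ) • (H * (H + (ρ : ℂ) • 1)) := by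
      rw [Matrix.mul_add, smul_add, Matrix.mul_smul, Matrix.mul_one, smul_smul]
      congr 1
      rw [← Complex.ofReal_mul, one_div_mul_cancel hρ.ne']
      simp
    have e2 : H * (H + (ρ : ℂ) • 1) * R = H := by rw [Matrix.mul_assoc, h1, Matrix.mul_one]
    have e3 : R * H = 1 - (ρ : ℂ) • R := by
      rw [Matrix.mul_add, Matrix.mul_smul, Matrix.mul_one] at h2
      rw [← h2]; simp
    rw [e1, Matrix.mul_smul, Matrix.smul_mul, Matrix.mul_assoc R, e2, e3, smul_sub, smul_smul,
      ← Complex.ofReal_mul, one_div_mul_cancel hρ.ne', Algebra.algebraMap_eq_smul_one]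
    simp only [Complex.ofReal_one, one_smul, sub_left_inj]
    ext i j
    simp [Matrix.smul_apply]
  rw [hkey]
  exact mul_mul_self_posSemidef hRp.1 ((hHH.smul (by exact_mod_cast (by positivity))).add hH)

lemma norm_resolv_le (hB : B.IsHermitian) (hρ : 0 < ρ) (hH : H.PosSemidef) :
    ‖resolv B ρ H‖ ≤ ‖B * B‖ / ρ := by
  have h1 : ‖B * B‖ = ‖B‖ * ‖B‖ := by
    have := Matrix.l2_opNorm_conjTranspose_mul_self B
    rwa [hB.eq] at this
  rw [h1, resolv]
  calc _ ≤ ‖B‖ * ‖(B * H * B + (ρ : ℂ) • 1)⁻¹‖ * ‖B‖ :=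
        (norm_mul_le _ _).trans (by gcongr; exact norm_mul_le _ _)
    _ ≤ ‖B‖ * (1 / ρ) * ‖B‖ := by
        gcongr
        exact norm_inv_add_smul_one_le hρ (mul_mul_self_posSemidef hB hH)
    _ = _ := by ring

/-- The second resolvent identity; the outer factors B supply exactly the B on each side of the
difference H₂ − H₁. -/
lemma resolv_sub (hB : B.IsHermitian) (hρ : 0 < ρ) (hH₁ : H₁.PosSemidef) (hH₂ : H₂.PosSemidef) :
    resolv B ρ H₁ - resolv B ρ H₂ = resolv B ρ H₁ * (H₂ - H₁) * resolv B ρ H₂ := by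
  have d1 := (Matrix.isUnit_iff_isUnit_det _).mp (resolv_aux_posDef hB hρ hH₁).isUnit
  have d2 := (Matrix.isUnit_iff_isUnit_det _).mp (resolv_aux_posDef hB hρ hH₂).isUnit
  have key : (B * H₁ * B + (ρ : ℂ) • 1)⁻¹ - (B * H₂ * B + (ρ : ℂ) • 1)⁻¹
      = (B * H₁ * B + (ρ : ℂ) • 1)⁻¹ * (B * (H₂ - H₁) * B) *
        (B * H₂ * B + (ρ : ℂ) • 1)⁻¹ := by
    have e : B * (H₂ - H₁) * B = (B * H₂ * B + (ρ : ℂ) • 1) - (B * H₁ * B + (ρ : ℂ) • 1) := by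
      noncomm_ring
    rw [e, Matrix.mul_sub, Matrix.sub_mul, Matrix.nonsing_inv_mul _ d1, Matrix.one_mul,
      Matrix.mul_assoc _ (B * H₂ * B + (ρ : ℂ) • 1), Matrix.mul_nonsing_inv _ d2, Matrix.mul_one]
  simp only [resolv]
  rw [← Matrix.sub_mul, ← Matrix.mul_sub, key]
  simp only [Matrix.mul_assoc]

lemma mul_outer_mul_mulVec (A C : Matrix n n ℂ) (x y : n → ℂ) :
    (A * outer x * C) *ᵥ y = (star x ⬝ᵥ C *ᵥ y) • (A *ᵥ x) := by
  rw [← Matrix.mulVec_mulVec, ← Matrix.mulVec_mulVec, outer, Matrix.vecMulVec_mulVec,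
    op_smul_eq_smul, Matrix.mulVec_smul]

lemma trace_mul_outer (A : Matrix n n ℂ) (x : n → ℂ) :
    (A * outer x).trace = star x ⬝ᵥ A *ᵥ x := by
  rw [outer, Matrix.mul_vecMulVec, Matrix.trace_vecMulVec, dotProduct_comm]

lemma reTr_mul_outer (A : Matrix n n ℂ) (x : n → ℂ) : reTr (A * outer x) = qform A x := by
  rw [reTr, trace_mul_outer, qform]

/-! ### Rank-one perturbations of the resolvent (Sherman–Morrison). -/

section RankOne

variable {τ : ℝ} {x : n → ℂ}

lemma add_smul_outer_posSemidef (hτ : 0 ≤ τ) (hH : H.PosSemidef) (x : n → ℂ) :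
    (H + (τ : ℂ) • outer x).PosSemidef :=
  hH.add ((outer_posSemidef x).smul (by exact_mod_cast hτ))

/-- The resolvent identity applied to x: the outer product collapses to the scalar τ x*Mx times the
perturbed vector. -/
lemma resolv_mulVec_rankOne (hB : B.IsHermitian) (hρ : 0 < ρ) (hH : H.PosSemidef) (hτ : 0 ≤ τ) :
    resolv B ρ H *ᵥ x = ((1 + τ * qform (resolv B ρ H) x : ℝ) : ℂ) •
      (resolv B ρ (H + (τ : ℂ) • outer x) *ᵥ x) := by
  have h := resolv_sub hB hρ (add_smul_outer_posSemidef hτ hH x) hH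
  have hM := resolv_posSemidef hB hρ hH
  have e : H - (H + (τ : ℂ) • outer x) = (-τ : ℂ) • outer x := by
    rw [sub_add_cancel_left, neg_smul]
  rw [e, Matrix.mul_smul, Matrix.smul_mul] at h
  have h2 : resolv B ρ (H + (τ : ℂ) • outer x) *ᵥ x - resolv B ρ H *ᵥ x =
      (-τ * (qform (resolv B ρ H) x : ℂ)) • (resolv B ρ (H + (τ : ℂ) • outer x) *ᵥ x) := by
    rw [← Matrix.sub_mulVec, h, Matrix.smul_mulVec, mul_outer_mul_mulVec, ← coe_qform hM.1,
      smul_smul]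
  rw [sub_eq_iff_eq_add, ← sub_eq_iff_eq_add'] at h2
  rw [← h2]
  push_cast
  rw [add_smul, one_smul, neg_mul, neg_smul, sub_neg_eq_add]

lemma one_add_pos (hB : B.IsHermitian) (hρ : 0 < ρ) (hH : H.PosSemidef) (hτ : 0 ≤ τ) :
    0 < 1 + τ * qform (resolv B ρ H) x := by
  have := qform_nonneg (resolv_posSemidef hB hρ hH) x
  positivity

lemma resolv_rankOne_mulVec (hB : B.IsHermitian) (hρ : 0 < ρ) (hH : H.PosSemidef) (hτ : 0 ≤ τ) :
    resolv B ρ (H + (τ : ℂ) • outer x) *ᵥ x =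
      (((1 + τ * qform (resolv B ρ H) x)⁻¹ : ℝ) : ℂ) • (resolv B ρ H *ᵥ x) := by
  rw [resolv_mulVec_rankOne (x := x) hB hρ hH hτ, smul_smul, ← Complex.ofReal_mul,
    inv_mul_cancel₀ (one_add_pos hB hρ hH hτ).ne', Complex.ofReal_one, one_smul]

lemma qform_mul_resolv_rankOne (hB : B.IsHermitian) (hρ : 0 < ρ) (hH : H.PosSemidef)
    (hτ : 0 ≤ τ) (A : Matrix n n ℂ) :
    qform (A * resolv B ρ (H + (τ : ℂ) • outer x)) x =
      qform (A * resolv B ρ H) x / (1 + τ * qform (resolv B ρ H) x) := by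
  rw [qform, ← Matrix.mulVec_mulVec, resolv_rankOne_mulVec hB hρ hH hτ, Matrix.mulVec_smul,
    dotProduct_smul, smul_eq_mul, Complex.re_ofReal_mul, Matrix.mulVec_mulVec, ← qform,
    div_eq_inv_mul]

/-- By cyclicity the trace of a product containing x x* is a quadratic form at x, to which the
Sherman–Morrison formula applies. -/
lemma reTr_mul_resolv_sub_rankOne (hB : B.IsHermitian) (hρ : 0 < ρ) (hH : H.PosSemidef)
    (hτ : 0 ≤ τ) (A : Matrix n n ℂ) :
    reTr (A * resolv B ρ H) - reTr (A * resolv B ρ (H + (τ : ℂ) • outer x)) =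
      τ * qform (resolv B ρ H * A * resolv B ρ H) x / (1 + τ * qform (resolv B ρ H) x) := by
  have h := resolv_sub hB hρ (add_smul_outer_posSemidef hτ hH x) hH
  have h' : resolv B ρ H - resolv B ρ (H + (τ : ℂ) • outer x) =
      (τ : ℂ) • (resolv B ρ (H + (τ : ℂ) • outer x) * outer x * resolv B ρ H) := by
    rw [← neg_sub, h, sub_add_cancel_left, Matrix.mul_neg, Matrix.neg_mul, neg_neg,
      Matrix.mul_smul, Matrix.smul_mul]
  rw [← reTr_sub, ← Matrix.mul_sub, h', Matrix.mul_smul, reTr_smul]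
  have e : reTr (A * (resolv B ρ (H + (τ : ℂ) • outer x) * outer x * resolv B ρ H)) =
      qform (resolv B ρ H * A * resolv B ρ (H + (τ : ℂ) • outer x)) x := by
    rw [← reTr_mul_outer, reTr, reTr, ← Matrix.mul_assoc, Matrix.trace_mul_comm]
    simp only [Matrix.mul_assoc]
  rw [e, qform_mul_resolv_rankOne hB hρ hH hτ, mul_div_assoc]

/-- The bound does not depend on x or τ: by `abs_qform_conj_le` the numerator is at most ‖A‖c times
τ x*Mx, which is smaller than the denominator. This makes removal of one column harmless even though
Gaussian columns are unbounded. -/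
lemma abs_reTr_mul_resolv_sub_rankOne_le (hB : B.IsHermitian) (hρ : 0 < ρ) (hH : H.PosSemidef)
    (hτ : 0 ≤ τ) (A : Matrix n n ℂ) {c : ℝ} (hc : ‖B * B‖ / ρ ≤ c) :
    |reTr (A * resolv B ρ H) - reTr (A * resolv B ρ (H + (τ : ℂ) • outer x))| ≤ ‖A‖ * c := by
  rw [reTr_mul_resolv_sub_rankOne hB hρ hH hτ]
  have hp := one_add_pos (x := x) hB hρ hH hτ
  have hM := resolv_posSemidef hB hρ hH
  have hn := (norm_resolv_le hB hρ hH).trans hc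
  have hq := qform_nonneg hM x
  have hc0 : 0 ≤ c := (norm_nonneg _).trans hn
  rw [abs_div, abs_of_pos hp, div_le_iff₀ hp, abs_mul, abs_of_nonneg hτ]
  have := abs_qform_conj_le hM hn A x
  have h3 : 0 ≤ ‖A‖ * c := by positivity
  calc _ ≤ τ * (‖A‖ * c * qform (resolv B ρ H) x) := by gcongr
    _ ≤ _ := by nlinarith

end RankOne

end MatrixAlgebra

end LMMSE

namespace LMMSE

/-! ### Bookkeeping for integrals. -/

section Mean

/-- `f` is integrable with integral `m`. -/
def HasMean {Ω : Type*} [MeasurableSpace Ω] (P : Measure Ω) (f : Ω → ℝ) (m : ℝ) : Prop :=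
  Integrable f P ∧ ∫ ω, f ω ∂P = m

variable {Ω : Type*} [MeasurableSpace Ω] {P : Measure Ω} {f g : Ω → ℝ} {a b : ℝ}

lemma _root_.MeasureTheory.Integrable.hasMean (h : Integrable f P) :
    HasMean P f (∫ ω, f ω ∂P) := ⟨h, rfl⟩

lemma HasMean.add (hf : HasMean P f a) (hg : HasMean P g b) :
    HasMean P (fun ω => f ω + g ω) (a + b) :=
  ⟨hf.1.add hg.1, by rw [integral_add hf.1 hg.1, hf.2, hg.2]⟩

lemma HasMean.sub (hf : HasMean P f a) (hg : HasMean P g b) :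
    HasMean P (fun ω => f ω - g ω) (a - b) :=
  ⟨hf.1.sub hg.1, by rw [integral_sub hf.1 hg.1, hf.2, hg.2]⟩

lemma HasMean.const_mul (c : ℝ) (hf : HasMean P f a) : HasMean P (fun ω => c * f ω) (c * a) :=
  ⟨hf.1.const_mul c, by rw [integral_const_mul, hf.2]⟩

lemma HasMean.const [IsProbabilityMeasure P] (c : ℝ) : HasMean P (fun _ => c) c :=
  ⟨integrable_const c, by simp⟩

lemma HasMean.congr (hf : HasMean P f a) (h : ∀ ω, g ω = f ω) (hab : b = a) : HasMean P g b := by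
  rw [funext h, hab]; exact hf

end Mean

/-! ### Moments of |z|² for a standard complex Gaussian z. -/

section GaussianMoments

open Polynomial in
/-- The polynomial factor of the iterated derivatives of `exp (v t² / 2)`. -/
noncomputable def gaussPoly (v : ℝ) : ℕ → ℝ[X]
  | 0 => 1
  | k + 1 => derivative (gaussPoly v k) + C v * X * gaussPoly v k

open Polynomial in
lemma iteratedDeriv_exp_mul_sq (v : ℝ) (k : ℕ) :
    iteratedDeriv k (fun t : ℝ => Real.exp (v * t ^ 2 / 2)) =
      fun t => (gaussPoly v k).eval t * Real.exp (v * t ^ 2 / 2) := by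
  induction k with
  | zero => simp [gaussPoly]
  | succ k ih =>
    rw [iteratedDeriv_succ, ih]
    ext t
    have h1 : HasDerivAt (fun t : ℝ => v * t ^ 2 / 2) (v * t) t := by
      refine (((hasDerivAt_pow 2 t).const_mul v).div_const 2).congr_deriv ?_
      push_cast
      ring
    have h2 := (((gaussPoly v k).hasDerivAt t).mul h1.exp).deriv
    refine Eq.trans h2 ?_
    simp [gaussPoly]
    ring

/-- Moments are derivatives at 0 of the moment generating function exp(vt²/2), whose derivatives
keep the form polynomial times exponential. -/
lemma integral_pow_gaussianReal (v : NNReal) (k : ℕ) :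
    ∫ x, x ^ k ∂(gaussianReal 0 v) = (gaussPoly v k).eval 0 := by
  have h : ∫ x, x ^ k ∂(gaussianReal 0 v) =
      iteratedDeriv k (mgf (fun x => x) (gaussianReal 0 v)) 0 := by
    rw [iteratedDeriv_mgf_zero] <;> simp
  rw [h, mgf_fun_id_gaussianReal]
  simp only [zero_mul, zero_add]
  rw [iteratedDeriv_exp_mul_sq]
  simp

lemma integral_sq_gaussianReal (v : NNReal) : ∫ x, x ^ 2 ∂(gaussianReal 0 v) = v := by
  simp [integral_pow_gaussianReal, gaussPoly]

lemma integral_pow_four_gaussianReal (v : NNReal) :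
    ∫ x, x ^ 4 ∂(gaussianReal 0 v) = 3 * v ^ 2 := by
  simp [integral_pow_gaussianReal, gaussPoly]
  ring

lemma integral_pow_six_gaussianReal (v : NNReal) :
    ∫ x, x ^ 6 ∂(gaussianReal 0 v) = 15 * v ^ 3 := by
  simp [integral_pow_gaussianReal, gaussPoly]
  ring

lemma integrable_pow_gaussianReal (v : NNReal) (k : ℕ) :
    Integrable (fun x : ℝ => x ^ k) (gaussianReal 0 v) := by
  have h := memLp_id_gaussianReal' (μ := 0) (v := v) k (by simp)
  have := h.integrable_norm_pow'
  refine this.mono' (by fun_prop) (ae_of_all _ fun x => ?_)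
  simp

lemma measurable_complex_mk : Measurable (fun x : ℝ × ℝ => (⟨x.1, x.2⟩ : ℂ)) :=
  Complex.measurableEquivRealProd.symm.measurable

instance : IsProbabilityMeasure stdComplexGaussian :=
  Measure.isProbabilityMeasure_map measurable_complex_mk.aemeasurable

lemma integrable_stdComplexGaussian {f : ℂ → ℝ} (hf : Measurable f)
    (h : Integrable (fun x : ℝ × ℝ => f ⟨x.1, x.2⟩)
      ((gaussianReal 0 (1 / 2)).prod (gaussianReal 0 (1 / 2)))) :
    Integrable f stdComplexGaussian := by
  rw [stdComplexGaussian, integrable_map_measure hf.aestronglyMeasurable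
    measurable_complex_mk.aemeasurable]
  exact h

lemma integral_stdComplexGaussian {f : ℂ → ℝ} (hf : Measurable f) :
    ∫ z, f z ∂stdComplexGaussian =
      ∫ x : ℝ × ℝ, f ⟨x.1, x.2⟩ ∂((gaussianReal 0 (1 / 2)).prod (gaussianReal 0 (1 / 2))) := by
  rw [stdComplexGaussian, integral_map measurable_complex_mk.aemeasurable
    hf.aestronglyMeasurable]

lemma hasMean_pow_mul_pow (j k : ℕ) :
    HasMean ((gaussianReal 0 (1 / 2)).prod (gaussianReal 0 (1 / 2)))
      (fun x : ℝ × ℝ => x.1 ^ j * x.2 ^ k)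
      ((∫ x, x ^ j ∂(gaussianReal 0 (1 / 2))) * ∫ x, x ^ k ∂(gaussianReal 0 (1 / 2))) :=
  ⟨(integrable_pow_gaussianReal _ j).mul_prod (integrable_pow_gaussianReal _ k),
    integral_prod_mul (fun x : ℝ => x ^ j) (fun x : ℝ => x ^ k)⟩

lemma integrable_normSq_pow (k : ℕ) :
    Integrable (fun z : ℂ => Complex.normSq z ^ k) stdComplexGaussian := by
  refine integrable_stdComplexGaussian (Complex.continuous_normSq.measurable.pow_const k) ?_
  have : (fun x : ℝ × ℝ => Complex.normSq ⟨x.1, x.2⟩ ^ k) = fun x : ℝ × ℝ =>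
      ∑ m ∈ Finset.range (k + 1), x.1 ^ (2 * m) * x.2 ^ (2 * (k - m)) * (k.choose m : ℝ) := by
    ext x
    rw [Complex.normSq_mk, add_pow]
    refine Finset.sum_congr rfl fun m _ => ?_
    ring
  rw [this]
  exact integrable_finsetSum _ fun m _ => (hasMean_pow_mul_pow _ _).1.mul_const _

lemma HasMean.of_stdComplexGaussian {f : ℂ → ℝ} {m : ℝ} (hf : Measurable f)
    (h : HasMean ((gaussianReal 0 (1 / 2)).prod (gaussianReal 0 (1 / 2)))
      (fun x : ℝ × ℝ => f ⟨x.1, x.2⟩) m) :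
    HasMean stdComplexGaussian f m :=
  ⟨integrable_stdComplexGaussian hf h.1, (integral_stdComplexGaussian hf).trans h.2⟩

lemma hasMean_normSq : HasMean stdComplexGaussian (fun z => Complex.normSq z) 1 := by
  refine .of_stdComplexGaussian Complex.continuous_normSq.measurable ?_
  refine ((hasMean_pow_mul_pow 2 0).add (hasMean_pow_mul_pow 0 2)).congr
    (fun x => by rw [Complex.normSq_mk]; ring) ?_
  simp only [integral_sq_gaussianReal]
  norm_num

lemma hasMean_normSq_sq : HasMean stdComplexGaussian (fun z => Complex.normSq z ^ 2) 2 := by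
  refine .of_stdComplexGaussian (Complex.continuous_normSq.measurable.pow_const 2) ?_
  refine (((hasMean_pow_mul_pow 4 0).add (hasMean_pow_mul_pow 0 4)).add
    ((hasMean_pow_mul_pow 2 2).const_mul 2)).congr
    (fun x => by rw [Complex.normSq_mk]; ring) ?_
  simp only [integral_sq_gaussianReal, integral_pow_four_gaussianReal]
  norm_num

lemma hasMean_normSq_pow_three :
    HasMean stdComplexGaussian (fun z => Complex.normSq z ^ 3) 6 := by
  refine .of_stdComplexGaussian (Complex.continuous_normSq.measurable.pow_const 3) ?_
  refine ((((hasMean_pow_mul_pow 6 0).add (hasMean_pow_mul_pow 0 6)).add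
    ((hasMean_pow_mul_pow 4 2).const_mul 3)).add ((hasMean_pow_mul_pow 2 4).const_mul 3)).congr
    (fun x => by rw [Complex.normSq_mk]; ring) ?_
  simp only [integral_sq_gaussianReal, integral_pow_four_gaussianReal,
    integral_pow_six_gaussianReal]
  norm_num

lemma memLp_normSq (p : ℕ) : MemLp (fun z : ℂ => Complex.normSq z) p stdComplexGaussian := by
  rcases Nat.eq_zero_or_pos p with rfl | hp
  · simpa using Complex.continuous_normSq.measurable.aestronglyMeasurable
  · rw [← integrable_norm_rpow_iff Complex.continuous_normSq.measurable.aestronglyMeasurable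
      (by simpa using hp.ne') (by simp)]
    refine (integrable_normSq_pow p).congr (ae_of_all _ fun z => ?_)
    simp [abs_of_nonneg (Complex.normSq_nonneg z)]

lemma memLp_normSq_sub_one (p : ℕ) :
    MemLp (fun z : ℂ => Complex.normSq z - 1) p stdComplexGaussian :=
  (memLp_normSq p).sub (memLp_const 1)

lemma hasMean_normSq_sub_one : HasMean stdComplexGaussian (fun z => Complex.normSq z - 1) 0 :=
  (hasMean_normSq.sub (.const 1)).congr (fun _ => rfl) (by norm_num)

lemma hasMean_normSq_sub_one_sq :
    HasMean stdComplexGaussian (fun z => (Complex.normSq z - 1) ^ 2) 1 :=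
  ((hasMean_normSq_sq.sub (hasMean_normSq.const_mul 2)).add (.const 1)).congr
    (fun _ => by ring) (by norm_num)

lemma hasMean_normSq_sub_one_pow_three :
    HasMean stdComplexGaussian (fun z => (Complex.normSq z - 1) ^ 3) 2 :=
  (((hasMean_normSq_pow_three.sub (hasMean_normSq_sq.const_mul 3)).add
    (hasMean_normSq.const_mul 3)).sub (.const 1)).congr (fun _ => by ring) (by norm_num)

end GaussianMoments

/-! ### Third moment of a sum of centred independent variables. -/

section IndependentSums

variable {Ω ι : Type*} [MeasurableSpace Ω] {P : Measure Ω} [IsProbabilityMeasure P]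
  {ξ : ι → Ω → ℝ}

omit [IsProbabilityMeasure P] in
lemma MemLp.integrable_mul_sq {f g : Ω → ℝ} (hf : MemLp f 3 P) (hg : MemLp g 3 P) :
    Integrable (fun ω => f ω * g ω ^ 2) P := by
  have h1 : Integrable (fun ω => |f ω| ^ 3) P := by
    simpa using hf.integrable_norm_pow (p := 3) (by norm_num)
  have h2 : Integrable (fun ω => |g ω| ^ 3) P := by
    simpa using hg.integrable_norm_pow (p := 3) (by norm_num)
  refine (h1.add h2).mono' (hf.1.mul (hg.1.pow 2)) (ae_of_all _ fun ω => ?_)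
  simp only [Real.norm_eq_abs, abs_mul, abs_pow, Pi.add_apply]
  have ha := abs_nonneg (f ω)
  have hb := abs_nonneg (g ω)
  rcases le_total |f ω| |g ω| with h | h
  · nlinarith [pow_nonneg ha 3, mul_le_mul_of_nonneg_right h (sq_nonneg |g ω|)]
  · nlinarith [pow_nonneg hb 3, mul_le_mul_of_nonneg_left (pow_le_pow_left₀ hb h 2) ha]

omit [IsProbabilityMeasure P] in
lemma MemLp.integrable_pow_three {f : Ω → ℝ} (hf : MemLp f 3 P) :
    Integrable (fun ω => f ω ^ 3) P := by
  refine (MemLp.integrable_mul_sq hf hf).congr (ae_of_all _ fun ω => ?_)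
  ring

/-- Third cumulants add. Inductively, in (S + ξ)³ the mixed terms S ξ² and S² ξ have zero mean,
because S and ξ are independent and both centred. -/
lemma integral_sum_pow_three (hm : ∀ i, Measurable (ξ i)) (hξ : ∀ i, MemLp (ξ i) 3 P)
    (hind : iIndepFun ξ P) (h0 : ∀ i, ∫ ω, ξ i ω ∂P = 0) (s : Finset ι) :
    ∫ ω, (∑ i ∈ s, ξ i ω) ^ 3 ∂P = ∑ i ∈ s, ∫ ω, ξ i ω ^ 3 ∂P := by
  classical
  induction s using Finset.induction_on with
  | empty => simp
  | insert a s ha ih =>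
    have hS : MemLp (fun ω => ∑ i ∈ s, ξ i ω) 3 P := memLp_finsetSum _ fun i _ => hξ i
    have hSm : Measurable (fun ω => ∑ i ∈ s, ξ i ω) := Finset.measurable_sum _ fun i _ => hm i
    have hI : IndepFun (fun ω => ∑ i ∈ s, ξ i ω) (ξ a) P := by
      have := hind.indepFun_finsetSum_of_notMem hm ha
      convert this using 1
      ext ω; simp
    have hS0 : ∫ ω, ∑ i ∈ s, ξ i ω ∂P = 0 := by
      rw [integral_finsetSum _ fun i _ => (hξ i).integrable (by norm_num)]
      simp [h0]
    have e1 : ∫ ω, (∑ i ∈ s, ξ i ω) * ξ a ω ^ 2 ∂P = 0 := by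
      have := (hI.comp measurable_id (measurable_id.pow_const 2)).integral_fun_mul_eq_mul_integral
        hSm.aestronglyMeasurable ((hm a).pow_const 2).aestronglyMeasurable
      simp only [Function.comp, id] at this
      rw [this, hS0, zero_mul]
    have e2 : ∫ ω, ξ a ω * (∑ i ∈ s, ξ i ω) ^ 2 ∂P = 0 := by
      have := (hI.symm.comp measurable_id
        (measurable_id.pow_const 2)).integral_fun_mul_eq_mul_integral
        (hm a).aestronglyMeasurable (hSm.pow_const 2).aestronglyMeasurable
      simp only [Function.comp, id] at this
      rw [this, h0, zero_mul]
    have i1 := (MemLp.integrable_mul_sq hS (hξ a)).hasMean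
    have i2 := (MemLp.integrable_mul_sq (hξ a) hS).hasMean
    have i3 := (MemLp.integrable_pow_three hS).hasMean
    have i4 := (MemLp.integrable_pow_three (hξ a)).hasMean
    refine (HasMean.congr (((i4.add i3).add (i1.const_mul 3)).add (i2.const_mul 3))
      (fun ω => ?_) ?_).2
    · rw [Finset.sum_insert ha]; ring
    · rw [e1, e2, ih, Finset.sum_insert ha]
      ring

end IndependentSums

end LMMSE

namespace LMMSE

/-! ### Unitary invariance of the complex Gaussian vector. -/

section ColumnLaw

variable {n : Type*} [Fintype n]

/-- The law of a vector with i.i.d. standard complex Gaussian entries. -/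
noncomputable def colLaw (n : Type*) [Fintype n] : Measure (n → ℂ) :=
  Measure.pi fun _ => stdComplexGaussian

instance : IsProbabilityMeasure (colLaw n) := by unfold colLaw; infer_instance

lemma charFunDual_stdComplexGaussian (L : StrongDual ℝ ℂ) :
    charFunDual stdComplexGaussian L =
      Complex.exp (-(((L 1) ^ 2 + (L Complex.I) ^ 2 : ℝ) : ℂ) / 4) := by
  have hL : ∀ x : ℝ × ℝ, L ⟨x.1, x.2⟩ = L 1 * x.1 + L Complex.I * x.2 := by
    intro x
    have : (⟨x.1, x.2⟩ : ℂ) = x.1 • (1 : ℂ) + x.2 • Complex.I := by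
      apply Complex.ext <;> simp
    rw [this, map_add, map_smul, map_smul]
    simp [mul_comm]
  have h1 : charFunDual stdComplexGaussian L =
      ∫ x : ℝ × ℝ, Complex.exp (L 1 * x.1 * Complex.I) * Complex.exp (L Complex.I * x.2 * Complex.I)
        ∂((gaussianReal 0 (1 / 2)).prod (gaussianReal 0 (1 / 2))) := by
    rw [charFunDual_apply, stdComplexGaussian, integral_map measurable_complex_mk.aemeasurable
      (by fun_prop)]
    refine integral_congr_ae (ae_of_all _ fun x => ?_)
    simp only [hL]
    rw [← Complex.exp_add]
    congr 1
    push_cast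
    ring
  rw [h1, integral_prod_mul (fun x : ℝ => Complex.exp (L 1 * x * Complex.I))
    (fun x : ℝ => Complex.exp (L Complex.I * x * Complex.I)), ← charFun_apply_real,
    ← charFun_apply_real, charFun_gaussianReal, charFun_gaussianReal, ← Complex.exp_add]
  congr 1
  push_cast
  ring

variable [DecidableEq n]

lemma charFunDual_colLaw (L : StrongDual ℝ (n → ℂ)) :
    charFunDual (colLaw n) L =
      Complex.exp (-((∑ i, ((L (Pi.single i 1)) ^ 2 + (L (Pi.single i Complex.I)) ^ 2) : ℝ) : ℂ)
        / 4) := by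
  rw [colLaw, charFunDual_pi]
  simp_rw [charFunDual_stdComplexGaussian]
  rw [← Complex.exp_sum]
  congr 1
  push_cast
  rw [← Finset.sum_neg_distrib, Finset.sum_div]
  simp

/-- Represents a real-linear functional as Re(a*x), so that composing with a unitary V replaces a by
V*a. -/
lemma strongDual_pi_complex_apply (L : StrongDual ℝ (n → ℂ)) (x : n → ℂ) :
    L x = ((star fun i => (⟨L (Pi.single i 1), L (Pi.single i Complex.I)⟩ : ℂ)) ⬝ᵥ x).re := by
  have hx : x = ∑ i, ((x i).re • (Pi.single i (1 : ℂ) : n → ℂ)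
      + (x i).im • (Pi.single i Complex.I : n → ℂ)) := by
    ext j
    simp only [Finset.sum_apply, Pi.add_apply, Pi.smul_apply, Finset.sum_add_distrib,
      Pi.single_apply, smul_ite, smul_zero, Finset.sum_ite_eq, Finset.mem_univ, if_true]
    apply Complex.ext <;> simp
  conv_lhs => rw [hx]
  simp only [map_sum, map_add, map_smul, dotProduct, Complex.re_sum]
  refine Finset.sum_congr rfl fun i _ => ?_
  simp [Complex.mul_re]
  ring

/-- The characteristic function at Re(a*·) depends only on |a|², and V* preserves this norm. -/
lemma map_mulVec_colLaw (V : Matrix.unitaryGroup n ℂ) :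
    (colLaw n).map (fun x => (V : Matrix n n ℂ) *ᵥ x) = colLaw n := by
  set T : (n → ℂ) →L[ℝ] (n → ℂ) :=
    ((LinearMap.toContinuousLinearMap (Matrix.mulVecLin (V : Matrix n n ℂ))).restrictScalars ℝ)
    with hT
  have hTa : ∀ x, T x = (V : Matrix n n ℂ) *ᵥ x := fun x => rfl
  have : IsProbabilityMeasure ((colLaw n).map T) :=
    Measure.isProbabilityMeasure_map T.continuous.aemeasurable
  change (colLaw n).map T = colLaw n
  refine Measure.ext_of_charFunDual ?_
  ext L
  rw [charFunDual_map, charFunDual_colLaw, charFunDual_colLaw]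
  set a : n → ℂ := fun i => ⟨L (Pi.single i 1), L (Pi.single i Complex.I)⟩ with ha
  set b : n → ℂ := star (V : Matrix n n ℂ) *ᵥ a with hb
  have hLT : ∀ x, (L.comp T) x = (star b ⬝ᵥ x).re := by
    intro x
    rw [ContinuousLinearMap.comp_apply, strongDual_pi_complex_apply, hTa, hb, Matrix.star_mulVec,
      Matrix.star_eq_conjTranspose, Matrix.conjTranspose_conjTranspose, Matrix.dotProduct_mulVec]
  have e1 : ∀ i, (L.comp T) (Pi.single i 1) = (b i).re := fun i => by rw [hLT]; simp
  have e2 : ∀ i, (L.comp T) (Pi.single i Complex.I) = (b i).im := fun i => by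
    rw [hLT]; simp
  have hs : ∀ c : n → ℂ, ∑ i, ((c i).re ^ 2 + (c i).im ^ 2) = (star c ⬝ᵥ c).re := by
    intro c
    simp only [dotProduct, Complex.re_sum]
    refine Finset.sum_congr rfl fun i _ => ?_
    simp [Complex.mul_re]
    ring
  simp_rw [e1, e2]
  have h3 : ∑ i, ((b i).re ^ 2 + (b i).im ^ 2) =
      ∑ i, (L (Pi.single i 1) ^ 2 + L (Pi.single i Complex.I) ^ 2) := by
    rw [hs, show ∑ i, (L (Pi.single i 1) ^ 2 + L (Pi.single i Complex.I) ^ 2) =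
      ∑ i, ((a i).re ^ 2 + (a i).im ^ 2) from rfl, hs, hb, Matrix.star_mulVec,
      ← Matrix.dotProduct_mulVec, Matrix.mulVec_mulVec, Matrix.star_eq_conjTranspose,
      Matrix.conjTranspose_conjTranspose, ← Matrix.star_eq_conjTranspose,
      (Unitary.mem_iff.mp V.2).2, Matrix.one_mulVec]
  rw [h3]

lemma integral_comp_mulVec_colLaw (V : Matrix.unitaryGroup n ℂ) (f : (n → ℂ) → ℝ)
    (hf : Measurable f) :
    ∫ x, f ((V : Matrix n n ℂ) *ᵥ x) ∂(colLaw n) = ∫ x, f x ∂(colLaw n) := by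
  conv_rhs => rw [← map_mulVec_colLaw V]
  rw [integral_map]
  · exact (Continuous.matrix_mulVec continuous_const continuous_id).aemeasurable
  · exact hf.aestronglyMeasurable

end ColumnLaw

/-! ### Moments of Gaussian quadratic forms. -/

section QuadraticForms

variable {n : Type*} [Fintype n] [DecidableEq n]

omit [DecidableEq n] in
lemma continuous_qform (A : Matrix n n ℂ) : Continuous (qform A) := by
  unfold qform
  exact Complex.continuous_re.comp (Continuous.dotProduct continuous_star
    (Continuous.matrix_mulVec continuous_const continuous_id))

lemma qform_spectral {A : Matrix n n ℂ} (hA : A.IsHermitian) (x : n → ℂ) :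
    qform A x = ∑ i, hA.eigenvalues i * Complex.normSq
      ((star (hA.eigenvectorUnitary : Matrix n n ℂ) *ᵥ x) i) := by
  conv_lhs => rw [hA.spectral_theorem]
  rw [Unitary.conjStarAlgAut_apply, qform, ← Matrix.mulVec_mulVec, ← Matrix.mulVec_mulVec,
    Matrix.dotProduct_mulVec]
  set y := star (hA.eigenvectorUnitary : Matrix n n ℂ) *ᵥ x with hy
  have : star x ᵥ* (hA.eigenvectorUnitary : Matrix n n ℂ) = star y := by
    rw [hy, Matrix.star_mulVec, Matrix.star_eq_conjTranspose, Matrix.conjTranspose_conjTranspose]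
  rw [this]
  simp only [dotProduct, Matrix.mulVec_diagonal, Complex.re_sum]
  refine Finset.sum_congr rfl fun i _ => ?_
  simp [Complex.normSq_apply, Complex.mul_re]
  ring

lemma reTr_pow_spectral {A : Matrix n n ℂ} (hA : A.IsHermitian) (k : ℕ) :
    reTr (A ^ k) = ∑ i, hA.eigenvalues i ^ k := by
  have h : A ^ k = Unitary.conjStarAlgAut ℂ (Matrix n n ℂ) hA.eigenvectorUnitary
      (Matrix.diagonal (RCLike.ofReal ∘ hA.eigenvalues) ^ k) := by
    rw [map_pow, ← hA.spectral_theorem]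
  rw [h, Unitary.conjStarAlgAut_apply, reTr, Matrix.trace_mul_comm, ← Matrix.mul_assoc,
    Unitary.coe_star_mul_self, Matrix.one_mul, Matrix.diagonal_pow, Matrix.trace_diagonal,
    Complex.re_sum]
  refine Finset.sum_congr rfl fun i _ => ?_
  simp [← Complex.ofReal_pow]

/-- The centred quadratic form in the eigenbasis. -/
lemma qform_sub_reTr_spectral {A : Matrix n n ℂ} (hA : A.IsHermitian) (x : n → ℂ) :
    qform A x - reTr A = ∑ i, hA.eigenvalues i * (Complex.normSq
      ((star (hA.eigenvectorUnitary : Matrix n n ℂ) *ᵥ x) i) - 1) := by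
  have := reTr_pow_spectral hA 1
  simp only [pow_one] at this
  rw [qform_spectral hA, this, ← Finset.sum_sub_distrib]
  exact Finset.sum_congr rfl fun i _ => by ring

omit [DecidableEq n] in
lemma memLp_sum_normSq_sub_one (l : n → ℝ) (p : ℕ) :
    MemLp (fun x : n → ℂ => ∑ i, l i * (Complex.normSq (x i) - 1)) p (colLaw n) :=
  memLp_finsetSum _ fun i _ => ((memLp_normSq_sub_one p).comp_measurePreserving
    (measurePreserving_eval (fun _ : n => stdComplexGaussian) i)).const_mul (l i)

lemma memLp_qform_sub_reTr {A : Matrix n n ℂ} (hA : A.IsHermitian) (p : ℕ) :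
    MemLp (fun x => qform A x - reTr A) p (colLaw n) := by
  have hm : MeasurePreserving (fun x => ((star hA.eigenvectorUnitary : Matrix.unitaryGroup n ℂ) :
      Matrix n n ℂ) *ᵥ x) (colLaw n) (colLaw n) :=
    ⟨(Continuous.matrix_mulVec continuous_const continuous_id).measurable, map_mulVec_colLaw _⟩
  have := (memLp_sum_normSq_sub_one hA.eigenvalues p).comp_measurePreserving hm
  refine this.congr_norm (by
    exact ((continuous_qform A).measurable.sub_const _).aestronglyMeasurable)
    (ae_of_all _ fun x => ?_)
  rw [qform_sub_reTr_spectral hA]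
  rfl

/-- In the eigenbasis the centred form is a weighted sum of the variables |z_i|² − 1, which by
unitary invariance are again independent. The moments below follow since these variables have mean
0, variance 1 and third moment 2. -/
lemma integral_qform_aux {A : Matrix n n ℂ} (hA : A.IsHermitian) (k : ℕ) :
    ∫ x, (qform A x - reTr A) ^ k ∂(colLaw n) =
      ∫ x : n → ℂ, (∑ i, hA.eigenvalues i * (Complex.normSq (x i) - 1)) ^ k ∂(colLaw n) := by
  have hm : Measurable fun x : n → ℂ =>
      (∑ i, hA.eigenvalues i * (Complex.normSq (x i) - 1)) ^ k :=
    (Finset.measurable_sum _ fun i _ =>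
      ((Complex.continuous_normSq.measurable.comp (measurable_pi_apply i)).sub_const 1).const_mul
        _).pow_const k
  rw [← integral_comp_mulVec_colLaw (star hA.eigenvectorUnitary) _ hm]
  simp_rw [qform_sub_reTr_spectral hA]
  rfl

omit [DecidableEq n] in
lemma HasMean.comp_eval {f : ℂ → ℝ} {m : ℝ} (h : HasMean stdComplexGaussian f m) (i : n) :
    HasMean (colLaw n) (fun x => f (x i)) m := by
  have hmp := measurePreserving_eval (fun _ : n => stdComplexGaussian) i
  refine ⟨hmp.integrable_comp_of_integrable h.1, ?_⟩
  rw [← h.2, colLaw, integral_comp_eval h.1.aestronglyMeasurable]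

lemma integral_qform_sub_reTr {A : Matrix n n ℂ} (hA : A.IsHermitian) :
    ∫ x, (qform A x - reTr A) ∂(colLaw n) = 0 := by
  have := integral_qform_aux hA 1
  simp only [pow_one] at this
  rw [this, integral_finsetSum _ fun i _ => ((hasMean_normSq_sub_one.comp_eval i).const_mul _).1]
  exact Finset.sum_eq_zero fun i _ => by
    rw [((hasMean_normSq_sub_one.comp_eval i).const_mul _).2, mul_zero]

omit [DecidableEq n] in
lemma iIndepFun_weighted (l : n → ℝ) :
    iIndepFun (fun i (x : n → ℂ) => l i * (Complex.normSq (x i) - 1)) (colLaw n) :=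
  iIndepFun_pi (μ := fun _ : n => stdComplexGaussian)
    (X := fun i z => l i * (Complex.normSq z - 1)) fun i =>
    (((Complex.continuous_normSq.sub continuous_const).const_smul (l i)).measurable).aemeasurable

lemma integral_qform_sub_reTr_sq {A : Matrix n n ℂ} (hA : A.IsHermitian) :
    ∫ x, (qform A x - reTr A) ^ 2 ∂(colLaw n) = reTr (A ^ 2) := by
  rw [integral_qform_aux hA 2, reTr_pow_spectral hA]
  have hind := iIndepFun_weighted hA.eigenvalues
  have hmem : ∀ i, MemLp (fun x : n → ℂ => hA.eigenvalues i * (Complex.normSq (x i) - 1)) 2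
      (colLaw n) := fun i => ((memLp_normSq_sub_one 2).comp_measurePreserving
    (measurePreserving_eval (fun _ : n => stdComplexGaussian) i)).const_mul _
  have h0 : ∀ i, ∫ x : n → ℂ, hA.eigenvalues i * (Complex.normSq (x i) - 1) ∂(colLaw n) = 0 :=
    fun i => by rw [((hasMean_normSq_sub_one.comp_eval i).const_mul _).2, mul_zero]
  have hv := IndepFun.variance_sum (s := Finset.univ) (fun i _ => hmem i)
    (fun i _ j _ hij => hind.indepFun hij)
  have hS0 : ∫ x : n → ℂ, ∑ i, hA.eigenvalues i * (Complex.normSq (x i) - 1) ∂(colLaw n) = 0 := by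
    rw [integral_finsetSum _ fun i _ => (hmem i).integrable (by norm_num)]
    simp [h0]
  rw [variance_of_integral_eq_zero] at hv
  · simp only [Finset.sum_apply] at hv
    rw [hv]
    refine Finset.sum_congr rfl fun i _ => ?_
    rw [variance_of_integral_eq_zero (hmem i).aestronglyMeasurable.aemeasurable (h0 i)]
    have := (hasMean_normSq_sub_one_sq.comp_eval i).const_mul (hA.eigenvalues i ^ 2)
    rw [← mul_one (hA.eigenvalues i ^ 2), ← this.2]
    simp_rw [mul_pow]
  · exact (memLp_finsetSum' _ fun i _ => hmem i).aestronglyMeasurable.aemeasurable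
  · simpa using hS0

lemma integral_qform_sub_reTr_pow_three {A : Matrix n n ℂ} (hA : A.IsHermitian) :
    ∫ x, (qform A x - reTr A) ^ 3 ∂(colLaw n) = 2 * reTr (A ^ 3) := by
  rw [integral_qform_aux hA 3, reTr_pow_spectral hA]
  have hind := iIndepFun_weighted hA.eigenvalues
  have hmem : ∀ i, MemLp (fun x : n → ℂ => hA.eigenvalues i * (Complex.normSq (x i) - 1)) 3
      (colLaw n) := fun i => ((memLp_normSq_sub_one 3).comp_measurePreserving
    (measurePreserving_eval (fun _ : n => stdComplexGaussian) i)).const_mul _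
  have h0 : ∀ i, ∫ x : n → ℂ, hA.eigenvalues i * (Complex.normSq (x i) - 1) ∂(colLaw n) = 0 :=
    fun i => by rw [((hasMean_normSq_sub_one.comp_eval i).const_mul _).2, mul_zero]
  have hm : ∀ i, Measurable (fun x : n → ℂ => hA.eigenvalues i * (Complex.normSq (x i) - 1)) :=
    fun i => ((Complex.continuous_normSq.measurable.comp
      (measurable_pi_apply i)).sub_const 1).const_mul _
  rw [integral_sum_pow_three hm hmem hind h0, Finset.mul_sum]
  refine Finset.sum_congr rfl fun i _ => ?_
  have := (hasMean_normSq_sub_one_pow_three.comp_eval i).const_mul (hA.eigenvalues i ^ 3)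
  rw [mul_comm, ← this.2]
  simp_rw [mul_pow]

lemma integral_qform {A : Matrix n n ℂ} (hA : A.IsHermitian) :
    HasMean (colLaw n) (qform A) (reTr A) := by
  have h : HasMean (colLaw n) (fun x => qform A x - reTr A) 0 :=
    ⟨by simpa using (memLp_qform_sub_reTr hA 1).integrable (by norm_num),
      integral_qform_sub_reTr hA⟩
  exact (h.add (.const (reTr A))).congr (fun _ => by ring) (by ring)

end QuadraticForms

end LMMSE

namespace LMMSE

/-! ### Efron–Stein bounds for second and third central moments. -/

section Tensorization

/-- Bounded measurable real functions. -/
def BddMeas {α : Type*} [MeasurableSpace α] (f : α → ℝ) : Prop :=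
  Measurable f ∧ ∃ C, ∀ x, |f x| ≤ C

variable {α β : Type*} [MeasurableSpace α] [MeasurableSpace β]

lemma BddMeas.integrable {f : α → ℝ} (hf : BddMeas f) (μ : Measure α) [IsFiniteMeasure μ] :
    Integrable f μ := by
  obtain ⟨hm, C, hC⟩ := hf
  exact Integrable.of_bound hm.aestronglyMeasurable C (ae_of_all _ hC)

lemma BddMeas.const (c : ℝ) : BddMeas (fun _ : α => c) := ⟨measurable_const, |c|, fun _ => le_rfl⟩

lemma BddMeas.mul {f g : α → ℝ} (hf : BddMeas f) (hg : BddMeas g) :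
    BddMeas (fun x => f x * g x) := by
  obtain ⟨hm, C, hC⟩ := hf
  obtain ⟨hm', C', hC'⟩ := hg
  refine ⟨hm.mul hm', C * C', fun x => ?_⟩
  rw [abs_mul]
  exact mul_le_mul (hC x) (hC' x) (abs_nonneg _) ((abs_nonneg _).trans (hC x))

lemma BddMeas.sub {f g : α → ℝ} (hf : BddMeas f) (hg : BddMeas g) :
    BddMeas (fun x => f x - g x) := by
  obtain ⟨hm, C, hC⟩ := hf
  obtain ⟨hm', C', hC'⟩ := hg
  exact ⟨hm.sub hm', C + C', fun x => (abs_sub _ _).trans (add_le_add (hC x) (hC' x))⟩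

lemma BddMeas.pow {f : α → ℝ} (hf : BddMeas f) (k : ℕ) : BddMeas (fun x => f x ^ k) := by
  obtain ⟨hm, C, hC⟩ := hf
  refine ⟨hm.pow_const k, C ^ k, fun x => ?_⟩
  rw [abs_pow]
  exact pow_le_pow_left₀ (abs_nonneg _) (hC x) k

lemma BddMeas.abs {f : α → ℝ} (hf : BddMeas f) : BddMeas (fun x => |f x|) := by
  obtain ⟨hm, C, hC⟩ := hf
  exact ⟨hm.abs, C, fun x => by simpa using hC x⟩

lemma BddMeas.comp {f : β → ℝ} (hf : BddMeas f) {g : α → β} (hg : Measurable g) :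
    BddMeas (fun x => f (g x)) :=
  ⟨hf.1.comp hg, hf.2.imp fun _ h x => h (g x)⟩

lemma abs_integral_le_const {μ : Measure α} [IsProbabilityMeasure μ] {f : α → ℝ} {C : ℝ}
    (h : ∀ x, |f x| ≤ C) : |∫ x, f x ∂μ| ≤ C := by
  have : ∀ᵐ x ∂μ, ‖f x‖ ≤ C := ae_of_all _ h
  simpa using norm_integral_le_of_norm_le_const this

lemma BddMeas.integral_left {f : α × β → ℝ} (hf : BddMeas f) (μ : Measure α)
    [IsProbabilityMeasure μ] : BddMeas (fun b => ∫ a, f (a, b) ∂μ) := by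
  obtain ⟨hm, C, hC⟩ := hf
  refine ⟨(hm.stronglyMeasurable.integral_prod_left' (μ := μ)).measurable, C,
    fun b => abs_integral_le_const fun a => hC (a, b)⟩

lemma sq_integral_le {μ : Measure α} [IsProbabilityMeasure μ] {f : α → ℝ}
    (hf : Integrable f μ) (hf2 : Integrable (fun x => f x ^ 2) μ) :
    (∫ x, f x ∂μ) ^ 2 ≤ ∫ x, f x ^ 2 ∂μ := by
  set m := ∫ x, f x ∂μ with hm
  have h : HasMean μ (fun x => (f x - m) ^ 2) (∫ x, f x ^ 2 ∂μ - 2 * m * m + m ^ 2) :=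
    ((hf2.hasMean.sub (hf.hasMean.const_mul (2 * m))).add (.const (m ^ 2))).congr
      (fun x => by ring) rfl
  have := h.2 ▸ integral_nonneg (μ := μ) (f := fun x => (f x - m) ^ 2) fun x => sq_nonneg _
  nlinarith

lemma sq_integral_abs_le {μ : Measure α} [IsProbabilityMeasure μ] {f : α → ℝ}
    (hf : Integrable f μ) (hf2 : Integrable (fun x => f x ^ 2) μ) :
    (∫ x, |f x| ∂μ) ^ 2 ≤ ∫ x, f x ^ 2 ∂μ := by
  have := sq_integral_le hf.abs (by simpa using hf2)
  simpa using this

variable {μ : Measure α} {ν : Measure β} [IsProbabilityMeasure μ] [IsProbabilityMeasure ν]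

/-- The mean minimises the quadratic deviation, so a variance may be bounded by centring at any
convenient constant. -/
lemma integral_sub_mean_sq_le (f : α → ℝ) (hf : BddMeas f) (c : ℝ) :
    ∫ x, (f x - ∫ y, f y ∂μ) ^ 2 ∂μ ≤ ∫ x, (f x - c) ^ 2 ∂μ := by
  set m := ∫ x, f x ∂μ with hm
  have h1 := ((hf.sub (.const c)).pow 2).integrable μ |>.hasMean
  have h2 := (hf.integrable μ).hasMean
  have h : HasMean μ (fun x => (f x - m) ^ 2)
      (∫ x, (f x - c) ^ 2 ∂μ + 2 * (c - m) * m + (m ^ 2 - c ^ 2)) :=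
    ((h1.add (h2.const_mul (2 * (c - m)))).add (.const (m ^ 2 - c ^ 2))).congr
      (fun x => by ring) rfl
  rw [h.2]
  nlinarith [sq_nonneg (m - c)]

/-- Law of total variance and third central moment on a product space. -/
lemma moments_prod_le {g : α × β → ℝ} (hg : BddMeas g) {v b V T m : ℝ}
    (hv : ∀ y, ∫ a, (g (a, y) - ∫ a', g (a', y) ∂μ) ^ 2 ∂μ ≤ v)
    (hb : ∀ a y, |g (a, y) - ∫ a', g (a', y) ∂μ| ≤ b)
    (hV : ∫ y, (∫ a, g (a, y) ∂μ - m) ^ 2 ∂ν ≤ V)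
    (hT : |∫ y, (∫ a, g (a, y) ∂μ - m) ^ 3 ∂ν| ≤ T) :
    ∫ z, (g z - m) ^ 2 ∂(μ.prod ν) ≤ V + v ∧
      |∫ z, (g z - m) ^ 3 ∂(μ.prod ν)| ≤ T + v * (3 * (1 + V) + b) := by
  -- Here h is the conditional mean given y. Expand powers of g − m = (g − h) + (h − m); terms
  -- linear in g − h integrate to zero over the first factor, leaving d2 + (h − m)² and d3 + 3(h −
  -- m) d2 + (h − m)³.
  set h : β → ℝ := fun y => ∫ a, g (a, y) ∂μ with hh
  have hhB : BddMeas h := hg.integral_left μ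
  have hgy : ∀ y, BddMeas fun a => g (a, y) := fun y => hg.comp (by fun_prop)
  have hD1 : ∀ y, HasMean μ (fun a => g (a, y) - h y) 0 := fun y =>
    (((hgy y).integrable μ).hasMean.sub (.const (h y))).congr (fun _ => rfl) (by simp [hh])
  have hD2 := fun y => (((hgy y).sub (.const (h y))).pow 2 |>.integrable μ).hasMean
  have hD3 := fun y => (((hgy y).sub (.const (h y))).pow 3 |>.integrable μ).hasMean
  set d2 : β → ℝ := fun y => ∫ a, (g (a, y) - h y) ^ 2 ∂μ with hd2
  set d3 : β → ℝ := fun y => ∫ a, (g (a, y) - h y) ^ 3 ∂μ with hd3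
  have hgh : BddMeas fun z : α × β => g z - h z.2 := hg.sub (hhB.comp measurable_snd)
  have hd2B : BddMeas d2 := (hgh.pow 2).integral_left μ
  have hd3B : BddMeas d3 := (hgh.pow 3).integral_left μ
  have hX : BddMeas fun y => h y - m := hhB.sub (.const m)
  have d2n : ∀ y, 0 ≤ d2 y := fun y => integral_nonneg fun a => sq_nonneg _
  have hb' : ∀ y, |d3 y| ≤ b * d2 y := by
    intro y
    refine (abs_integral_le_integral_abs).trans ?_
    rw [hd2, ← integral_const_mul]
    refine integral_mono (((((hgy y).sub (.const (h y))).pow 3).abs).integrable μ)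
      ((((hgy y).sub (.const (h y))).pow 2 |>.integrable μ).const_mul b) fun a => ?_
    have := hb a y
    simp only
    rw [pow_succ, abs_mul, abs_of_nonneg (sq_nonneg _), mul_comm]
    exact mul_le_mul_of_nonneg_right this (sq_nonneg _)
  have hinner2 : ∀ y, ∫ a, (g (a, y) - m) ^ 2 ∂μ = d2 y + (h y - m) ^ 2 := by
    intro y
    refine (HasMean.congr (((hD2 y).add ((hD1 y).const_mul (2 * (h y - m)))).add
      (.const ((h y - m) ^ 2))) (fun a => ?_) ?_).2
    · ring
    · ring
  have hinner3 : ∀ y, ∫ a, (g (a, y) - m) ^ 3 ∂μ =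
      d3 y + 3 * (h y - m) * d2 y + (h y - m) ^ 3 := by
    intro y
    refine (HasMean.congr ((((hD3 y).add ((hD2 y).const_mul (3 * (h y - m)))).add
      ((hD1 y).const_mul (3 * (h y - m) ^ 2))).add (.const ((h y - m) ^ 3))) (fun a => ?_) ?_).2
    · ring
    · simp only [hd2, hd3]
      ring
  have hF : ∀ k, ∫ z, (g z - m) ^ k ∂(μ.prod ν) = ∫ y, ∫ a, (g (a, y) - m) ^ k ∂μ ∂ν := by
    intro k
    rw [integral_prod_symm _ (((hg.sub (.const m)).pow k).integrable _)]
  have hXX := (((hX.pow 2)).integrable ν).hasMean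
  have hb0 : 0 ≤ v := by
    obtain ⟨y⟩ : Nonempty β := nonempty_of_isProbabilityMeasure ν
    exact (d2n y).trans (hv y)
  have hbb : 0 ≤ b := by
    obtain ⟨y⟩ : Nonempty β := nonempty_of_isProbabilityMeasure ν
    obtain ⟨a⟩ : Nonempty α := nonempty_of_isProbabilityMeasure μ
    exact (abs_nonneg _).trans (hb a y)
  constructor
  · rw [hF 2]
    simp_rw [hinner2]
    rw [((hd2B.integrable ν).hasMean.add hXX).2]
    have : ∫ y, d2 y ∂ν ≤ v := by
      have := integral_mono (hd2B.integrable ν) (integrable_const v) hv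
      simpa using this
    linarith
  · rw [hF 3]
    simp_rw [hinner3]
    have i1 := (hd3B.integrable ν).hasMean
    have i2B : BddMeas fun y => 3 * (h y - m) * d2 y := ((BddMeas.const 3).mul hX).mul hd2B
    have i2 := (i2B.integrable ν).hasMean
    have i3 := ((hX.pow 3).integrable ν).hasMean
    rw [((i1.add i2).add i3).2]
    have e1 : |∫ y, d3 y ∂ν| ≤ b * v := by
      refine (abs_integral_le_integral_abs).trans ?_
      have := integral_mono (hd3B.abs.integrable ν) (integrable_const (b * v)) fun y =>
        (hb' y).trans (mul_le_mul_of_nonneg_left (hv y) hbb)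
      simpa using this
    have e2 : |∫ y, 3 * (h y - m) * d2 y ∂ν| ≤ 3 * v * (1 + V) := by
      refine (abs_integral_le_integral_abs).trans ?_
      have hI := (HasMean.const (P := ν) 1).add hXX |>.const_mul (3 * v)
      have : ∫ y, |3 * (h y - m) * d2 y| ∂ν ≤ ∫ y, 3 * v * (1 + (h y - m) ^ 2) ∂ν := by
        refine integral_mono (i2B.abs.integrable ν) hI.1 fun y => ?_
        simp only
        rw [abs_mul, abs_mul, abs_of_nonneg (d2n y), abs_of_nonneg (by norm_num : (0:ℝ) ≤ 3)]
        -- Trades a first absolute moment for the variance V already under control; this is where 1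
        -- + V in the bound comes from.
        have h1 : |h y - m| ≤ 1 + (h y - m) ^ 2 := by
          rw [← sq_abs (h y - m)]
          nlinarith [sq_nonneg (|h y - m| - 1), abs_nonneg (h y - m)]
        calc 3 * |h y - m| * d2 y ≤ 3 * (1 + (h y - m) ^ 2) * v := by
              gcongr
              exact hv y
          _ = _ := by ring
      refine this.trans ?_
      rw [hI.2]
      gcongr
    calc _ ≤ |∫ y, d3 y ∂ν| + |∫ y, 3 * (h y - m) * d2 y ∂ν| + |∫ y, (h y - m) ^ 3 ∂ν| :=
          (abs_add_le _ _).trans (by gcongr; exact abs_add_le _ _)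
      _ ≤ b * v + 3 * v * (1 + V) + T := by gcongr
      _ = _ := by ring

lemma BddMeas.update {n : ℕ} {f : (Fin n → α) → ℝ} (hf : BddMeas f) (X : Fin n → α) (k : Fin n) :
    BddMeas fun x => f (Function.update X k x) :=
  hf.comp (measurable_update X)

lemma measurable_cons {n : ℕ} :
    Measurable fun z : α × (Fin n → α) => (Fin.cons z.1 z.2 : Fin (n + 1) → α) := by
  refine measurable_pi_iff.mpr fun i => ?_
  refine Fin.cases ?_ (fun j => ?_) i
  · simpa using measurable_fst
  · simp only [Fin.cons_succ]
    exact (measurable_pi_apply j).comp measurable_snd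

variable (μ) in
lemma measurePreserving_cons (n : ℕ) :
    MeasurePreserving (fun z : α × (Fin n → α) => (Fin.cons z.1 z.2 : Fin (n + 1) → α))
      (μ.prod (Measure.pi fun _ : Fin n => μ)) (Measure.pi fun _ : Fin (n + 1) => μ) := by
  have := (measurePreserving_piFinSuccAbove (fun _ : Fin (n + 1) => μ) 0).symm
  convert this using 1
  ext z i
  simp [MeasurableEquiv.piFinSuccAbove, Fin.insertNthEquiv]

lemma integral_pi_cons {n : ℕ} {f : (Fin (n + 1) → α) → ℝ} (hf : Measurable f) :
    ∫ X, f X ∂(Measure.pi fun _ : Fin (n + 1) => μ) =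
      ∫ z : α × (Fin n → α), f (Fin.cons z.1 z.2) ∂(μ.prod (Measure.pi fun _ : Fin n => μ)) := by
  rw [← (measurePreserving_cons μ n).map_eq, integral_map
    measurable_cons.aemeasurable hf.aestronglyMeasurable]

/-- Efron–Stein inequality and its analogue for the third central moment, for bounded functions
of i.i.d. variables. -/
theorem moments_pi_le (n : ℕ) {f : (Fin n → α) → ℝ} (hf : BddMeas f) {v b : ℝ}
    (hv : ∀ k X, ∫ x, (f (Function.update X k x) - ∫ x', f (Function.update X k x') ∂μ) ^ 2 ∂μ ≤ v)
    (hb : ∀ k X x, |f (Function.update X k x) - ∫ x', f (Function.update X k x') ∂μ| ≤ b) :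
    ∫ X, (f X - ∫ X', f X' ∂(Measure.pi fun _ => μ)) ^ 2 ∂(Measure.pi fun _ => μ) ≤ n * v ∧
    |∫ X, (f X - ∫ X', f X' ∂(Measure.pi fun _ => μ)) ^ 3 ∂(Measure.pi fun _ => μ)| ≤
      n * (v * (3 * (1 + n * v) + b)) := by
  induction n with
  | zero =>
    have h : ∀ X, f X = f default := fun X => congrArg f (Subsingleton.elim _ _)
    simp_rw [h]
    simp
  | succ n ih =>
    -- The first coordinate is averaged out: the induction hypothesis handles the conditional mean h
    -- on the remaining coordinates, and `moments_prod_le` restores the first one.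
    set π : Measure (Fin n → α) := Measure.pi fun _ => μ with hπ
    set g : α × (Fin n → α) → ℝ := fun z => f (Fin.cons z.1 z.2) with hgdef
    have hg : BddMeas g := hf.comp measurable_cons
    set h : (Fin n → α) → ℝ := fun y => ∫ a, g (a, y) ∂μ with hhdef
    have hh : BddMeas h := hg.integral_left μ
    have hmean : ∫ X, f X ∂(Measure.pi fun _ : Fin (n + 1) => μ) = ∫ y, h y ∂π := by
      rw [integral_pi_cons hf.1, integral_prod_symm _ (hg.integrable _)]
    have hupd : ∀ (k : Fin n) (Y : Fin n → α) (a x : α),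
        g (a, Function.update Y k x) = f (Function.update (Fin.cons a Y) k.succ x) := by
      intro k Y a x
      simp only [hgdef, Fin.cons_update]
    have hgB : ∀ (k : Fin n) (Y : Fin n → α),
        BddMeas fun z : α × α => g (z.1, Function.update Y k z.2) := fun k Y =>
      hg.comp (measurable_fst.prodMk ((measurable_update Y).comp measurable_snd))
    have hswap : ∀ (k : Fin n) (Y : Fin n → α), ∫ x, h (Function.update Y k x) ∂μ =
        ∫ a, ∫ x, f (Function.update (Fin.cons a Y) k.succ x) ∂μ ∂μ := by
      intro k Y
      simp only [hhdef]
      rw [integral_integral_swap]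
      · simp_rw [hupd]
      · exact ((hgB k Y).comp measurable_swap).integrable _
    -- An increment of the averaged function is the average of the increments of f, so the uniform
    -- bound b passes to h directly and the variance bound v passes by Jensen's inequality and
    -- Fubini.
    have hdiff : ∀ (k : Fin n) (Y : Fin n → α) (x : α),
        h (Function.update Y k x) - ∫ x', h (Function.update Y k x') ∂μ =
          ∫ a, (f (Function.update (Fin.cons a Y) k.succ x) -
            ∫ x', f (Function.update (Fin.cons a Y) k.succ x') ∂μ) ∂μ := by
      intro k Y x
      rw [hswap, integral_sub]
      · simp only [hhdef, hupd]
      · simp_rw [← hupd]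
        exact ((hgB k Y).comp (measurable_id.prodMk measurable_const)).integrable _
      · simp_rw [← hupd]
        exact (((hgB k Y).comp measurable_swap).integral_left μ).integrable _
    have hDB : ∀ (k : Fin n) (Y : Fin n → α), BddMeas fun z : α × α =>
        f (Function.update (Fin.cons z.1 Y) k.succ z.2) -
            ∫ x', f (Function.update (Fin.cons z.1 Y) k.succ x') ∂μ := by
      intro k Y
      simp_rw [← hupd]
      exact (hgB k Y).sub
        ((((hgB k Y).comp measurable_swap).integral_left μ).comp measurable_fst)
    have hih := ih hh (fun k Y => by
      simp_rw [hdiff]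
      have hm := hDB k Y
      calc _ ≤ ∫ x, ∫ a, (f (Function.update (Fin.cons a Y) k.succ x) -
              ∫ x', f (Function.update (Fin.cons a Y) k.succ x') ∂μ) ^ 2 ∂μ ∂μ := by
            refine integral_mono (((hm.integral_left μ).pow 2).integrable μ)
              (((hm.pow 2).integral_left μ).integrable μ) fun x => ?_
            have hx := hm.comp (measurable_id.prodMk (measurable_const (a := x)))
            exact sq_integral_le (hx.integrable μ) ((hx.pow 2).integrable μ)
        _ = ∫ a, ∫ x, (f (Function.update (Fin.cons a Y) k.succ x) -
              ∫ x', f (Function.update (Fin.cons a Y) k.succ x') ∂μ) ^ 2 ∂μ ∂μ := by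
            rw [integral_integral_swap]
            exact ((hm.pow 2).comp measurable_swap).integrable _
        _ ≤ ∫ _a, v ∂μ := by
            refine integral_mono ((((hm.pow 2).comp measurable_swap).integral_left μ).integrable μ)
              (integrable_const v) fun a => hv k.succ (Fin.cons a Y)
        _ = v := by simp) (fun k Y x => by
      rw [hdiff]
      exact abs_integral_le_const fun a => hb k.succ (Fin.cons a Y) x)
    have hcons0 : ∀ (a : α) (Y : Fin n → α) (x : α),
        g (x, Y) = f (Function.update (Fin.cons a Y) 0 x) := by
      intro a Y x
      simp only [hgdef, Fin.update_cons_zero]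
    have hne : Nonempty α := nonempty_of_isProbabilityMeasure μ
    have hstep := moments_prod_le (μ := μ) (ν := π) hg (m := ∫ y, h y ∂π) (v := v) (b := b)
      (fun Y => by
        simp_rw [hcons0 hne.some Y]
        exact hv 0 _)
      (fun a Y => by
        simp_rw [hcons0 hne.some Y]
        exact hb 0 _ _) hih.1 hih.2
    rw [hmean]
    have hc : ∀ k : ℕ, ∫ X, (f X - ∫ y, h y ∂π) ^ k ∂(Measure.pi fun _ : Fin (n + 1) => μ) =
        ∫ z, (g z - ∫ y, h y ∂π) ^ k ∂(μ.prod π) := fun k =>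
      integral_pi_cons ((hf.sub (.const _)).pow k).1
    rw [hc 2, hc 3]
    refine ⟨hstep.1.trans (le_of_eq (by push_cast; ring)), hstep.2.trans ?_⟩
    push_cast
    have hn : (0 : ℝ) ≤ n := n.cast_nonneg
    have h1 : 0 ≤ n * v ^ 2 := by positivity
    have h2 : 0 ≤ v ^ 2 := by positivity
    nlinarith

end Tensorization

/-! ### Replacing one coordinate by an independent copy. -/

section Resampling

variable {α : Type*} [MeasurableSpace α] {μ : Measure α} [IsProbabilityMeasure μ]

lemma measurable_update_prod {n : ℕ} (k : Fin n) :
    Measurable fun z : (Fin n → α) × α => Function.update z.1 k z.2 := by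
  refine measurable_pi_iff.mpr fun i => ?_
  by_cases h : i = k
  · subst h
    simpa using measurable_snd
  · simp only [Function.update_of_ne h]
    exact (measurable_pi_apply i).comp measurable_fst

-- Lets one integrate over a single column while the others, and hence the leave-one-out resolvent,
-- stay frozen.
variable (μ) in
lemma measurePreserving_update {n : ℕ} (k : Fin n) :
    MeasurePreserving (fun z : (Fin n → α) × α => Function.update z.1 k z.2)
      ((Measure.pi fun _ : Fin n => μ).prod μ) (Measure.pi fun _ : Fin n => μ) := by
  refine ⟨measurable_update_prod k, ?_⟩
  refine (Measure.pi_eq fun s hs => ?_).symm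
  rw [Measure.map_apply (measurable_update_prod k) (MeasurableSet.univ_pi hs)]
  have : (fun z : (Fin n → α) × α => Function.update z.1 k z.2) ⁻¹' Set.univ.pi s =
      (Set.univ.pi (Function.update s k Set.univ)) ×ˢ s k := by
    ext z
    simp only [Set.mem_preimage, Set.mem_univ_pi, Set.mem_prod]
    constructor
    · intro h
      refine ⟨fun i => ?_, by simpa using h k⟩
      by_cases hi : i = k
      · subst hi; simp
      · simpa [Function.update_of_ne hi] using h i
    · rintro ⟨h1, h2⟩ i
      by_cases hi : i = k
      · subst hi; simpa using h2
      · simpa [Function.update_of_ne hi] using h1 i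
  rw [this, Measure.prod_prod, Measure.pi_pi]
  rw [← Finset.prod_erase_mul _ _ (Finset.mem_univ k), ← Finset.prod_erase_mul _ (fun i => μ (s i))
    (Finset.mem_univ k)]
  simp only [Function.update_self, measure_univ, mul_one]
  congr 1
  refine Finset.prod_congr rfl fun i hi => ?_
  rw [Function.update_of_ne (Finset.ne_of_mem_erase hi)]

end Resampling

end LMMSE

namespace LMMSE

/-! ### The functions F and G of the deterministic system, and its stability. -/

section DeterministicSystem

variable {ι κ : Type*} [Fintype ι] [Fintype κ]

/-- The function `x ↦ s ∑ᵢ dᵢ / (r + x dᵢ)`. -/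
noncomputable def stieltjesSum (s r : ℝ) (d : ι → ℝ) (x : ℝ) : ℝ := s * ∑ i, d i / (r + x * d i)

variable {s r x y : ℝ} {d : ι → ℝ}

omit [Fintype ι] in
lemma add_mul_pos_of_nonneg (hr : 0 < r) (hd : ∀ i, 0 ≤ d i) (hx : 0 ≤ x) (i : ι) :
    0 < r + x * d i := by
  have := mul_nonneg hx (hd i)
  linarith

lemma stieltjesSum_nonneg (hs : 0 ≤ s) (hr : 0 < r) (hd : ∀ i, 0 ≤ d i) (hx : 0 ≤ x) :
    0 ≤ stieltjesSum s r d x :=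
  mul_nonneg hs (Finset.sum_nonneg fun i _ =>
    div_nonneg (hd i) (add_mul_pos_of_nonneg hr hd hx i).le)

lemma stieltjesSum_anti (hs : 0 ≤ s) (hr : 0 < r) (hd : ∀ i, 0 ≤ d i) (hx : 0 ≤ x) (hxy : x ≤ y) :
    stieltjesSum s r d y ≤ stieltjesSum s r d x := by
  refine mul_le_mul_of_nonneg_left (Finset.sum_le_sum fun i _ => ?_) hs
  have := add_mul_pos_of_nonneg hr hd hx i
  have := hd i
  gcongr

/-- Each term x d/(r + x d) increases in x. Together with the decrease of the sum itself, this
monotonicity drives uniqueness. -/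
lemma mul_stieltjesSum_mono (hs : 0 ≤ s) (hr : 0 < r) (hd : ∀ i, 0 ≤ d i) (hx : 0 ≤ x)
    (hxy : x ≤ y) : x * stieltjesSum s r d x ≤ y * stieltjesSum s r d y := by
  unfold stieltjesSum
  rw [mul_left_comm, mul_left_comm y, Finset.mul_sum (a := x), Finset.mul_sum (a := y)]
  refine mul_le_mul_of_nonneg_left (Finset.sum_le_sum fun i _ => ?_) hs
  have h1 := add_mul_pos_of_nonneg hr hd hx i
  have h2 := add_mul_pos_of_nonneg hr hd (hx.trans hxy) i
  rw [← mul_div_assoc, ← mul_div_assoc, div_le_div_iff₀ h1 h2]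
  nlinarith [mul_nonneg hr.le (hd i), mul_nonneg (mul_nonneg hr.le (hd i)) (sub_nonneg.mpr hxy)]

lemma stieltjesSum_zero_le {dm S : ℝ} (hs : 0 ≤ s) (hr : 0 < r) (hd : ∀ i, d i ≤ dm)
    (hdm : 0 ≤ dm) (hS : s * Fintype.card ι ≤ S) : stieltjesSum s r d 0 ≤ S * dm / r := by
  have h : ∑ i, d i / (r + 0 * d i) ≤ Fintype.card ι * (dm / r) := by
    rw [← nsmul_eq_mul, ← Finset.card_univ]
    refine Finset.sum_le_card_nsmul _ _ _ fun i _ => ?_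
    rw [zero_mul, add_zero]
    exact div_le_div_of_nonneg_right (hd i) hr.le
  calc _ ≤ s * (Fintype.card ι * (dm / r)) := mul_le_mul_of_nonneg_left h hs
    _ = s * Fintype.card ι * (dm / r) := by ring
    _ ≤ S * (dm / r) := by gcongr
    _ = _ := by ring

lemma stieltjesSum_ge {dm c X : ℝ} (hs : 0 ≤ s) (hr : 0 < r) (hd : ∀ i, 0 ≤ d i)
    (hd' : ∀ i, d i ≤ dm) (hc : c ≤ s * ∑ i, d i) (hx : 0 ≤ x) (hxX : x ≤ X) (hdm : 0 ≤ dm) :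
    c / (r + X * dm) ≤ stieltjesSum s r d x := by
  have hX : 0 < r + X * dm := by have := mul_nonneg (hx.trans hxX) hdm; linarith
  calc c / (r + X * dm) ≤ (s * ∑ i, d i) / (r + X * dm) := by gcongr
    _ = s * ∑ i, d i / (r + X * dm) := by rw [mul_div_assoc, Finset.sum_div]
    _ ≤ _ := by
      refine mul_le_mul_of_nonneg_left (Finset.sum_le_sum fun i _ => ?_) hs
      have := add_mul_pos_of_nonneg hr hd hx i
      have h3 := hd i
      have h4 := hd' i
      have h5 := hx.trans hxX
      gcongr

/-- Over a common denominator, the numerator of each term is d(r(e₂ − e₁) + d(e₂x₂ − e₁x₁)). The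
second part is nonnegative by hypothesis, and the first alone gives the linear lower bound. -/
lemma stieltjesSum_gap {dm c X e₁ e₂ x₁ x₂ : ℝ} (hs : 0 ≤ s) (hr : 0 < r) (hd : ∀ i, 0 ≤ d i)
    (hd' : ∀ i, d i ≤ dm) (hc : c ≤ s * ∑ i, d i) (hx₁ : 0 ≤ x₁) (hx₁X : x₁ ≤ X)
    (hx₂ : 0 ≤ x₂) (hx₂X : x₂ ≤ X) (hdm : 0 ≤ dm) (he : e₁ ≤ e₂) (hex : e₁ * x₁ ≤ e₂ * x₂) :
    c * r / (r + X * dm) ^ 2 * (e₂ - e₁) ≤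
      e₂ * stieltjesSum s r d x₁ - e₁ * stieltjesSum s r d x₂ := by
  have hX0 := hx₁.trans hx₁X
  have hX : 0 < r + X * dm := by have := mul_nonneg hX0 hdm; linarith
  have hterm : ∀ i, d i * (r / (r + X * dm) ^ 2 * (e₂ - e₁)) ≤
      e₂ * (d i / (r + x₁ * d i)) - e₁ * (d i / (r + x₂ * d i)) := by
    intro i
    have h1 := add_mul_pos_of_nonneg hr hd hx₁ i
    have h2 := add_mul_pos_of_nonneg hr hd hx₂ i
    have h3 := hd i
    have h4 := hd' i
    have e : e₂ * (d i / (r + x₁ * d i)) - e₁ * (d i / (r + x₂ * d i)) =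
        d i * (r * (e₂ - e₁) + d i * (e₂ * x₂ - e₁ * x₁)) /
          ((r + x₁ * d i) * (r + x₂ * d i)) := by
      field_simp
      ring
    rw [e]
    have h5 : (r + x₁ * d i) * (r + x₂ * d i) ≤ (r + X * dm) ^ 2 := by
      rw [sq]; gcongr
    have h6 : 0 ≤ d i * (e₂ * x₂ - e₁ * x₁) := mul_nonneg h3 (sub_nonneg.mpr hex)
    have h7 : 0 ≤ r * (e₂ - e₁) := mul_nonneg hr.le (sub_nonneg.mpr he)
    calc d i * (r / (r + X * dm) ^ 2 * (e₂ - e₁)) = d i * (r * (e₂ - e₁)) / (r + X * dm) ^ 2 := by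
          ring
      _ ≤ d i * (r * (e₂ - e₁)) / ((r + x₁ * d i) * (r + x₂ * d i)) := by gcongr
      _ ≤ _ := by gcongr; linarith
  have hsum := Finset.sum_le_sum fun i (_ : i ∈ Finset.univ) => hterm i
  rw [← Finset.sum_mul, Finset.sum_sub_distrib, ← Finset.mul_sum, ← Finset.mul_sum] at hsum
  have h8 : 0 ≤ r / (r + X * dm) ^ 2 * (e₂ - e₁) := by
    have := sub_nonneg.mpr he
    positivity
  calc _ = c * (r / (r + X * dm) ^ 2 * (e₂ - e₁)) := by ring
    _ ≤ (s * ∑ i, d i) * (r / (r + X * dm) ^ 2 * (e₂ - e₁)) := by gcongr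
    _ = s * ((∑ i, d i) * (r / (r + X * dm) ^ 2 * (e₂ - e₁))) := by ring
    _ ≤ s * _ := mul_le_mul_of_nonneg_left hsum hs
    _ = _ := by unfold stieltjesSum; ring

variable {q : κ → ℝ}

/-- Quantitative uniqueness for the approximate solutions of `e = F (t + G e)`. -/
lemma stieltjesSum_stability {dm c X E t e₁ e₂ r₁ r₂ : ℝ} (hs : 0 ≤ s) (hr : 0 < r)
    (hd : ∀ i, 0 ≤ d i) (hd' : ∀ i, d i ≤ dm) (hdm : 0 ≤ dm) (hq : ∀ k, 0 ≤ q k)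
    (hc : c ≤ s * ∑ i, d i) (ht : 0 ≤ t) (hX : t + stieltjesSum s 1 q 0 ≤ X)
    (he₁ : 0 ≤ e₁) (he₁' : e₁ ≤ E) (he₂ : 0 ≤ e₂) (he₂' : e₂ ≤ E)
    (hr₁ : |e₁ - stieltjesSum s r d (t + stieltjesSum s 1 q e₁)| ≤ r₁)
    (hr₂ : |e₂ - stieltjesSum s r d (t + stieltjesSum s 1 q e₂)| ≤ r₂) :
    c * r / (r + X * dm) ^ 2 * |e₁ - e₂| ≤ E * (r₁ + r₂) := by
  wlog h : e₁ ≤ e₂ generalizing e₁ e₂ r₁ r₂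
  · rw [abs_sub_comm, add_comm r₁]
    exact this he₂ he₂' he₁ he₁' hr₂ hr₁ (le_of_not_ge h)
  have hG1 := stieltjesSum_nonneg hs one_pos hq he₁
  have hG2 := stieltjesSum_nonneg hs one_pos hq he₂
  have hG1' := stieltjesSum_anti hs one_pos hq le_rfl he₁
  have hG2' := stieltjesSum_anti hs one_pos hq le_rfl he₂
  -- With x_i = t + G(e_i), monotonicity of e·G(e) gives e₁x₁ ≤ e₂x₂, as the gap lemma requires. For
  -- exact solutions e₂F(x₁) − e₁F(x₂) = e₂e₁ − e₁e₂ = 0, so only residuals can compensate for the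
  -- gap.
  have hm := mul_stieltjesSum_mono hs one_pos hq he₁ h
  have hgap := stieltjesSum_gap (x₁ := t + stieltjesSum s 1 q e₁)
    (x₂ := t + stieltjesSum s 1 q e₂) (X := X) hs hr hd hd' hc (by linarith) (by linarith)
    (by linarith) (by linarith) hdm h (by nlinarith)
  rw [abs_sub_comm, abs_of_nonneg (sub_nonneg.mpr h)]
  refine hgap.trans ?_
  rw [abs_le] at hr₁ hr₂
  have hr1 : 0 ≤ r₁ := by linarith [hr₁.1, hr₁.2]
  have hr2 : 0 ≤ r₂ := by linarith [hr₂.1, hr₂.2]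
  nlinarith [mul_le_mul_of_nonneg_left hr₁.2 he₂, mul_le_mul_of_nonneg_left hr₁.1 he₂,
    mul_le_mul_of_nonneg_left hr₂.2 he₁, mul_le_mul_of_nonneg_left hr₂.1 he₁,
    mul_le_mul_of_nonneg_right he₂' hr1, mul_le_mul_of_nonneg_right he₁' hr2]

lemma continuousOn_stieltjesSum (hr : 0 < r) (hd : ∀ i, 0 ≤ d i) :
    ContinuousOn (stieltjesSum s r d) (Set.Ici 0) := by
  unfold stieltjesSum
  refine continuousOn_const.mul (continuousOn_finsetSum _ fun i _ => ?_)
  exact continuousOn_const.div (by fun_prop) fun x hx => (add_mul_pos_of_nonneg hr hd hx i).ne'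

/-- Intermediate value theorem on [0, F(0)]: the composite F∘G takes nonnegative values bounded by
F(0), because F is nonincreasing. -/
lemma exists_fixedPoint (hs : 0 ≤ s) (hr : 0 < r) (hd : ∀ i, 0 ≤ d i) (hq : ∀ k, 0 ≤ q k) :
    ∃ e, 0 ≤ e ∧ e = stieltjesSum s r d (stieltjesSum s 1 q e) := by
  set M := stieltjesSum s r d 0
  have hM : 0 ≤ M := stieltjesSum_nonneg hs hr hd le_rfl
  have hG0 : ∀ e, 0 ≤ e → 0 ≤ stieltjesSum s 1 q e := fun e he =>
    stieltjesSum_nonneg hs one_pos hq he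
  have hcont : ContinuousOn (fun e => stieltjesSum s r d (stieltjesSum s 1 q e) - e)
      (Set.Icc 0 M) := by
    refine ContinuousOn.sub ?_ continuousOn_id
    refine (continuousOn_stieltjesSum hr hd).comp
      ((continuousOn_stieltjesSum one_pos hq).mono fun e he => he.1) fun e he => hG0 e he.1
  have h0 : (0 : ℝ) ∈ Set.Icc (stieltjesSum s r d (stieltjesSum s 1 q M) - M)
      (stieltjesSum s r d (stieltjesSum s 1 q 0) - 0) := by
    constructor
    · have := stieltjesSum_anti hs hr hd le_rfl (hG0 M hM)
      linarith
    · have := stieltjesSum_nonneg hs hr hd (hG0 0 le_rfl)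
      linarith
  obtain ⟨e, he, heq⟩ := intermediate_value_Icc' hM hcont h0
  exact ⟨e, he.1, by simp only at heq; linarith⟩

/-- The coefficients of the Taylor expansion of `stieltjesSum`. -/
noncomputable def stieltjesCoeff (k : ℕ) (s r : ℝ) (d : ι → ℝ) (x : ℝ) : ℝ :=
  s * ∑ i, d i ^ (k + 1) / (r + x * d i) ^ (k + 1)

/-- With a = r + x d, each term is d/(a + d k), whose expansion in k is geometric, with exact
remainder −d⁴k³/(a³(a + d k)). Both denominators are at least r, so no smallness of k is needed. -/
lemma stieltjesSum_taylor {dm S : ℝ} (hs : 0 ≤ s) (hr : 0 < r) (hd : ∀ i, 0 ≤ d i)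
    (hd' : ∀ i, d i ≤ dm) (hS : s * Fintype.card ι ≤ S)
    (hx : 0 ≤ x) (k : ℝ) (hxk : 0 ≤ x + k) :
    |stieltjesSum s r d (x + k) - (stieltjesSum s r d x - stieltjesCoeff 1 s r d x * k +
      stieltjesCoeff 2 s r d x * k ^ 2)| ≤ S * (dm / r) ^ 4 * |k| ^ 3 := by
  have hterm : ∀ i, |d i / (r + (x + k) * d i) - (d i / (r + x * d i) -
      d i ^ (1 + 1) / (r + x * d i) ^ (1 + 1) * k + d i ^ (2 + 1) / (r + x * d i) ^ (2 + 1) * k ^ 2)|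
        ≤ (dm / r) ^ 4 * |k| ^ 3 := by
    intro i
    have h1 := add_mul_pos_of_nonneg hr hd hx i
    have h2 := add_mul_pos_of_nonneg hr hd hxk i
    have h1' : r ≤ r + x * d i := le_add_of_nonneg_right (mul_nonneg hx (hd i))
    have h2' : r ≤ r + (x + k) * d i := le_add_of_nonneg_right (mul_nonneg hxk (hd i))
    have e : d i / (r + (x + k) * d i) - (d i / (r + x * d i) -
        d i ^ (1 + 1) / (r + x * d i) ^ (1 + 1) * k +
          d i ^ (2 + 1) / (r + x * d i) ^ (2 + 1) * k ^ 2) =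
        -(d i ^ 4 * k ^ 3 / ((r + x * d i) ^ 3 * (r + (x + k) * d i))) := by
      have e2 : r + (x + k) * d i = (r + x * d i) + d i * k := by ring
      rw [e2] at h2 ⊢
      generalize r + x * d i = a at h1 h2
      have h1' := h1.ne'
      have h2' := h2.ne'
      field_simp
      ring
    rw [e, abs_neg, abs_div, abs_mul, abs_of_nonneg (pow_nonneg (hd i) 4), abs_pow,
      abs_of_pos (mul_pos (pow_pos h1 3) h2), div_pow, div_mul_eq_mul_div]
    have h3 : r ^ 4 ≤ (r + x * d i) ^ 3 * (r + (x + k) * d i) := by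
      rw [pow_succ]; gcongr
    have h4 := hd i
    have h5 := hd' i
    gcongr
  have hsum : |∑ i, (d i / (r + (x + k) * d i) - (d i / (r + x * d i) -
      d i ^ (1 + 1) / (r + x * d i) ^ (1 + 1) * k +
        d i ^ (2 + 1) / (r + x * d i) ^ (2 + 1) * k ^ 2))| ≤
      Fintype.card ι * ((dm / r) ^ 4 * |k| ^ 3) := by
    refine (Finset.abs_sum_le_sum_abs _ _).trans ?_
    rw [← nsmul_eq_mul, ← Finset.card_univ]
    exact Finset.sum_le_card_nsmul _ _ _ fun i _ => hterm i
  have e : stieltjesSum s r d (x + k) - (stieltjesSum s r d x - stieltjesCoeff 1 s r d x * k +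
      stieltjesCoeff 2 s r d x * k ^ 2) = s * ∑ i, (d i / (r + (x + k) * d i) -
      (d i / (r + x * d i) - d i ^ (1 + 1) / (r + x * d i) ^ (1 + 1) * k +
        d i ^ (2 + 1) / (r + x * d i) ^ (2 + 1) * k ^ 2)) := by
    simp only [stieltjesSum, stieltjesCoeff, Finset.sum_sub_distrib, Finset.sum_add_distrib,
      ← Finset.sum_mul]
    ring
  rw [e, abs_mul, abs_of_nonneg hs]
  calc _ ≤ s * (Fintype.card ι * ((dm / r) ^ 4 * |k| ^ 3)) := by gcongr
    _ = s * Fintype.card ι * ((dm / r) ^ 4 * |k| ^ 3) := by ring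
    _ ≤ S * ((dm / r) ^ 4 * |k| ^ 3) := by
        gcongr
    _ = _ := by ring

lemma stieltjesCoeff_nonneg (k : ℕ) (hs : 0 ≤ s) (hr : 0 < r) (hd : ∀ i, 0 ≤ d i) (hx : 0 ≤ x) :
    0 ≤ stieltjesCoeff k s r d x :=
  mul_nonneg hs (Finset.sum_nonneg fun i _ => div_nonneg (pow_nonneg (hd i) _)
    (pow_nonneg (add_mul_pos_of_nonneg hr hd hx i).le _))

lemma stieltjesCoeff_le {dm S : ℝ} (k : ℕ) (hs : 0 ≤ s) (hr : 0 < r) (hd : ∀ i, 0 ≤ d i)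
    (hd' : ∀ i, d i ≤ dm) (hdm : 0 ≤ dm) (hS : s * Fintype.card ι ≤ S) (hx : 0 ≤ x) :
    stieltjesCoeff k s r d x ≤ S * (dm / r) ^ (k + 1) := by
  have h : ∑ i, d i ^ (k + 1) / (r + x * d i) ^ (k + 1) ≤
      Fintype.card ι * (dm / r) ^ (k + 1) := by
    rw [← nsmul_eq_mul, ← Finset.card_univ]
    refine Finset.sum_le_card_nsmul _ _ _ fun i _ => ?_
    have h1 : r ≤ r + x * d i := le_add_of_nonneg_right (mul_nonneg hx (hd i))
    rw [← div_pow]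
    have h2 := hd i
    have h3 := hd' i
    have h4 := add_mul_pos_of_nonneg hr hd hx i
    gcongr
  calc _ ≤ s * (Fintype.card ι * (dm / r) ^ (k + 1)) := mul_le_mul_of_nonneg_left h hs
    _ = s * Fintype.card ι * (dm / r) ^ (k + 1) := by ring
    _ ≤ _ := by gcongr

/-- The coefficient is −F'(x), and F(x) + xF'(x) = s ∑ d r/(r + x d)² is bounded below. This strict
loss keeps the linearised system invertible in `Regime.gap`. -/
lemma stieltjesCoeff_one_mul_le {dm c X : ℝ} (hs : 0 ≤ s) (hr : 0 < r) (hd : ∀ i, 0 ≤ d i)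
    (hd' : ∀ i, d i ≤ dm) (hdm : 0 ≤ dm) (hc : c ≤ s * ∑ i, d i) (hx : 0 ≤ x) (hxX : x ≤ X) :
    stieltjesCoeff 1 s r d x * x ≤ stieltjesSum s r d x - c * r / (r + X * dm) ^ 2 := by
  have hX0 := hx.trans hxX
  have hX : 0 < r + X * dm := by have := mul_nonneg hX0 hdm; linarith
  have e : stieltjesSum s r d x - stieltjesCoeff 1 s r d x * x =
      s * ∑ i, d i * r / (r + x * d i) ^ 2 := by
    rw [stieltjesSum, stieltjesCoeff, mul_assoc, ← mul_sub, Finset.sum_mul,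
      ← Finset.sum_sub_distrib]
    congr 1
    refine Finset.sum_congr rfl fun i _ => ?_
    have h1 := (add_mul_pos_of_nonneg hr hd hx i).ne'
    have e2 : d i * r = d i * (r + x * d i) - x * d i ^ 2 := by ring
    rw [e2]
    generalize r + x * d i = a at h1
    field_simp
    ring
  have h : c * r / (r + X * dm) ^ 2 ≤ s * ∑ i, d i * r / (r + x * d i) ^ 2 := by
    calc _ ≤ (s * ∑ i, d i) * r / (r + X * dm) ^ 2 := by gcongr
      _ = s * ∑ i, d i * r / (r + X * dm) ^ 2 := by
          rw [mul_assoc, mul_div_assoc, Finset.sum_mul, Finset.sum_div]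
      _ ≤ _ := by
          refine mul_le_mul_of_nonneg_left (Finset.sum_le_sum fun i _ => ?_) hs
          have h1 := add_mul_pos_of_nonneg hr hd hx i
          have h2 := hd i
          have h3 := hd' i
          gcongr
  linarith

end DeterministicSystem

end LMMSE

namespace LMMSE

/-! ### Second-order expansion of the perturbed fixed point. -/

section DeterministicExpansion

/-- The second-order approximation of the solution of `h = F₁ k + F₂ k²`,
`k = t + G₁ h + G₂ h²`, up to cubic perturbations, has a cubic residual. -/
lemma cubic_residual {A F₁ F₂ G₁ G₂ h₁ h₂ t g v : ℝ} (hA : 1 ≤ A) (hF₁ : |F₁| ≤ A)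
    (hF₂ : |F₂| ≤ A) (hG₁ : |G₁| ≤ A) (hG₂ : |G₂| ≤ A) (hh₁ : |h₁| ≤ A) (hh₂ : |h₂| ≤ A)
    (e₁ : h₁ = F₁ * (1 + G₁ * h₁))
    (e₂ : h₂ = F₁ * (G₁ * h₂ + G₂ * h₁ ^ 2) + F₂ * (1 + G₁ * h₁) ^ 2)
    (ht : 0 ≤ t) (ht1 : t ≤ 1)
    (hg : |g - (G₁ * (h₁ * t + h₂ * t ^ 2) + G₂ * (h₁ * t + h₂ * t ^ 2) ^ 2)| ≤
      A * |h₁ * t + h₂ * t ^ 2| ^ 3)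
    (hv : |v - (F₁ * (t + g) + F₂ * (t + g) ^ 2)| ≤ A * |t + g| ^ 3) :
    |h₁ * t + h₂ * t ^ 2 - v| ≤ 3607 * A ^ 13 * t ^ 3 := by
  have hA0 : 0 ≤ A := by linarith
  have ht2 : t ^ 2 ≤ t := pow_le_of_le_one ht ht1 (by norm_num)
  have ht3 : t ^ 3 ≤ t ^ 2 := pow_le_pow_of_le_one ht ht1 (by norm_num)
  have ht4 : t ^ 4 ≤ t ^ 3 := pow_le_pow_of_le_one ht ht1 (by norm_num)
  have ht30 : 0 ≤ t ^ 3 := by positivity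
  set h := h₁ * t + h₂ * t ^ 2 with hh
  have bh : |h| ≤ 2 * A * t := by
    calc |h| ≤ |h₁| * t + |h₂| * t ^ 2 := by
          refine (abs_add_le _ _).trans ?_
          rw [abs_mul, abs_mul, abs_of_nonneg ht, abs_of_nonneg (sq_nonneg t)]
      _ ≤ A * t + A * t := by gcongr
      _ = _ := by ring
  have bRG : |g - (G₁ * h + G₂ * h ^ 2)| ≤ 8 * A ^ 4 * t ^ 3 := by
    refine hg.trans ?_
    calc A * |h| ^ 3 ≤ A * (2 * A * t) ^ 3 := by gcongr
      _ = _ := by ring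
  have bh12 : |2 * h₁ * h₂ * t ^ 3 + h₂ ^ 2 * t ^ 4| ≤ 3 * A ^ 2 * t ^ 3 := by
    calc _ ≤ 2 * |h₁| * |h₂| * t ^ 3 + |h₂| ^ 2 * t ^ 4 := by
          refine (abs_add_le _ _).trans (le_of_eq ?_)
          simp only [abs_mul, abs_pow, abs_of_nonneg ht, abs_two]
      _ ≤ 2 * A * A * t ^ 3 + A ^ 2 * t ^ 3 := by
          gcongr
      _ = _ := by ring
  set k₁ := 1 + G₁ * h₁ with hk₁
  set k₂ := G₁ * h₂ + G₂ * h₁ ^ 2 with hk₂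
  have p1 : 1 ≤ A ^ 2 := one_le_pow₀ hA
  have p3 : A ^ 2 ≤ A ^ 3 := pow_le_pow_right₀ hA (by norm_num)
  have p4 : A ^ 3 ≤ A ^ 4 := pow_le_pow_right₀ hA (by norm_num)
  have bk₁ : |k₁| ≤ 2 * A ^ 2 := by
    calc |k₁| ≤ 1 + |G₁| * |h₁| := by
          refine (abs_add_le _ _).trans ?_
          rw [abs_mul, abs_one]
      _ ≤ 1 + A * A := by gcongr
      _ = 1 + A ^ 2 := by ring
      _ ≤ _ := by linarith
  have bk₂ : |k₂| ≤ 2 * A ^ 3 := by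
    calc |k₂| ≤ |G₁| * |h₂| + |G₂| * |h₁| ^ 2 := by
          refine (abs_add_le _ _).trans ?_
          rw [abs_mul, abs_mul, abs_pow]
      _ ≤ A * A + A * A ^ 2 := by gcongr
      _ = A ^ 2 + A ^ 3 := by ring
      _ ≤ _ := by linarith
  set k := t + g with hk
  have brk : |k - (k₁ * t + k₂ * t ^ 2)| ≤ 11 * A ^ 4 * t ^ 3 := by
    have e : k - (k₁ * t + k₂ * t ^ 2) = G₂ * (2 * h₁ * h₂ * t ^ 3 + h₂ ^ 2 * t ^ 4) +
        (g - (G₁ * h + G₂ * h ^ 2)) := by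
      rw [hk, hk₁, hk₂, hh]; ring
    rw [e]
    calc _ ≤ |G₂| * |2 * h₁ * h₂ * t ^ 3 + h₂ ^ 2 * t ^ 4| + |g - (G₁ * h + G₂ * h ^ 2)| := by
          refine (abs_add_le _ _).trans ?_
          rw [abs_mul]
      _ ≤ A * (3 * A ^ 2 * t ^ 3) + 8 * A ^ 4 * t ^ 3 := by gcongr
      _ = (3 * A ^ 3 + 8 * A ^ 4) * t ^ 3 := by ring
      _ ≤ (3 * A ^ 4 + 8 * A ^ 4) * t ^ 3 := by gcongr
      _ = _ := by ring
  have bk1t : |k - k₁ * t| ≤ 13 * A ^ 4 * t ^ 2 := by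
    have e : k - k₁ * t = (k - (k₁ * t + k₂ * t ^ 2)) + k₂ * t ^ 2 := by ring
    rw [e]
    calc _ ≤ 11 * A ^ 4 * t ^ 3 + 2 * A ^ 3 * t ^ 2 := by
          refine (abs_add_le _ _).trans (add_le_add brk ?_)
          rw [abs_mul, abs_of_nonneg (sq_nonneg t)]
          gcongr
      _ ≤ 11 * A ^ 4 * t ^ 2 + 2 * A ^ 4 * t ^ 2 := by gcongr
      _ = _ := by ring
  have bk1t' : |k₁ * t| ≤ 2 * A ^ 4 * t := by
    rw [abs_mul, abs_of_nonneg ht]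
    have : 2 * A ^ 2 ≤ 2 * A ^ 4 := by linarith
    gcongr
    exact bk₁.trans this
  have bk : |k| ≤ 15 * A ^ 4 * t := by
    have e : k = (k - k₁ * t) + k₁ * t := by ring
    calc |k| ≤ |k - k₁ * t| + |k₁ * t| := by
          conv_lhs => rw [e]
          exact abs_add_le _ _
      _ ≤ 13 * A ^ 4 * t ^ 2 + 2 * A ^ 4 * t := add_le_add bk1t bk1t'
      _ ≤ 13 * A ^ 4 * t + 2 * A ^ 4 * t := by gcongr
      _ = _ := by ring
  have bsq : |k ^ 2 - (k₁ * t) ^ 2| ≤ 221 * A ^ 8 * t ^ 3 := by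
    have e : k ^ 2 - (k₁ * t) ^ 2 = (k - k₁ * t) * (k + k₁ * t) := by ring
    rw [e, abs_mul]
    calc _ ≤ (13 * A ^ 4 * t ^ 2) * (15 * A ^ 4 * t + 2 * A ^ 4 * t) := by
          refine mul_le_mul bk1t ((abs_add_le _ _).trans (add_le_add bk bk1t')) (abs_nonneg _) ?_
          positivity
      _ = _ := by ring
  have e : h - v = -(v - (F₁ * k + F₂ * k ^ 2)) - F₁ * (k - (k₁ * t + k₂ * t ^ 2)) -
      F₂ * (k ^ 2 - (k₁ * t) ^ 2) := by
    have e₁' : h₁ * t = F₁ * k₁ * t := by rw [← e₁]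
    have e₂' : h₂ * t ^ 2 = (F₁ * k₂ + F₂ * k₁ ^ 2) * t ^ 2 := by rw [← e₂]
    rw [hh]
    linear_combination e₁' + e₂'
  rw [e]
  -- The three error sources contribute 15³ = 3375 (cubic remainder in k), 11 (error in k) and 221 =
  -- 13·17 (error in k²), whose sum is 3607.
  have q1 : A ^ 5 ≤ A ^ 13 := pow_le_pow_right₀ hA (by norm_num)
  have q2 : A ^ 9 ≤ A ^ 13 := pow_le_pow_right₀ hA (by norm_num)
  calc _ ≤ |v - (F₁ * k + F₂ * k ^ 2)| + |F₁| * |k - (k₁ * t + k₂ * t ^ 2)| +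
        |F₂| * |k ^ 2 - (k₁ * t) ^ 2| := by
        refine (abs_sub _ _).trans (add_le_add ((abs_sub _ _).trans (add_le_add ?_ ?_)) ?_)
        · rw [abs_neg]
        · rw [abs_mul]
        · rw [abs_mul]
    _ ≤ A * (15 * A ^ 4 * t) ^ 3 + A * (11 * A ^ 4 * t ^ 3) + A * (221 * A ^ 8 * t ^ 3) := by
        refine add_le_add (add_le_add (hv.trans ?_) ?_) ?_ <;> gcongr
    _ = (3375 * A ^ 13 + 11 * A ^ 5 + 221 * A ^ 9) * t ^ 3 := by ring
    _ ≤ (3375 * A ^ 13 + 11 * A ^ 13 + 221 * A ^ 13) * t ^ 3 := by gcongr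
    _ = _ := by ring

/-- Uniform assumptions on the parameters of the deterministic system. -/
structure Regime {ι κ : Type*} [Fintype ι] [Fintype κ] (r dm pm c S s : ℝ) (d : ι → ℝ)
    (q : κ → ℝ) : Prop where
  s_nonneg : 0 ≤ s
  d_nonneg : ∀ i, 0 ≤ d i
  d_le : ∀ i, d i ≤ dm
  q_nonneg : ∀ k, 0 ≤ q k
  q_le : ∀ k, q k ≤ pm
  c_le : c ≤ s * ∑ i, d i
  card_le : s * Fintype.card ι ≤ S
  card_le' : s * Fintype.card κ ≤ 1
  r_pos : 0 < r
  dm_nonneg : 0 ≤ dm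
  pm_nonneg : 0 ≤ pm
  c_pos : 0 < c

section

variable {ι κ : Type*} [Fintype ι] [Fintype κ] {r dm pm c S s e : ℝ} {d : ι → ℝ} {q : κ → ℝ}

/-- Minus the first derivative at `0` of the solution of `e = F (t + G e)`. -/
noncomputable def linCoeff (s r : ℝ) (d : ι → ℝ) (q : κ → ℝ) (e : ℝ) : ℝ :=
  stieltjesCoeff 1 s r d (stieltjesSum s 1 q e) /
    (1 - stieltjesCoeff 1 s r d (stieltjesSum s 1 q e) * stieltjesCoeff 1 s 1 q e)

/-- Half the second derivative at `0` of the solution of `e = F (t + G e)`. -/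
noncomputable def quadCoeff (s r : ℝ) (d : ι → ℝ) (q : κ → ℝ) (e : ℝ) : ℝ :=
  (stieltjesCoeff 2 s r d (stieltjesSum s 1 q e) -
    stieltjesCoeff 1 s r d (stieltjesSum s 1 q e) ^ 3 * stieltjesCoeff 2 s 1 q e) /
    (1 - stieltjesCoeff 1 s r d (stieltjesSum s 1 q e) * stieltjesCoeff 1 s 1 q e) ^ 3

lemma Regime.G_zero_le (h : Regime r dm pm c S s d q) : stieltjesSum s 1 q 0 ≤ pm := by
  have := stieltjesSum_zero_le h.s_nonneg one_pos h.q_le h.pm_nonneg h.card_le'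
  simpa using this

lemma Regime.G_nonneg (h : Regime r dm pm c S s d q) (he : 0 ≤ e) : 0 ≤ stieltjesSum s 1 q e :=
  stieltjesSum_nonneg h.s_nonneg one_pos h.q_nonneg he

lemma Regime.G_le (h : Regime r dm pm c S s d q) (he : 0 ≤ e) : stieltjesSum s 1 q e ≤ pm :=
  (stieltjesSum_anti h.s_nonneg one_pos h.q_nonneg le_rfl he).trans h.G_zero_le

lemma Regime.F_le (h : Regime r dm pm c S s d q) {x : ℝ} (hx : 0 ≤ x) :
    stieltjesSum s r d x ≤ S * dm / r :=
  (stieltjesSum_anti h.s_nonneg h.r_pos h.d_nonneg le_rfl hx).trans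
    (stieltjesSum_zero_le h.s_nonneg h.r_pos h.d_le h.dm_nonneg h.card_le)

lemma Regime.den_pos (h : Regime r dm pm c S s d q) : 0 < r + (1 + pm) * dm := by
  have := mul_nonneg (add_nonneg zero_le_one h.pm_nonneg) h.dm_nonneg
  linarith [h.r_pos]

lemma Regime.le_fixedPoint (h : Regime r dm pm c S s d q) (he : 0 ≤ e)
    (hfix : e = stieltjesSum s r d (stieltjesSum s 1 q e)) :
    c / (r + (1 + pm) * dm) ≤ e := by
  rw [hfix]
  exact stieltjesSum_ge h.s_nonneg h.r_pos h.d_nonneg h.d_le h.c_le (h.G_nonneg he)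
    ((h.G_le he).trans (by linarith)) h.dm_nonneg

/-- Put x = G(e), a = −F'(x), b = −G'(e). Then a x ≤ e − κ with κ > 0, and b e ≤ x, hence a b e ≤ e
− κ. Since e ≤ S·dm/r, dividing gives a lower bound for 1 − ab independent of the dimensions. -/
lemma Regime.gap (h : Regime r dm pm c S s d q) (he : 0 ≤ e)
    (hfix : e = stieltjesSum s r d (stieltjesSum s 1 q e)) :
    c * r / (r + (1 + pm) * dm) ^ 2 / (S * dm / r) ≤
      1 - stieltjesCoeff 1 s r d (stieltjesSum s 1 q e) * stieltjesCoeff 1 s 1 q e := by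
  have hx := h.G_nonneg he
  have h1 := stieltjesCoeff_one_mul_le h.s_nonneg h.r_pos h.d_nonneg h.d_le h.dm_nonneg h.c_le hx
    ((h.G_le he).trans (by linarith : pm ≤ 1 + pm))
  rw [← hfix] at h1
  have h2 := stieltjesCoeff_one_mul_le (c := 0) h.s_nonneg one_pos h.q_nonneg h.q_le h.pm_nonneg
    (mul_nonneg h.s_nonneg (Finset.sum_nonneg fun k _ => h.q_nonneg k)) he le_rfl
  rw [zero_mul, zero_div, sub_zero] at h2
  have ha := stieltjesCoeff_nonneg 1 h.s_nonneg h.r_pos h.d_nonneg hx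
  have hepos : 0 < e := (div_pos h.c_pos h.den_pos).trans_le (h.le_fixedPoint he hfix)
  have heE : e ≤ S * dm / r := by
    conv_lhs => rw [hfix]
    exact h.F_le hx
  rw [div_le_iff₀ (hepos.trans_le heE)]
  have h3 := mul_le_mul_of_nonneg_left h2 ha
  set a := stieltjesCoeff 1 s r d (stieltjesSum s 1 q e)
  set b := stieltjesCoeff 1 s 1 q e
  have hκ : 0 < c * r / (r + (1 + pm) * dm) ^ 2 := by
    have := h.den_pos
    have := h.c_pos
    have := h.r_pos
    positivity
  have h4 : c * r / (r + (1 + pm) * dm) ^ 2 ≤ (1 - a * b) * e := by nlinarith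
  have h5 : 0 ≤ 1 - a * b := by
    by_contra hcon
    push Not at hcon
    nlinarith
  exact h4.trans (mul_le_mul_of_nonneg_left heE h5)

end

/-- The first-order coefficient equation required by `cubic_residual`, with F₁ = −a and G₁ = −b. -/
lemma linCoeff_identity {a b : ℝ} (h : 1 - a * b ≠ 0) :
    -(a / (1 - a * b)) = -a * (1 + -b * -(a / (1 - a * b))) := by
  field_simp
  ring

/-- The second-order coefficient equation. It rests on 1 + (−b)(−a/(1 − ab)) = 1/(1 − ab), the
first-order change of t + G(e) per unit of t. -/
lemma quadCoeff_identity {a b A B : ℝ} (h : 1 - a * b ≠ 0) :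
    (A - a ^ 3 * B) / (1 - a * b) ^ 3 =
      -a * (-b * ((A - a ^ 3 * B) / (1 - a * b) ^ 3) + B * (-(a / (1 - a * b))) ^ 2) +
        A * (1 + -b * -(a / (1 - a * b))) ^ 2 := by
  generalize hq : 1 - a * b = q at *
  have hab : a * b = 1 - q := by linarith
  have h1 : 1 + -b * -(a / q) = 1 / q := by
    field_simp
    linear_combination hab
  rw [h1]
  field_simp
  linear_combination -(A - a ^ 3 * B) * hab

/-- All constants depend only on the uniform bounds of the regime, never on N, K or the spectra; the
asymptotic statements rest on this uniformity. -/
lemma Regime.exists_coeff_bound {r dm pm c S : ℝ} (hr : 0 < r) (hdm : 0 ≤ dm) (hpm : 0 ≤ pm)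
    (hc : 0 < c) (hS : 0 ≤ S) :
    ∃ A, 1 ≤ A ∧ S * (dm / r) ^ 4 ≤ A ∧ pm ^ 4 ≤ A ∧
      ∀ (N K : ℕ) (s e : ℝ) (d : Fin N → ℝ) (q : Fin K → ℝ),
      Regime r dm pm c S s d q → 0 ≤ e → e = stieltjesSum s r d (stieltjesSum s 1 q e) →
      stieltjesCoeff 1 s r d (stieltjesSum s 1 q e) ≤ A ∧
      stieltjesCoeff 2 s r d (stieltjesSum s 1 q e) ≤ A ∧
      stieltjesCoeff 1 s 1 q e ≤ A ∧ stieltjesCoeff 2 s 1 q e ≤ A ∧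
      0 < 1 - stieltjesCoeff 1 s r d (stieltjesSum s 1 q e) * stieltjesCoeff 1 s 1 q e ∧
      0 ≤ linCoeff s r d q e ∧ linCoeff s r d q e ≤ A ∧ |quadCoeff s r d q e| ≤ A := by
  -- The added 1 keeps the denominator positive even when S·dm/r vanishes, while staying below the
  -- gap.
  obtain ⟨q₀, hq₀, hq₀def⟩ : ∃ q₀ : ℝ, 0 < q₀ ∧
      q₀ ≤ c * r / (r + (1 + pm) * dm) ^ 2 / (S * dm / r + 1) :=
    ⟨_, by positivity, le_rfl⟩
  obtain ⟨M, hM1, hM2, hM3, hM4, hM5, hM6, hM7⟩ : ∃ M : ℝ, 1 ≤ M ∧ S * (dm / r) ^ 4 ≤ M ∧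
      pm ^ 4 ≤ M ∧ S * (dm / r) ^ 2 ≤ M ∧ S * (dm / r) ^ 3 ≤ M ∧ pm ^ 2 ≤ M ∧ pm ^ 3 ≤ M := by
    have n1 : 0 ≤ S * (dm / r) ^ 2 := by positivity
    have n2 : 0 ≤ S * (dm / r) ^ 3 := by positivity
    have n3 : 0 ≤ pm ^ 2 := by positivity
    have n4 : 0 ≤ pm ^ 3 := by positivity
    have n7 : 0 ≤ S * (dm / r) ^ 4 := by positivity
    have n8 : 0 ≤ pm ^ 4 := by positivity
    exact ⟨1 + S * (dm / r) ^ 4 + pm ^ 4 + S * (dm / r) ^ 2 + S * (dm / r) ^ 3 + pm ^ 2 + pm ^ 3,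
      by linarith, by linarith, by linarith, by linarith, by linarith, by linarith, by linarith⟩
  have hM0 : 0 < M := by linarith
  have n5 : 0 ≤ M / q₀ := by positivity
  have n6 : 0 ≤ (M + M ^ 3 * M) / q₀ ^ 3 := by positivity
  refine ⟨M + M / q₀ + (M + M ^ 3 * M) / q₀ ^ 3, by linarith, by linarith, by linarith, ?_⟩
  intro N K s e d q h he hfix
  have hxe := h.G_nonneg he
  have hgap := h.gap he hfix
  have heE : e ≤ S * dm / r := by
    conv_lhs => rw [hfix]
    exact h.F_le hxe
  have hEpos : 0 < S * dm / r :=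
    ((div_pos h.c_pos h.den_pos).trans_le (h.le_fixedPoint he hfix)).trans_le heE
  have ha0 := stieltjesCoeff_nonneg 1 h.s_nonneg h.r_pos h.d_nonneg hxe
  have hA20 := stieltjesCoeff_nonneg 2 h.s_nonneg h.r_pos h.d_nonneg hxe
  have hB20 := stieltjesCoeff_nonneg 2 h.s_nonneg one_pos h.q_nonneg he
  have ha1 := stieltjesCoeff_le 1 h.s_nonneg h.r_pos h.d_nonneg h.d_le h.dm_nonneg h.card_le hxe
  have hA21 := stieltjesCoeff_le 2 h.s_nonneg h.r_pos h.d_nonneg h.d_le h.dm_nonneg h.card_le hxe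
  have hb1 := stieltjesCoeff_le 1 h.s_nonneg one_pos h.q_nonneg h.q_le h.pm_nonneg h.card_le' he
  have hB21 := stieltjesCoeff_le 2 h.s_nonneg one_pos h.q_nonneg h.q_le h.pm_nonneg h.card_le' he
  have hq : q₀ ≤ 1 - stieltjesCoeff 1 s r d (stieltjesSum s 1 q e) * stieltjesCoeff 1 s 1 q e := by
    refine hq₀def.trans (le_trans ?_ hgap)
    have : 0 ≤ c * r / (r + (1 + pm) * dm) ^ 2 := by positivity
    gcongr
    linarith
  unfold linCoeff quadCoeff
  generalize stieltjesCoeff 1 s r d (stieltjesSum s 1 q e) = a at *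
  generalize stieltjesCoeff 1 s 1 q e = b at *
  generalize stieltjesCoeff 2 s r d (stieltjesSum s 1 q e) = A₂ at *
  generalize stieltjesCoeff 2 s 1 q e = B₂ at *
  simp only [Nat.reduceAdd, div_one, one_mul] at ha1 hA21 hb1 hB21
  replace ha1 := ha1.trans hM4
  replace hA21 := hA21.trans hM5
  replace hb1 := hb1.trans hM6
  replace hB21 := hB21.trans hM7
  have hq0 : 0 < 1 - a * b := hq₀.trans_le hq
  have bh₁ : a / (1 - a * b) ≤ M / q₀ := by gcongr
  have bh₂ : |(A₂ - a ^ 3 * B₂) / (1 - a * b) ^ 3| ≤ (M + M ^ 3 * M) / q₀ ^ 3 := by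
    rw [abs_div, abs_of_pos (pow_pos hq0 3)]
    have : |A₂ - a ^ 3 * B₂| ≤ M + M ^ 3 * M := by
      refine (abs_sub _ _).trans ?_
      rw [abs_of_nonneg hA20, abs_of_nonneg (mul_nonneg (pow_nonneg ha0 3) hB20)]
      gcongr
    gcongr
  exact ⟨by linarith, by linarith, by linarith, by linarith, hq0, div_nonneg ha0 hq0.le,
    by linarith, by linarith⟩

/-- The residual in `e = F (t + G e)` of the second-order expansion is cubic. -/
lemma Regime.expansion_residual {r dm pm c S s e A : ℝ} {N K : ℕ} {d : Fin N → ℝ}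
    {q : Fin K → ℝ} (h : Regime r dm pm c S s d q) (he : 0 ≤ e)
    (hfix : e = stieltjesSum s r d (stieltjesSum s 1 q e))
    (hA : 1 ≤ A) (hA₁ : S * (dm / r) ^ 4 ≤ A) (hA₂ : pm ^ 4 ≤ A)
    (ha : stieltjesCoeff 1 s r d (stieltjesSum s 1 q e) ≤ A)
    (ha₂ : stieltjesCoeff 2 s r d (stieltjesSum s 1 q e) ≤ A)
    (hb : stieltjesCoeff 1 s 1 q e ≤ A) (hb₂ : stieltjesCoeff 2 s 1 q e ≤ A)
    (hab : 0 < 1 - stieltjesCoeff 1 s r d (stieltjesSum s 1 q e) * stieltjesCoeff 1 s 1 q e)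
    (hl0 : 0 ≤ linCoeff s r d q e) (hl : linCoeff s r d q e ≤ A)
    (hq : |quadCoeff s r d q e| ≤ A) {t : ℝ} (ht : 0 ≤ t) (ht1 : t ≤ 1) {u : ℝ}
    (hu : u = e + (-linCoeff s r d q e * t + quadCoeff s r d q e * t ^ 2)) (hu0 : 0 ≤ u) :
    |u - stieltjesSum s r d (t + stieltjesSum s 1 q u)| ≤ 3607 * A ^ 13 * t ^ 3 := by
  have hxe := h.G_nonneg he
  have ha0 := stieltjesCoeff_nonneg 1 h.s_nonneg h.r_pos h.d_nonneg hxe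
  have hb0 := stieltjesCoeff_nonneg 1 h.s_nonneg one_pos h.q_nonneg he
  have hA20 := stieltjesCoeff_nonneg 2 h.s_nonneg h.r_pos h.d_nonneg hxe
  have hB20 := stieltjesCoeff_nonneg 2 h.s_nonneg one_pos h.q_nonneg he
  have hGu := h.G_nonneg hu0
  have tG := stieltjesSum_taylor h.s_nonneg one_pos h.q_nonneg h.q_le h.card_le' he
    (-linCoeff s r d q e * t + quadCoeff s r d q e * t ^ 2) (by rw [← hu]; exact hu0)
  rw [← hu] at tG
  have hxk : stieltjesSum s 1 q e + (t + (stieltjesSum s 1 q u - stieltjesSum s 1 q e)) =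
      t + stieltjesSum s 1 q u := by ring
  have tF := stieltjesSum_taylor h.s_nonneg h.r_pos h.d_nonneg h.d_le h.card_le hxe
    (t + (stieltjesSum s 1 q u - stieltjesSum s 1 q e)) (by rw [hxk]; exact add_nonneg ht hGu)
  rw [hxk, ← hfix] at tF
  have i1 := linCoeff_identity hab.ne'
  have i2 := quadCoeff_identity (A := stieltjesCoeff 2 s r d (stieltjesSum s 1 q e))
    (B := stieltjesCoeff 2 s 1 q e) hab.ne'
  rw [← linCoeff] at i1 i2
  rw [← quadCoeff] at i2
  have hres := cubic_residual (t := t) (g := stieltjesSum s 1 q u - stieltjesSum s 1 q e)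
    (v := stieltjesSum s r d (t + stieltjesSum s 1 q u) - e) hA
    (by rw [abs_neg, abs_of_nonneg ha0]; exact ha) (by rw [abs_of_nonneg hA20]; exact ha₂)
    (by rw [abs_neg, abs_of_nonneg hb0]; exact hb) (by rw [abs_of_nonneg hB20]; exact hb₂)
    (by rw [abs_neg, abs_of_nonneg hl0]; exact hl) hq i1 i2 ht ht1
    (by
      refine le_trans (le_of_eq ?_) (tG.trans ?_)
      · congr 1; ring
      · rw [div_one, one_mul]
        exact mul_le_mul_of_nonneg_right hA₂ (pow_nonneg (abs_nonneg _) 3))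
    (by
      refine le_trans (le_of_eq ?_) (tF.trans ?_)
      · congr 1; ring
      · exact mul_le_mul_of_nonneg_right hA₁ (pow_nonneg (abs_nonneg _) 3))
  refine le_trans (le_of_eq ?_) hres
  congr 1; rw [hu]; ring

/-- Uniform comparison of approximate solutions of `e = F (t + G e)` with the second-order
expansion at `t = 0` of the exact solution. -/
theorem exists_expansion_bound {r dm pm c S : ℝ} (hr : 0 < r) (hdm : 0 ≤ dm) (hpm : 0 ≤ pm)
    (hc : 0 < c) (hS : 0 ≤ S) :
    ∃ C > 0, ∃ t₀ > 0, t₀ ≤ 1 ∧ ∀ (N K : ℕ) (s e : ℝ) (d : Fin N → ℝ) (q : Fin K → ℝ),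
      Regime r dm pm c S s d q → 0 ≤ e → e = stieltjesSum s r d (stieltjesSum s 1 q e) →
      linCoeff s r d q e ∈ Set.Icc 0 C ∧ |quadCoeff s r d q e| ≤ C ∧
      ∀ t ∈ Set.Icc 0 t₀, ∀ f ∈ Set.Icc 0 (S * dm / r), ∀ ε,
        |f - stieltjesSum s r d (t + stieltjesSum s 1 q f)| ≤ ε →
        |f - (e - linCoeff s r d q e * t + quadCoeff s r d q e * t ^ 2)| ≤ C * (ε + t ^ 3) := by
  obtain ⟨A, hA1, hA2, hA3, hcoef⟩ := Regime.exists_coeff_bound hr hdm hpm hc hS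
  have hA0 : 0 < A := by linarith
  obtain ⟨E, hE⟩ : ∃ E, E = S * dm / r := ⟨_, rfl⟩
  obtain ⟨κ, hκ⟩ : ∃ κ, κ = c * r / (r + (1 + pm) * dm) ^ 2 := ⟨_, rfl⟩
  obtain ⟨lo, hlo⟩ : ∃ lo, lo = c / (r + (1 + pm) * dm) := ⟨_, rfl⟩
  have hE0 : 0 ≤ E := by rw [hE]; positivity
  have hκ0 : 0 < κ := by rw [hκ]; positivity
  have hlo0 : 0 < lo := by rw [hlo]; positivity
  have w1 : 0 ≤ (E + 1) / κ := by positivity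
  have w3 : 0 ≤ A ^ 13 := by positivity
  -- The shift is at most 2At in size. The constraint t ≤ 1/(2A) keeps the approximant below E + 1,
  -- and t ≤ lo/(2A) keeps it nonnegative, where lo is the lower bound for e.
  refine ⟨A + (E + 1) / κ * (1 + 3607 * A ^ 13), by positivity,
    min 1 (min (1 / (2 * A)) (lo / (2 * A))), ?_, min_le_left _ _, ?_⟩
  · exact lt_min one_pos (lt_min (by positivity) (by positivity))
  intro N K s e d q h he hfix
  obtain ⟨ha, ha₂, hb, hb₂, hab, hl0, hl, hq⟩ := hcoef N K s e d q h he hfix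
  have hepos : lo ≤ e := by rw [hlo]; exact h.le_fixedPoint he hfix
  have heE : e ≤ E := by
    rw [hE]
    conv_lhs => rw [hfix]
    exact h.F_le (h.G_nonneg he)
  have hCA : A ≤ A + (E + 1) / κ * (1 + 3607 * A ^ 13) := by
    have : 0 ≤ (E + 1) / κ * (1 + 3607 * A ^ 13) := by positivity
    linarith
  refine ⟨⟨hl0, hl.trans hCA⟩, hq.trans hCA, ?_⟩
  rw [← hE]
  intro t ht f hf ε hε
  have ht0 := ht.1
  have ht1 : t ≤ 1 := ht.2.trans (min_le_left _ _)
  have ht2 : t ≤ 1 / (2 * A) := ht.2.trans ((min_le_right _ _).trans (min_le_left _ _))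
  have ht3 : t ≤ lo / (2 * A) := ht.2.trans ((min_le_right _ _).trans (min_le_right _ _))
  rw [le_div_iff₀ (by positivity)] at ht2 ht3
  have hhb : |-linCoeff s r d q e * t + quadCoeff s r d q e * t ^ 2| ≤ 2 * A * t := by
    calc _ ≤ linCoeff s r d q e * t + |quadCoeff s r d q e| * t ^ 2 := by
          refine (abs_add_le _ _).trans ?_
          rw [abs_mul, abs_mul, abs_neg, abs_of_nonneg hl0, abs_of_nonneg ht0,
            abs_of_nonneg (sq_nonneg t)]
      _ ≤ A * t + A * t := by
          have : t ^ 2 ≤ t := pow_le_of_le_one ht0 ht1 (by norm_num)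
          gcongr
      _ = _ := by ring
  -- Both f and the quadratic approximant u are approximate solutions at the same t, with residuals
  -- ε and O(t³), so stability compares them.
  obtain ⟨u, hu⟩ : ∃ u, u = e + (-linCoeff s r d q e * t + quadCoeff s r d q e * t ^ 2) := ⟨_, rfl⟩
  have hu0 : 0 ≤ u := by
    have := (abs_le.mp hhb).1
    linarith
  have huE : u ≤ E + 1 := by
    have := (abs_le.mp hhb).2
    linarith
  have hres := h.expansion_residual he hfix hA1 hA2 hA3 ha ha₂ hb hb₂ hab hl0 hl hq ht0 ht1 hu hu0
  have hG0 := h.G_zero_le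
  have hst := stieltjesSum_stability (X := 1 + pm) (E := E + 1) h.s_nonneg h.r_pos h.d_nonneg
    h.d_le h.dm_nonneg h.q_nonneg h.c_le ht0 (by linarith) hf.1 (by linarith [hf.2]) hu0 huE hε hres
  rw [← hκ] at hst
  have hfe : |f - u| ≤ (E + 1) / κ * (ε + 3607 * A ^ 13 * t ^ 3) := by
    rw [div_mul_eq_mul_div, le_div_iff₀ hκ0, mul_comm]
    exact hst
  have hε0 : 0 ≤ ε := (abs_nonneg _).trans hε
  have e1 : e - linCoeff s r d q e * t + quadCoeff s r d q e * t ^ 2 = u := by rw [hu]; ring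
  rw [e1]
  have w2 : 0 ≤ t ^ 3 := by positivity
  have w4 : 0 ≤ ε + t ^ 3 := by positivity
  have w5 : 3607 * A ^ 13 * ε ≥ 0 := by positivity
  calc |f - u| ≤ (E + 1) / κ * (ε + 3607 * A ^ 13 * t ^ 3) := hfe
    _ ≤ (E + 1) / κ * ((1 + 3607 * A ^ 13) * (ε + t ^ 3)) := by
        refine mul_le_mul_of_nonneg_left ?_ w1
        linarith
    _ = (E + 1) / κ * (1 + 3607 * A ^ 13) * (ε + t ^ 3) := by ring
    _ ≤ _ := by
        refine mul_le_mul_of_nonneg_right ?_ w4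
        linarith

end DeterministicExpansion

/-! ### Translation between δ, γ, Ω², ν and the functions F, G. -/

section Solution

variable {K N : ℕ} {ρ δ δ' : ℝ} {d : Fin N → ℝ} {p : Fin K → ℝ}

lemma tMat_diagonal {n : ℕ} {t x : ℝ} {d : Fin n → ℝ} (h : ∀ i, 1 + t * x * d i ≠ 0) :
    tMat t x (Matrix.diagonal d) = Matrix.diagonal fun i => (1 + t * x * d i)⁻¹ := by
  rw [tMat]
  refine Matrix.inv_eq_right_inv ?_
  rw [← Matrix.diagonal_smul, ← Matrix.diagonal_one, Matrix.diagonal_add,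
    Matrix.diagonal_mul_diagonal]
  congr 1
  ext i
  simpa using mul_inv_cancel₀ (h i)

lemma trace_pow_mul_tMat {n : ℕ} {t x : ℝ} {d : Fin n → ℝ} (h : ∀ i, 1 + t * x * d i ≠ 0)
    (k : ℕ) : (Matrix.diagonal d ^ k * tMat t x (Matrix.diagonal d) ^ k).trace =
      ∑ i, d i ^ k / (1 + t * x * d i) ^ k := by
  rw [tMat_diagonal h, Matrix.diagonal_pow, Matrix.diagonal_pow, Matrix.diagonal_mul_diagonal,
    Matrix.trace_diagonal]
  refine Finset.sum_congr rfl fun i _ => ?_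
  simp [div_eq_mul_inv]

lemma sum_div_scale {n : ℕ} (hρ : 0 < ρ) {x : ℝ} (hx : 0 ≤ x) {d : Fin n → ℝ}
    (hd : ∀ i, 0 ≤ d i) (k : ℕ) :
    ∑ i, d i ^ k / (1 + 1 / ρ * x * d i) ^ k = ρ ^ k * ∑ i, d i ^ k / (ρ + x * d i) ^ k := by
  rw [Finset.mul_sum]
  refine Finset.sum_congr rfl fun i _ => ?_
  have h1 := (add_mul_pos_of_nonneg hρ hd hx i).ne'
  have : 1 + 1 / ρ * x * d i = (ρ + x * d i) / ρ := by field_simp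
  rw [this, div_pow]
  field_simp

lemma sum_div_scale_one {n : ℕ} {x : ℝ} {q : Fin n → ℝ} (k : ℕ) :
    ∑ i, q i ^ k / (1 + 1 / ρ * x * q i) ^ k = ∑ i, q i ^ k / (1 + x / ρ * q i) ^ k :=
  Finset.sum_congr rfl fun i _ => by rw [one_div_mul_eq_div]

lemma one_add_ne_zero {n : ℕ} (hρ : 0 < ρ) {x : ℝ} (hx : 0 ≤ x) {d : Fin n → ℝ}
    (hd : ∀ i, 0 ≤ d i) (i : Fin n) : 1 + 1 / ρ * x * d i ≠ 0 := by
  have := mul_nonneg (mul_nonneg (one_div_pos.mpr hρ).le hx) (hd i)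
  positivity

/-- The change of unknown e = δ/ρ puts the system in the form e = F(δ̃), δ̃ = G(e); ρ then appears
inside F only. -/
lemma isPosSolution_iff (hρ : 0 < ρ) (hd : ∀ i, 0 ≤ d i) (hp : ∀ k, 0 ≤ p k) (h0 : 0 ≤ δ)
    (h0' : 0 ≤ δ') :
    IsPosSolution (1 / ρ) (Matrix.diagonal d) (Matrix.diagonal p) δ δ' ↔
      0 < δ ∧ 0 < δ' ∧ δ / ρ = stieltjesSum (1 / K) ρ d δ' ∧
        δ' = stieltjesSum (1 / K) 1 p (δ / ρ) := by
  have e1 : 1 / (K : ℝ) * (Matrix.diagonal d * tMat (1 / ρ) δ' (Matrix.diagonal d)).trace =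
      ρ * stieltjesSum (1 / K) ρ d δ' := by
    have := trace_pow_mul_tMat (one_add_ne_zero hρ h0' hd) 1
    have h2 := sum_div_scale hρ h0' hd 1
    simp only [pow_one] at this h2
    rw [this, h2, stieltjesSum]
    ring
  have e2 : 1 / (K : ℝ) * (Matrix.diagonal p * tMat (1 / ρ) δ (Matrix.diagonal p)).trace =
      stieltjesSum (1 / K) 1 p (δ / ρ) := by
    have := trace_pow_mul_tMat (one_add_ne_zero hρ h0 hp) 1
    have h2 := sum_div_scale_one (ρ := ρ) (x := δ) (q := p) 1
    simp only [pow_one] at this h2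
    rw [this, h2, stieltjesSum]
  constructor
  · rintro ⟨h1, h2, h3, h4⟩
    refine ⟨h1, h2, ?_, ?_⟩
    · rw [e1] at h3
      rw [h3]
      field_simp
    · rwa [e2] at h4
  · rintro ⟨h1, h2, h3, h4⟩
    refine ⟨h1, h2, ?_, ?_⟩
    · rw [e1, ← h3]
      field_simp
    · rwa [e2]

/-- The factor ρ² appears here but not for γ̃, so γγ̃/ρ² is the product ab in the gap. -/
lemma gam_eq (hρ : 0 < ρ) (hd : ∀ i, 0 ≤ d i) (h0' : 0 ≤ δ') :
    gam K (1 / ρ) δ' (Matrix.diagonal d) = ρ ^ 2 * stieltjesCoeff 1 (1 / K) ρ d δ' := by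
  rw [gam, trace_pow_mul_tMat (one_add_ne_zero hρ h0' hd), sum_div_scale hρ h0' hd, stieltjesCoeff]
  ring

lemma gam_eq_one (hρ : 0 < ρ) (hp : ∀ k, 0 ≤ p k) (h0 : 0 ≤ δ) :
    gam K (1 / ρ) δ (Matrix.diagonal p) = stieltjesCoeff 1 (1 / K) 1 p (δ / ρ) := by
  rw [gam, trace_pow_mul_tMat (one_add_ne_zero hρ h0 hp), sum_div_scale_one, stieltjesCoeff]

/-- With γ = ρ²a and γ̃ = b, this is a(ab/(1 − ab) + 1) = a/(1 − ab). -/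
lemma omegaSq_eq_linCoeff (hρ : 0 < ρ) (hd : ∀ i, 0 ≤ d i) (hp : ∀ k, 0 ≤ p k) (h0 : 0 ≤ δ)
    (h0' : 0 ≤ δ') (hδ' : δ' = stieltjesSum (1 / K) 1 p (δ / ρ))
    (hne : 1 - stieltjesCoeff 1 (1 / K) ρ d δ' * stieltjesCoeff 1 (1 / K) 1 p (δ / ρ) ≠ 0) :
    omegaSq ρ (Matrix.diagonal d) (Matrix.diagonal p) δ δ' = linCoeff (1 / K) ρ d p (δ / ρ) := by
  rw [omegaSq, linCoeff, ← hδ']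
  rw [gam_eq hρ hd h0', gam_eq_one hρ hp h0]
  set a := stieltjesCoeff 1 (1 / K) ρ d δ'
  set b := stieltjesCoeff 1 (1 / K) 1 p (δ / ρ)
  have : ρ ^ 2 - ρ ^ 2 * a * b = ρ ^ 2 * (1 - a * b) := by ring
  rw [this]
  field_simp
  ring

/-- The powers of ρ cancel: Tr D³T³ carries ρ³, γ³/ρ³ = ρ³a³, and (ρ² − γγ̃)³ = ρ⁶(1 − ab)³. The
factor 2 is that of the third central moment 2 Tr M³. -/
lemma nu_eq_quadCoeff (hρ : 0 < ρ) (hd : ∀ i, 0 ≤ d i) (hp : ∀ k, 0 ≤ p k) (h0 : 0 ≤ δ)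
    (h0' : 0 ≤ δ') (hδ' : δ' = stieltjesSum (1 / K) 1 p (δ / ρ))
    (hne : 1 - stieltjesCoeff 1 (1 / K) ρ d δ' * stieltjesCoeff 1 (1 / K) 1 p (δ / ρ) ≠ 0) :
    nu ρ (Matrix.diagonal d) (Matrix.diagonal p) δ δ' =
      2 * quadCoeff (1 / K) ρ d p (δ / ρ) := by
  rw [nu, quadCoeff, ← hδ']
  rw [gam_eq hρ hd h0', gam_eq_one hρ hp h0, trace_pow_mul_tMat (one_add_ne_zero hρ h0' hd),
    trace_pow_mul_tMat (one_add_ne_zero hρ h0 hp), sum_div_scale hρ h0' hd, sum_div_scale_one]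
  set a := stieltjesCoeff 1 (1 / K) ρ d δ'
  set b := stieltjesCoeff 1 (1 / K) 1 p (δ / ρ)
  have : ρ ^ 2 - ρ ^ 2 * a * b = ρ ^ 2 * (1 - a * b) := by ring
  have c₁ : stieltjesCoeff 2 (1 / K) ρ d δ' = 1 / K * ∑ i, d i ^ 3 / (ρ + δ' * d i) ^ 3 := rfl
  have c₂ : stieltjesCoeff 2 (1 / K) 1 p (δ / ρ) =
    1 / K * ∑ i, p i ^ 3 / (1 + δ / ρ * p i) ^ 3 := rfl
  rw [this, c₁, c₂]
  generalize ∑ i, d i ^ 3 / (ρ + δ' * d i) ^ 3 = S₁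
  generalize ∑ i, p i ^ 3 / (1 + δ / ρ * p i) ^ 3 = S₂
  field_simp

end Solution

end LMMSE

namespace LMMSE

set_option linter.unusedSectionVars false

/-! ### Continuity, used for measurability. -/

section Continuity

variable {n : Type*} [Fintype n] [DecidableEq n]

lemma continuous_matrix_inv {α : Type*} [TopologicalSpace α] {f : α → Matrix n n ℂ}
    (hf : Continuous f) (h : ∀ a, IsUnit (f a)) : Continuous fun a => (f a)⁻¹ := by
  simp_rw [Matrix.inv_def, Ring.inverse_eq_inv']
  exact (hf.matrix_det.inv₀ fun a => ((Matrix.isUnit_iff_isUnit_det _).mp (h a)).ne_zero).smul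
    hf.matrix_adjugate

lemma continuous_resolv {α : Type*} [TopologicalSpace α] {B : Matrix n n ℂ} {ρ : ℝ}
    {f : α → Matrix n n ℂ} (hB : B.IsHermitian) (hρ : 0 < ρ) (hf : Continuous f)
    (h : ∀ a, (f a).PosSemidef) : Continuous fun a => resolv B ρ (f a) := by
  unfold resolv
  refine Continuous.matrix_mul (Continuous.matrix_mul continuous_const ?_) continuous_const
  exact continuous_matrix_inv (((continuous_const.matrix_mul hf).matrix_mul continuous_const).add
    continuous_const) fun a => (resolv_aux_posDef hB hρ (h a)).isUnit

lemma continuous_reTr {α : Type*} [TopologicalSpace α] {f : α → Matrix n n ℂ}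
    (hf : Continuous f) : Continuous fun a => reTr (f a) :=
  Complex.continuous_re.comp hf.matrix_trace

lemma continuous_qform_comp {α : Type*} [TopologicalSpace α] {f : α → Matrix n n ℂ}
    {x : α → n → ℂ} (hf : Continuous f) (hx : Continuous x) :
    Continuous fun a => qform (f a) (x a) :=
  Complex.continuous_re.comp (hx.star.dotProduct (hf.matrix_mulVec hx))

lemma continuous_outer {α : Type*} [TopologicalSpace α] {x : α → n → ℂ} (hx : Continuous x) :
    Continuous fun a => outer (x a) :=
  hx.matrix_vecMulVec hx.star

end Continuity

/-! ### The Gram sum of the interfering columns and its shift. -/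

section GramSum

variable {N K : ℕ}

/-- The matrix `∑ₖ τₖ xₖ xₖ*`. -/
noncomputable def gramSum (τ : Fin K → ℝ) (X : Fin K → Fin N → ℂ) : Matrix (Fin N) (Fin N) ℂ :=
  ∑ k, (τ k : ℂ) • outer (X k)

variable {τ : Fin K → ℝ}

lemma gramSum_posSemidef (hτ : ∀ k, 0 ≤ τ k) (X : Fin K → Fin N → ℂ) :
    (gramSum τ X).PosSemidef :=
  Matrix.posSemidef_sum _ fun k _ => (outer_posSemidef _).smul (by exact_mod_cast hτ k)

lemma gramSum_update (X : Fin K → Fin N → ℂ) (k : Fin K) (x : Fin N → ℂ) :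
    gramSum τ (Function.update X k x) =
      gramSum τ (Function.update X k 0) + (τ k : ℂ) • outer x := by
  unfold gramSum
  rw [← Finset.add_sum_erase _ _ (Finset.mem_univ k),
    ← Finset.add_sum_erase (Finset.univ) (fun j => (τ j : ℂ) • outer (Function.update X k 0 j))
      (Finset.mem_univ k)]
  have h0 : outer (0 : Fin N → ℂ) = 0 := by ext i j; simp [outer, Matrix.vecMulVec_apply]
  simp only [Function.update_self, h0, smul_zero, zero_add]
  rw [add_comm]
  congr 1
  refine Finset.sum_congr rfl fun j hj => ?_
  rw [Function.update_of_ne (Finset.ne_of_mem_erase hj),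
    Function.update_of_ne (Finset.ne_of_mem_erase hj)]

/-- Supplies, through the resolvent, the measurability of every trace and quadratic form below. -/
lemma continuous_gramSum : Continuous (gramSum (N := N) τ) :=
  continuous_finsetSum _ fun k _ =>
    Continuous.const_smul (continuous_outer (continuous_apply k)) (τ k : ℂ)

/-- The resolvent `B (B (∑ₖ τₖ xₖ xₖ* + t) B + ρ)⁻¹ B`. -/
noncomputable def shiftRes (B : Matrix (Fin N) (Fin N) ℂ) (ρ : ℝ) (τ : Fin K → ℝ) (t : ℝ)
    (X : Fin K → Fin N → ℂ) : Matrix (Fin N) (Fin N) ℂ :=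
  resolv B ρ (gramSum τ X + (t : ℂ) • 1)

lemma smul_one_posSemidef {t : ℝ} (ht : 0 ≤ t) :
    ((t : ℂ) • (1 : Matrix (Fin N) (Fin N) ℂ)).PosSemidef :=
  Matrix.PosSemidef.one.smul (by exact_mod_cast ht)

lemma shift_posSemidef (hτ : ∀ k, 0 ≤ τ k) {t : ℝ} (ht : 0 ≤ t) (X : Fin K → Fin N → ℂ) :
    (gramSum τ X + (t : ℂ) • 1).PosSemidef :=
  (gramSum_posSemidef hτ X).add (smul_one_posSemidef ht)

end GramSum

open scoped Matrix.Norms.L2Operator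

/-- Standing assumptions on the resolvent of a random Gram matrix. -/
structure ResSetup {N K : ℕ} (B : Matrix (Fin N) (Fin N) ℂ) (ρ c τm : ℝ) (τ : Fin K → ℝ) :
    Prop where
  herm : B.IsHermitian
  ρ_pos : 0 < ρ
  norm_le : ‖B * B‖ / ρ ≤ c
  τ_nonneg : ∀ k, 0 ≤ τ k
  τ_le : ∀ k, τ k ≤ τm
  τm_nonneg : 0 ≤ τm

/-! ### Fluctuations of the trace of the resolvent. -/

section Estimates

variable {N K : ℕ} {B : Matrix (Fin N) (Fin N) ℂ} {ρ c τm : ℝ} {τ : Fin K → ℝ}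

namespace ResSetup

lemma c_nonneg (h : ResSetup B ρ c τm τ) : 0 ≤ c :=
  (div_nonneg (norm_nonneg _) h.ρ_pos.le).trans h.norm_le

lemma posSemidef (h : ResSetup B ρ c τm τ) {t : ℝ} (ht : 0 ≤ t) (X : Fin K → Fin N → ℂ) :
    (shiftRes B ρ τ t X).PosSemidef :=
  resolv_posSemidef h.herm h.ρ_pos (shift_posSemidef h.τ_nonneg ht X)

lemma norm_shiftRes_le (h : ResSetup B ρ c τm τ) {t : ℝ} (ht : 0 ≤ t) (X : Fin K → Fin N → ℂ) :
    ‖shiftRes B ρ τ t X‖ ≤ c :=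
  (norm_resolv_le h.herm h.ρ_pos (shift_posSemidef h.τ_nonneg ht X)).trans h.norm_le

lemma continuous_shiftRes (h : ResSetup B ρ c τm τ) {t : ℝ} (ht : 0 ≤ t) :
    Continuous (shiftRes B ρ τ t) :=
  continuous_resolv h.herm h.ρ_pos (continuous_gramSum.add continuous_const)
    fun X => shift_posSemidef h.τ_nonneg ht X

end ResSetup

lemma norm_pow_le_pow {M : Matrix (Fin N) (Fin N) ℂ} (hM : ‖M‖ ≤ c) (k : ℕ) (hk : 0 < k) :
    ‖M ^ k‖ ≤ c ^ k :=
  (norm_pow_le' M hk).trans (pow_le_pow_left₀ (norm_nonneg _) hM k)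

lemma abs_reTr_le_of_norm_le {A : Matrix (Fin N) (Fin N) ℂ} {a : ℝ} (h : ‖A‖ ≤ a) :
    |reTr A| ≤ N * a := by
  refine (abs_reTr_le A).trans ?_
  rw [Fintype.card_fin]
  gcongr

lemma norm_hermPart_le (A : Matrix (Fin N) (Fin N) ℂ) :
    ‖((1 / 2 : ℝ) : ℂ) • (A + Aᴴ)‖ ≤ ‖A‖ := by
  rw [norm_smul]
  have h1 : ‖A + Aᴴ‖ ≤ ‖A‖ + ‖A‖ := by
    refine (norm_add_le _ _).trans ?_
    rw [Matrix.l2_opNorm_conjTranspose]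
  have h2 : ‖((1 / 2 : ℝ) : ℂ)‖ = 1 / 2 := by
    rw [Complex.norm_real]; norm_num
  rw [h2]
  linarith

/-- Variance bound for the real part of a Gaussian quadratic form. -/
lemma qform_variance_le (A : Matrix (Fin N) (Fin N) ℂ) {a : ℝ} (hA : ‖A‖ ≤ a) :
    MemLp (fun x => qform A x - reTr A) 3 (colLaw (Fin N)) ∧
      ∫ x, (qform A x - reTr A) ^ 2 ∂(colLaw (Fin N)) ≤ N * a ^ 2 := by
  set S := ((1 / 2 : ℝ) : ℂ) • (A + Aᴴ) with hS
  have hSh : S.IsHermitian := by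
    rw [Matrix.IsHermitian, hS, Matrix.conjTranspose_smul, Matrix.conjTranspose_add,
      Matrix.conjTranspose_conjTranspose, add_comm]
    simp
  have e1 : ∀ x, qform S x = qform A x := fun x => by
    rw [hS, qform_smul, qform_add, qform_conjTranspose]; ring
  have e2 : reTr S = reTr A := by
    rw [hS, reTr_smul, reTr_add, reTr_conjTranspose]; ring
  simp_rw [← e1, ← e2]
  refine ⟨by exact_mod_cast memLp_qform_sub_reTr hSh 3, ?_⟩
  rw [integral_qform_sub_reTr_sq hSh]
  exact (le_abs_self _).trans (abs_reTr_le_of_norm_le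
    (norm_pow_le_pow ((norm_hermPart_le A).trans hA) 2 (by norm_num)))

lemma integral_abs_qform_sub_le (A : Matrix (Fin N) (Fin N) ℂ) {a : ℝ} (hA : ‖A‖ ≤ a) :
    ∫ x, |qform A x - reTr A| ∂(colLaw (Fin N)) ≤ √N * a := by
  obtain ⟨h1, h2⟩ := qform_variance_le A hA
  have ha : 0 ≤ a := (norm_nonneg _).trans hA
  have h3 := sq_integral_abs_le (h1.integrable (by norm_num))
    ((h1.mono_exponent (by norm_num : (2 : ℝ≥0∞) ≤ 3)).integrable_sq)
  refine abs_le_of_sq_le_sq' (h3.trans (h2.trans (le_of_eq ?_))) (by positivity) |>.2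
  rw [mul_pow, Real.sq_sqrt (Nat.cast_nonneg N)]

lemma qform_one_eq (x : Fin N → ℂ) : qform 1 x = (star x ⬝ᵥ x).re := by
  rw [qform, Matrix.one_mulVec]

lemma qform_one_nonneg (x : Fin N → ℂ) : 0 ≤ qform 1 x :=
  qform_nonneg Matrix.PosSemidef.one x

lemma abs_qform_le_of_norm_le {A : Matrix (Fin N) (Fin N) ℂ} {a : ℝ} (hA : ‖A‖ ≤ a)
    (x : Fin N → ℂ) : |qform A x| ≤ a * qform 1 x := by
  refine (abs_qform_le A x).trans ?_
  rw [← qform_one_eq]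
  exact mul_le_mul_of_nonneg_right hA (qform_one_nonneg x)

/-- The decrement of the trace of the resolvent under a rank-one perturbation has small
variance. -/
lemma integral_rankOne_decrement_le {M : Matrix (Fin N) (Fin N) ℂ} (hM : M.PosSemidef)
    (hc : ‖M‖ ≤ c) {σ : ℝ} (hσ : 0 ≤ σ) (hσm : σ ≤ τm) :
    ∫ x, (σ * qform (M * 1 * M) x / (1 + σ * qform M x) -
        σ * reTr (M * 1 * M) / (1 + σ * reTr M)) ^ 2 ∂(colLaw (Fin N)) ≤ 4 * τm ^ 2 * N * c ^ 4 := by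
  have hc0 : 0 ≤ c := (norm_nonneg _).trans hc
  have hτm := hσ.trans hσm
  set A := M * 1 * M with hA
  have hAn : ‖A‖ ≤ c ^ 2 := by
    rw [hA, Matrix.mul_one, sq]
    exact (norm_mul_le _ _).trans (mul_le_mul hc hc (norm_nonneg _) hc0)
  obtain ⟨a1, a2⟩ := qform_variance_le A hAn
  obtain ⟨b1, b2⟩ := qform_variance_le M hc
  have a3 := (a1.mono_exponent (by norm_num : (2 : ℝ≥0∞) ≤ 3)).integrable_sq
  have b3 := (b1.mono_exponent (by norm_num : (2 : ℝ≥0∞) ≤ 3)).integrable_sq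
  have hβ : 0 ≤ reTr M := (RCLike.nonneg_iff.mp hM.trace_nonneg).1
  have hpt : ∀ x, (σ * qform A x / (1 + σ * qform M x) - σ * reTr A / (1 + σ * reTr M)) ^ 2 ≤
      2 * σ ^ 2 * (qform A x - reTr A) ^ 2 + 2 * (σ ^ 2 * c ^ 2) * (qform M x - reTr M) ^ 2 := by
    intro x
    have hb := qform_nonneg hM x
    have ha := abs_qform_conj_le hM hc 1 x
    rw [← hA] at ha
    have h1 : ‖(1 : Matrix (Fin N) (Fin N) ℂ)‖ ≤ 1 := by
      rw [Matrix.cstar_norm_def, map_one]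
      exact ContinuousLinearMap.norm_id_le
    have ha' : |qform A x| ≤ c * qform M x := by
      refine ha.trans ?_
      rw [mul_assoc]
      exact mul_le_of_le_one_left (by positivity) h1
    set p := 1 + σ * qform M x with hp
    set r := 1 + σ * reTr M with hr
    have hp1 : 1 ≤ p := by rw [hp]; nlinarith
    have hr1 : 1 ≤ r := by rw [hr]; nlinarith
    -- The split puts the random denominator p only next to its own numerator, where the ratio is at
    -- most c. Both terms are then controlled by centred quadratic forms.
    have e : σ * qform A x / p - σ * reTr A / r =
        σ * ((qform A x - reTr A) / r) - (σ * qform A x / p) * (σ * (qform M x - reTr M) / r) := by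
      have : σ * (qform M x - reTr M) = p - r := by rw [hp, hr]; ring
      rw [this]
      field_simp
      ring
    have hu : (σ * qform A x / p) ^ 2 ≤ c ^ 2 := by
      rw [← sq_abs, abs_div, abs_of_pos (by linarith : 0 < p), abs_mul, abs_of_nonneg hσ]
      refine pow_le_pow_left₀ (by positivity) ?_ 2
      rw [div_le_iff₀ (by linarith), hp]
      nlinarith
    have h2 : ((qform A x - reTr A) / r) ^ 2 ≤ (qform A x - reTr A) ^ 2 := by
      rw [div_pow]
      exact div_le_self (sq_nonneg _) (one_le_pow₀ hr1)
    have h3 : (σ * (qform M x - reTr M) / r) ^ 2 ≤ σ ^ 2 * (qform M x - reTr M) ^ 2 := by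
      rw [div_pow, mul_pow]
      exact div_le_self (by positivity) (one_le_pow₀ hr1)
    rw [e]
    calc _ ≤ 2 * (σ * ((qform A x - reTr A) / r)) ^ 2 +
          2 * ((σ * qform A x / p) * (σ * (qform M x - reTr M) / r)) ^ 2 := by
          nlinarith [sq_nonneg (σ * ((qform A x - reTr A) / r) +
            (σ * qform A x / p) * (σ * (qform M x - reTr M) / r))]
      _ = 2 * (σ ^ 2 * ((qform A x - reTr A) / r) ^ 2) +
          2 * ((σ * qform A x / p) ^ 2 * (σ * (qform M x - reTr M) / r) ^ 2) := by ring
      _ ≤ 2 * (σ ^ 2 * (qform A x - reTr A) ^ 2) +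
          2 * (c ^ 2 * (σ ^ 2 * (qform M x - reTr M) ^ 2)) := by gcongr
      _ = _ := by ring
  have hI := (a3.hasMean.const_mul (2 * σ ^ 2)).add (b3.hasMean.const_mul (2 * (σ ^ 2 * c ^ 2)))
  refine (integral_mono_of_nonneg (ae_of_all _ fun x => sq_nonneg _) hI.1
    (ae_of_all _ hpt)).trans ?_
  rw [hI.2]
  calc _ ≤ 2 * σ ^ 2 * (N * (c ^ 2) ^ 2) + 2 * (σ ^ 2 * c ^ 2) * (N * c ^ 2) := by gcongr
    _ = 4 * σ ^ 2 * N * c ^ 4 := by ring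
    _ ≤ _ := by gcongr

namespace ResSetup

variable (h : ResSetup B ρ c τm τ)
include h

lemma abs_reTr_shiftRes_le {t : ℝ} (ht : 0 ≤ t) (X : Fin K → Fin N → ℂ) :
    |reTr (shiftRes B ρ τ t X)| ≤ N * c :=
  abs_reTr_le_of_norm_le (h.norm_shiftRes_le ht X)

lemma bddMeas_reTr {t : ℝ} (ht : 0 ≤ t) : BddMeas fun X => reTr (shiftRes B ρ τ t X) :=
  ⟨(continuous_reTr (h.continuous_shiftRes ht)).measurable, _, h.abs_reTr_shiftRes_le ht⟩

lemma shiftRes_update (t : ℝ) (X : Fin K → Fin N → ℂ) (k : Fin K) (x : Fin N → ℂ) :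
    shiftRes B ρ τ t (Function.update X k x) =
      resolv B ρ (gramSum τ (Function.update X k 0) + (t : ℂ) • 1 + (τ k : ℂ) • outer x) := by
  rw [shiftRes, gramSum_update, add_right_comm]

/-- Leave-one-out: the right-hand side uses a resolvent that does not depend on column k, so
Gaussian concentration in that column applies. -/
lemma qform_mul_shiftRes {t : ℝ} (ht : 0 ≤ t) (X : Fin K → Fin N → ℂ) (k : Fin K)
    (A : Matrix (Fin N) (Fin N) ℂ) :
    qform (A * shiftRes B ρ τ t X) (X k) =
      qform (A * shiftRes B ρ τ t (Function.update X k 0)) (X k) /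
        (1 + τ k * qform (shiftRes B ρ τ t (Function.update X k 0)) (X k)) := by
  have e := h.shiftRes_update t X k (X k)
  rw [Function.update_eq_self] at e
  rw [e, qform_mul_resolv_rankOne h.herm h.ρ_pos (shift_posSemidef h.τ_nonneg ht _)
    (h.τ_nonneg k)]
  rfl

lemma abs_reTr_mul_sub_update_le {t : ℝ} (ht : 0 ≤ t) (X : Fin K → Fin N → ℂ) (k : Fin K)
    (A : Matrix (Fin N) (Fin N) ℂ) :
    |reTr (A * shiftRes B ρ τ t (Function.update X k 0)) - reTr (A * shiftRes B ρ τ t X)| ≤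
      ‖A‖ * c := by
  have e := h.shiftRes_update t X k (X k)
  rw [Function.update_eq_self] at e
  rw [e]
  exact abs_reTr_mul_resolv_sub_rankOne_le h.herm h.ρ_pos
    (shift_posSemidef h.τ_nonneg ht _) (h.τ_nonneg k) A h.norm_le

lemma reTr_update {t : ℝ} (ht : 0 ≤ t) (X : Fin K → Fin N → ℂ) (k : Fin K) (x : Fin N → ℂ) :
    reTr (shiftRes B ρ τ t (Function.update X k x)) =
      reTr (shiftRes B ρ τ t (Function.update X k 0)) -
      τ k * qform (shiftRes B ρ τ t (Function.update X k 0) * 1 *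
        shiftRes B ρ τ t (Function.update X k 0)) x /
        (1 + τ k * qform (shiftRes B ρ τ t (Function.update X k 0)) x) := by
  have := reTr_mul_resolv_sub_rankOne (x := x) h.herm h.ρ_pos
    (shift_posSemidef h.τ_nonneg ht (Function.update X k 0)) (h.τ_nonneg k) 1
  rw [Matrix.one_mul, Matrix.one_mul] at this
  rw [h.shiftRes_update]
  simp only [shiftRes]
  linarith

/-- Adding a column adds a positive rank-one term, which lowers the trace by an amount between 0 and
c. -/
lemma abs_reTr_update_sub_le {t : ℝ} (ht : 0 ≤ t) (X : Fin K → Fin N → ℂ) (k : Fin K)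
    (x : Fin N → ℂ) :
    reTr (shiftRes B ρ τ t (Function.update X k 0)) - c ≤
        reTr (shiftRes B ρ τ t (Function.update X k x)) ∧
      reTr (shiftRes B ρ τ t (Function.update X k x)) ≤
        reTr (shiftRes B ρ τ t (Function.update X k 0)) := by
  have h1 := h.abs_reTr_mul_sub_update_le ht (Function.update X k x) k 1
  rw [Function.update_idem, Matrix.one_mul, Matrix.one_mul] at h1
  have hn : ‖(1 : Matrix (Fin N) (Fin N) ℂ)‖ ≤ 1 := by
    rw [Matrix.cstar_norm_def, map_one]
    exact ContinuousLinearMap.norm_id_le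
  have h2 : ‖(1 : Matrix (Fin N) (Fin N) ℂ)‖ * c ≤ c := mul_le_of_le_one_left h.c_nonneg hn
  refine ⟨by linarith [(abs_le.mp (h1.trans h2)).2], ?_⟩
  rw [h.reTr_update ht X k x]
  have hM := h.posSemidef ht (Function.update X k 0)
  have h3 : 0 ≤ qform (shiftRes B ρ τ t (Function.update X k 0) * 1 *
        shiftRes B ρ τ t (Function.update X k 0)) x := by
    rw [qform_mul_self_eq hM.1]
    exact qform_one_nonneg _
  have h4 := qform_nonneg hM x
  have h5 := h.τ_nonneg k
  have : 0 ≤ τ k * qform (shiftRes B ρ τ t (Function.update X k 0) * 1 *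
        shiftRes B ρ τ t (Function.update X k 0)) x /
        (1 + τ k * qform (shiftRes B ρ τ t (Function.update X k 0)) x) :=
    div_nonneg (mul_nonneg h5 h3) (add_nonneg zero_le_one (mul_nonneg h5 h4))
  linarith

/-- Second and third central moments of the trace of the resolvent. -/
lemma moments_reTr {t : ℝ} (ht : 0 ≤ t) {V : ℝ} (hV : K * (4 * τm ^ 2 * N * c ^ 4) ≤ V) :
    ∫ X, (reTr (shiftRes B ρ τ t X) -
      ∫ X', reTr (shiftRes B ρ τ t X') ∂(Measure.pi fun _ => colLaw (Fin N))) ^ 2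
        ∂(Measure.pi fun _ => colLaw (Fin N)) ≤ V ∧
    |∫ X, (reTr (shiftRes B ρ τ t X) -
      ∫ X', reTr (shiftRes B ρ τ t X') ∂(Measure.pi fun _ => colLaw (Fin N))) ^ 3
        ∂(Measure.pi fun _ => colLaw (Fin N))| ≤ V * (3 * (1 + V) + c) := by
  have hf := h.bddMeas_reTr ht
  have hc := h.c_nonneg
  have key := moments_pi_le (μ := colLaw (Fin N)) K hf (v := 4 * τm ^ 2 * N * c ^ 4) (b := c)
    (fun k X => by
      -- Centre at the value obtained by replacing the quadratic forms in the fresh column by their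
      -- traces, rather than at the conditional mean.
      refine (integral_sub_mean_sq_le _ (hf.update X k)
        (reTr (shiftRes B ρ τ t (Function.update X k 0)) -
          τ k * reTr (shiftRes B ρ τ t (Function.update X k 0) * 1 *
            shiftRes B ρ τ t (Function.update X k 0)) /
            (1 + τ k * reTr (shiftRes B ρ τ t (Function.update X k 0))))).trans ?_
      refine le_trans (le_of_eq ?_) (integral_rankOne_decrement_le
        (h.posSemidef ht (Function.update X k 0)) (h.norm_shiftRes_le ht _) (h.τ_nonneg k)
        (h.τ_le k))
      refine integral_congr_ae (ae_of_all _ fun x => ?_)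
      simp only
      rw [h.reTr_update ht X k x]
      ring)
    (fun k X x => by
      -- All values, hence also their mean, lie in an interval of length c.
      have hx := h.abs_reTr_update_sub_le ht X k
      have hI := (hf.update X k).integrable (colLaw (Fin N))
      have i1 := integral_mono (integrable_const _) hI fun x => (hx x).1
      have i2 := integral_mono hI (integrable_const _) fun x => (hx x).2
      simp only [integral_const, probReal_univ, one_smul] at i1 i2
      rw [abs_le]
      constructor <;> linarith [(hx x).1, (hx x).2])
  have hv0 : 0 ≤ K * (4 * τm ^ 2 * N * c ^ 4) := by positivity
  refine ⟨key.1.trans hV, key.2.trans ?_⟩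
  have hV0 := hv0.trans hV
  rw [← mul_assoc]
  gcongr

end ResSetup

end Estimates

end LMMSE

namespace LMMSE

open scoped Matrix.Norms.L2Operator

/-! ### The mean trace almost solves the fixed-point equation. -/

section DeterministicEquivalent

variable {N K : ℕ}

/-- A Gaussian quadratic form built on the other columns concentrates around its trace. -/
lemma integral_abs_qform_update_le {A : (Fin K → Fin N → ℂ) → Matrix (Fin N) (Fin N) ℂ}
    (hA : Continuous A) {a : ℝ} (ha : ∀ X, ‖A X‖ ≤ a) (k : Fin K) :
    Integrable (fun X : Fin K → Fin N → ℂ => |qform (A (Function.update X k 0)) (X k) -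
      reTr (A (Function.update X k 0))|) (Measure.pi fun _ => colLaw (Fin N)) ∧
    ∫ X : Fin K → Fin N → ℂ, |qform (A (Function.update X k 0)) (X k) - reTr (A (Function.update X k 0))|
      ∂(Measure.pi fun _ => colLaw (Fin N)) ≤ √N * a := by
  have hc : Continuous fun X : Fin K → Fin N → ℂ => A (Function.update X k 0) :=
    hA.comp (continuous_id.update k continuous_const)
  have hm : Continuous fun X : Fin K → Fin N → ℂ => |qform (A (Function.update X k 0)) (X k) -
      reTr (A (Function.update X k 0))| :=
    ((continuous_qform_comp hc (continuous_apply k)).sub (continuous_reTr hc)).abs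
  have hq : Integrable (fun X : Fin K → Fin N → ℂ => qform 1 (X k))
      (Measure.pi fun _ => colLaw (Fin N)) :=
    (measurePreserving_eval (fun _ : Fin K => colLaw (Fin N)) k).integrable_comp_of_integrable
      (integral_qform (n := Fin N) Matrix.isHermitian_one).1
  have hI : Integrable (fun X : Fin K → Fin N → ℂ => |qform (A (Function.update X k 0)) (X k) -
      reTr (A (Function.update X k 0))|) (Measure.pi fun _ => colLaw (Fin N)) := by
    refine ((hq.const_mul a).add (integrable_const (N * a))).mono' hm.aestronglyMeasurable
      (ae_of_all _ fun X => ?_)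
    rw [Real.norm_eq_abs, abs_abs]
    exact (abs_sub _ _).trans (add_le_add (abs_qform_le_of_norm_le (ha _) _)
      (abs_reTr_le_of_norm_le (ha _)))
  refine ⟨hI, ?_⟩
  set F : (Fin K → Fin N → ℂ) → ℝ := fun X => |qform (A (Function.update X k 0)) (X k) -
      reTr (A (Function.update X k 0))| with hF
  -- Resampling column k makes it independent of the frozen matrix, so the bound for a deterministic
  -- matrix applies under the inner integral.
  have hmp := measurePreserving_update (colLaw (Fin N)) k
  have hF' : ∀ X x, F (Function.update X k x) =
      |qform (A (Function.update X k 0)) x - reTr (A (Function.update X k 0))| := fun X x => by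
    simp only [hF, Function.update_idem, Function.update_self]
  have hI' : Integrable (fun z : (Fin K → Fin N → ℂ) × (Fin N → ℂ) =>
      F (Function.update z.1 k z.2)) ((Measure.pi fun _ => colLaw (Fin N)).prod (colLaw (Fin N))) :=
    hmp.integrable_comp_of_integrable hI
  have e : ∫ X, F X ∂(Measure.pi fun _ => colLaw (Fin N)) =
      ∫ z, F (Function.update z.1 k z.2) ∂((Measure.pi fun _ => colLaw (Fin N)).prod
        (colLaw (Fin N))) := by
    conv_lhs => rw [← hmp.map_eq]
    exact integral_map hmp.measurable.aemeasurable hm.aestronglyMeasurable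
  rw [e, integral_prod _ hI']
  have hle : ∀ X : Fin K → Fin N → ℂ,
      ∫ x, F (Function.update X k x) ∂(colLaw (Fin N)) ≤ √N * a := fun X => by
    simp_rw [hF']
    exact integral_abs_qform_sub_le _ (ha _)
  refine (integral_mono hI'.integral_prod_left (integrable_const (√N * a)) hle).trans ?_
  rw [integral_const, probReal_univ, one_smul]

variable {B : Matrix (Fin N) (Fin N) ℂ} {ρ c τm : ℝ} {τ : Fin K → ℝ}

lemma div_sub_div_abs_le {a b T m τ : ℝ} (hb : 0 ≤ b) (hm : 0 ≤ m) (hτ : 0 ≤ τ) :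
    |a / (1 + τ * b) - T / (1 + τ * m)| ≤ |a - T| + |T| * (τ * |b - m|) := by
  have h1 : 1 ≤ 1 + τ * b := by nlinarith
  have h2 : 1 ≤ 1 + τ * m := by nlinarith
  have h12 : 1 ≤ (1 + τ * b) * (1 + τ * m) := by nlinarith
  have e : a / (1 + τ * b) - T / (1 + τ * m) =
      (a - T) / (1 + τ * b) - T * (τ * (b - m)) / ((1 + τ * b) * (1 + τ * m)) := by
    field_simp
    ring
  rw [e]
  refine (abs_sub _ _).trans (add_le_add ?_ ?_)
  · rw [abs_div, abs_of_pos (by linarith : 0 < 1 + τ * b)]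
    exact div_le_self (abs_nonneg _) h1
  · rw [abs_div, abs_of_pos (by linarith : 0 < (1 + τ * b) * (1 + τ * m)), abs_mul, abs_mul τ,
      abs_of_nonneg hτ]
    exact div_le_self (by positivity) h12

namespace ResSetup

variable (h : ResSetup B ρ c τm τ)
include h

/-- With A the resolvent at the scalar t + g, the resolvent identity gives A − M = M(∑ τ_k x_k x_k*
− g)A; taking traces turns each rank-one term into a quadratic form. -/
lemma reTr_resolv_sub {t g : ℝ} (ht : 0 ≤ t) (hg : 0 ≤ g) (X : Fin K → Fin N → ℂ) :
    reTr (resolv B ρ (((t + g : ℝ) : ℂ) • 1)) - reTr (shiftRes B ρ τ t X) =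
      ∑ k, τ k * qform (resolv B ρ (((t + g : ℝ) : ℂ) • 1) * shiftRes B ρ τ t X) (X k) -
        g * reTr (resolv B ρ (((t + g : ℝ) : ℂ) • 1) * shiftRes B ρ τ t X) := by
  set A := resolv B ρ (((t + g : ℝ) : ℂ) • 1) with hA
  set M := shiftRes B ρ τ t X with hM
  have e : A - M = M * gramSum τ X * A - (g : ℂ) • (M * A) := by
    have := resolv_sub h.herm h.ρ_pos (shift_posSemidef h.τ_nonneg ht X)
      (smul_one_posSemidef (N := N) (add_nonneg ht hg))
    change M - A = M * _ * A at this
    rw [← neg_sub, this]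
    have e2 : (((t + g : ℝ) : ℂ) • (1 : Matrix (Fin N) (Fin N) ℂ) -
        (gramSum τ X + (t : ℂ) • 1)) = (g : ℂ) • 1 - gramSum τ X := by
      push_cast
      rw [add_smul]
      abel
    rw [e2, Matrix.mul_sub, Matrix.sub_mul, Matrix.mul_smul, Matrix.mul_one, Matrix.smul_mul]
    abel
  have e3 : reTr (M * gramSum τ X * A) = ∑ k, τ k * qform (A * M) (X k) := by
    rw [reTr, Matrix.trace_mul_comm, ← Matrix.mul_assoc, gramSum, Matrix.mul_sum,
      Matrix.trace_sum, Complex.re_sum]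
    refine Finset.sum_congr rfl fun k _ => ?_
    rw [Matrix.mul_smul, ← reTr_mul_outer, ← reTr_smul, reTr]
  have e4 : reTr (M * A) = reTr (A * M) := by rw [reTr, Matrix.trace_mul_comm, reTr]
  rw [← reTr_sub, e, reTr_sub, reTr_smul, e3, e4]

/-- The mean trace of the resolvent nearly satisfies the fixed-point equation. -/
theorem abs_reTr_resolv_sub_integral_le {t : ℝ} (ht : 0 ≤ t) {V m : ℝ}
    (hm : m = ∫ X, reTr (shiftRes B ρ τ t X) ∂(Measure.pi fun _ => colLaw (Fin N)))
    (hV : K * (4 * τm ^ 2 * N * c ^ 4) ≤ V) :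
    |reTr (resolv B ρ (((t + ∑ k, τ k / (1 + τ k * m) : ℝ) : ℂ) • 1)) - m| ≤
      K * (τm * (√N * c ^ 2 + c ^ 2 + N * c ^ 2 * (τm * (√N * c + c + √V)))) := by
  have hc := h.c_nonneg
  have hτm := h.τm_nonneg
  have hφ0 : ∀ X, 0 ≤ reTr (shiftRes B ρ τ t X) := fun X =>
    (RCLike.nonneg_iff.mp (h.posSemidef ht X).trace_nonneg).1
  have hm0 : 0 ≤ m := hm ▸ integral_nonneg hφ0
  set g := ∑ k, τ k / (1 + τ k * m) with hg
  have hg0 : 0 ≤ g := Finset.sum_nonneg fun k _ => div_nonneg (h.τ_nonneg k)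
    (add_nonneg zero_le_one (mul_nonneg (h.τ_nonneg k) hm0))
  set A := resolv B ρ (((t + g : ℝ) : ℂ) • 1) with hA
  have hAn : ‖A‖ ≤ c := (norm_resolv_le h.herm h.ρ_pos
    (smul_one_posSemidef (add_nonneg ht hg0))).trans h.norm_le
  set μ := (Measure.pi fun _ : Fin K => colLaw (Fin N)) with hμ
  set φ := fun X => reTr (shiftRes B ρ τ t X) with hφ
  have hφb : BddMeas φ := h.bddMeas_reTr ht
  have hAM : ∀ X, ‖A * shiftRes B ρ τ t X‖ ≤ c ^ 2 := fun X => by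
    rw [sq]
    exact (norm_mul_le _ _).trans (mul_le_mul hAn (h.norm_shiftRes_le ht X) (norm_nonneg _) hc)
  set u := fun (k : Fin K) (X : Fin K → Fin N → ℂ) =>
    |qform (A * shiftRes B ρ τ t (Function.update X k 0)) (X k) -
      reTr (A * shiftRes B ρ τ t (Function.update X k 0))| with hu
  set v := fun (k : Fin K) (X : Fin K → Fin N → ℂ) =>
    |qform (shiftRes B ρ τ t (Function.update X k 0)) (X k) -
      reTr (shiftRes B ρ τ t (Function.update X k 0))| with hv
  have hui := fun k => integral_abs_qform_update_le (A := fun X => A * shiftRes B ρ τ t X)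
    (continuous_const.matrix_mul (h.continuous_shiftRes ht)) hAM k
  have hvi := fun k => integral_abs_qform_update_le (h.continuous_shiftRes ht)
    (h.norm_shiftRes_le ht) k
  -- The choice of g matches term k with τ_k Tr(AM)/(1 + τ_k m). Three replacements cost the listed
  -- errors: quadratic forms by traces (u and v), leave-one-out traces by full traces (c² and c),
  -- and the random trace by its mean (|φ − m|).
  have hpt : ∀ X, |reTr A - φ X| ≤ ∑ k, τm * (u k X + c ^ 2 +
      N * c ^ 2 * (τm * (v k X + c + |φ X - m|))) := by
    intro X
    rw [hφ]
    simp only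
    rw [h.reTr_resolv_sub ht hg0 X, ← hA, hg, Finset.sum_mul, ← Finset.sum_sub_distrib]
    refine (Finset.abs_sum_le_sum_abs _ _).trans (Finset.sum_le_sum fun k _ => ?_)
    rw [h.qform_mul_shiftRes ht X k A]
    have hτ := h.τ_nonneg k
    have hMk := h.posSemidef ht (Function.update X k 0)
    have hb := qform_nonneg hMk (X k)
    set a := qform (A * shiftRes B ρ τ t (Function.update X k 0)) (X k)
    set b := qform (shiftRes B ρ τ t (Function.update X k 0)) (X k)
    set T := reTr (A * shiftRes B ρ τ t X) with hT
    have e : τ k * (a / (1 + τ k * b)) - τ k / (1 + τ k * m) * T =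
        τ k * (a / (1 + τ k * b) - T / (1 + τ k * m)) := by ring
    rw [e, abs_mul, abs_of_nonneg hτ]
    have hT' : |T| ≤ N * c ^ 2 := abs_reTr_le_of_norm_le (hAM X)
    have h1 : |a - T| ≤ u k X + c ^ 2 := by
      have h2 := h.abs_reTr_mul_sub_update_le ht X k A
      have h3 : ‖A‖ * c ≤ c ^ 2 := by rw [sq]; gcongr
      calc |a - T| ≤ |a - reTr (A * shiftRes B ρ τ t (Function.update X k 0))| +
            |reTr (A * shiftRes B ρ τ t (Function.update X k 0)) - T| := abs_sub_le _ _ _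
        _ ≤ _ := add_le_add le_rfl (h2.trans h3)
    have h4 : |b - m| ≤ v k X + c + |reTr (shiftRes B ρ τ t X) - m| := by
      have h2 := h.abs_reTr_update_sub_le ht X k (X k)
      rw [Function.update_eq_self] at h2
      have h3 : |reTr (shiftRes B ρ τ t (Function.update X k 0)) - reTr (shiftRes B ρ τ t X)|
          ≤ c := by
        rw [abs_le]; constructor <;> linarith [h2.1, h2.2]
      calc |b - m| ≤ |b - reTr (shiftRes B ρ τ t X)| + |reTr (shiftRes B ρ τ t X) - m| :=
            abs_sub_le _ _ _
        _ ≤ (|b - reTr (shiftRes B ρ τ t (Function.update X k 0))| +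
            |reTr (shiftRes B ρ τ t (Function.update X k 0)) - reTr (shiftRes B ρ τ t X)|) + _ :=
            add_le_add (abs_sub_le _ _ _) le_rfl
        _ ≤ _ := by gcongr
    have hbr : 0 ≤ v k X + c + |reTr (shiftRes B ρ τ t X) - m| := (abs_nonneg _).trans h4
    have hbr' : 0 ≤ u k X + c ^ 2 := (abs_nonneg _).trans h1
    refine mul_le_mul (h.τ_le k) ((div_sub_div_abs_le hb hm0 hτ).trans ?_) (abs_nonneg _) hτm
    refine add_le_add h1 (mul_le_mul hT' (mul_le_mul (h.τ_le k) h4 (abs_nonneg _) hτm)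
      (by positivity) (by positivity))
  have hw : HasMean μ (fun X => |φ X - m|) (∫ X, |φ X - m| ∂μ) :=
    ((hφb.sub (BddMeas.const m)).abs.integrable μ).hasMean
  have hw' : ∫ X, |φ X - m| ∂μ ≤ √V := by
    have h1 := sq_integral_abs_le (μ := μ) ((hφb.sub (BddMeas.const m)).integrable μ)
      (((hφb.sub (BddMeas.const m)).pow 2).integrable μ)
    have h2 := (h.moments_reTr ht hV).1
    rw [← hm] at h2
    exact Real.le_sqrt_of_sq_le (h1.trans h2)
  have hterm : ∀ k, HasMean μ (fun X => τm * (u k X + c ^ 2 +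
      N * c ^ 2 * (τm * (v k X + c + |φ X - m|)))) (τm * (∫ X, u k X ∂μ + c ^ 2 +
      N * c ^ 2 * (τm * (∫ X, v k X ∂μ + c + ∫ X, |φ X - m| ∂μ)))) := fun k =>
    (((hui k).1.hasMean.add (HasMean.const _)).add (((((hvi k).1.hasMean.add
      (HasMean.const _)).add hw).const_mul τm).const_mul _)).const_mul τm
  have e1 : reTr A - m = ∫ X, (reTr A - φ X) ∂μ := by
    rw [integral_sub (integrable_const _) (hφb.integrable μ), hm]
    simp
  rw [e1]
  refine abs_integral_le_integral_abs.trans ?_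
  refine (integral_mono (((BddMeas.const (reTr A)).sub hφb).abs.integrable μ)
    (integrable_finsetSum _ fun k _ => (hterm k).1) hpt).trans ?_
  rw [integral_finsetSum _ fun k _ => (hterm k).1]
  refine (Finset.sum_le_sum (g := fun _ => τm * (√N * c ^ 2 + c ^ 2 +
    N * c ^ 2 * (τm * (√N * c + c + √V)))) fun k _ => ?_).trans (by simp)
  rw [(hterm k).2]
  have hu1 := (hui k).2
  have hv1 := (hvi k).2
  change ∫ X, u k X ∂μ ≤ _ at hu1
  change ∫ X, v k X ∂μ ≤ _ at hv1
  gcongr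

end ResSetup

end DeterministicEquivalent

end LMMSE

namespace LMMSE

open scoped Matrix.Norms.L2Operator

/-! ### Moments of the quadratic form, and the expansion in the shift. -/

section QuadraticFormMoments

variable {N K : ℕ} {B : Matrix (Fin N) (Fin N) ℂ} {ρ c τm : ℝ} {τ : Fin K → ℝ}

lemma memLp_qform_one : MemLp (qform (1 : Matrix (Fin N) (Fin N) ℂ)) 3 (colLaw (Fin N)) := by
  have h := (memLp_qform_sub_reTr (n := Fin N) Matrix.isHermitian_one 3).add
    (memLp_const (reTr (1 : Matrix (Fin N) (Fin N) ℂ)))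
  refine MemLp.ae_eq (ae_of_all _ fun x => ?_) h
  simp

/-- Moments of a shifted Gaussian quadratic form. -/
lemma hasMean_qform_shift {A : Matrix (Fin N) (Fin N) ℂ} (hA : A.IsHermitian) (m : ℝ) :
    HasMean (colLaw (Fin N)) (fun x => (qform A x - m) ^ 2)
      (reTr (A ^ 2) + (reTr A - m) ^ 2) ∧
    HasMean (colLaw (Fin N)) (fun x => (qform A x - m) ^ 3)
      (2 * reTr (A ^ 3) + 3 * (reTr (A ^ 2) * (reTr A - m)) + (reTr A - m) ^ 3) := by
  have h3 : MemLp (fun x => qform A x - reTr A) 3 (colLaw (Fin N)) :=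
    by exact_mod_cast memLp_qform_sub_reTr hA 3
  have k1 : HasMean (colLaw (Fin N)) (fun x => qform A x - reTr A) 0 :=
    ⟨h3.integrable (by norm_num), integral_qform_sub_reTr hA⟩
  have k2 : HasMean (colLaw (Fin N)) (fun x => (qform A x - reTr A) ^ 2) (reTr (A ^ 2)) :=
    ⟨(h3.mono_exponent (by norm_num : (2 : ℝ≥0∞) ≤ 3)).integrable_sq,
      integral_qform_sub_reTr_sq hA⟩
  have k3 : HasMean (colLaw (Fin N)) (fun x => (qform A x - reTr A) ^ 3) (2 * reTr (A ^ 3)) :=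
    ⟨MemLp.integrable_pow_three h3, integral_qform_sub_reTr_pow_three hA⟩
  refine ⟨((k2.add (k1.const_mul (2 * (reTr A - m)))).add
      (HasMean.const ((reTr A - m) ^ 2))).congr (fun x => by ring) (by ring),
    (((k3.add (k2.const_mul (3 * (reTr A - m)))).add
      (k1.const_mul (3 * (reTr A - m) ^ 2))).add
      (HasMean.const ((reTr A - m) ^ 3))).congr (fun x => by ring) (by ring)⟩

namespace ResSetup

variable (h : ResSetup B ρ c τm τ)
include h

lemma continuous_qform_shiftRes {t : ℝ} (ht : 0 ≤ t) :
    Continuous fun z : (Fin N → ℂ) × (Fin K → Fin N → ℂ) => qform (shiftRes B ρ τ t z.2) z.1 :=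
  continuous_qform_comp ((h.continuous_shiftRes ht).comp continuous_snd) continuous_fst

lemma memLp_qform_shiftRes {t : ℝ} (ht : 0 ≤ t) :
    MemLp (fun z : (Fin N → ℂ) × (Fin K → Fin N → ℂ) => qform (shiftRes B ρ τ t z.2) z.1) 3
      ((colLaw (Fin N)).prod (Measure.pi fun _ => colLaw (Fin N))) := by
  have h1 : MemLp (fun z : (Fin N → ℂ) × (Fin K → Fin N → ℂ) => c * qform 1 z.1) 3
      ((colLaw (Fin N)).prod (Measure.pi fun _ => colLaw (Fin N))) :=
    (memLp_qform_one.comp_measurePreserving measurePreserving_fst).const_mul c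
  refine h1.mono (h.continuous_qform_shiftRes ht).aestronglyMeasurable (ae_of_all _ fun z => ?_)
  rw [Real.norm_eq_abs, Real.norm_eq_abs]
  exact (abs_qform_le_of_norm_le (h.norm_shiftRes_le ht _) _).trans (le_abs_self _)

lemma bddMeas_reTr_pow {t : ℝ} (ht : 0 ≤ t) (k : ℕ) (hk : 0 < k) :
    BddMeas fun X => reTr (shiftRes B ρ τ t X ^ k) :=
  ⟨(continuous_reTr ((h.continuous_shiftRes ht).pow k)).measurable, N * c ^ k, fun X =>
    abs_reTr_le_of_norm_le (norm_pow_le_pow (h.norm_shiftRes_le ht X) k hk)⟩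

/-- The first three central moments of the quadratic form, in terms of traces. -/
theorem moments_qform {t : ℝ} (ht : 0 ≤ t) {m : ℝ}
    (hm : m = ∫ X, reTr (shiftRes B ρ τ t X) ∂(Measure.pi fun _ => colLaw (Fin N))) :
    ∫ z, qform (shiftRes B ρ τ t z.2) z.1
      ∂((colLaw (Fin N)).prod (Measure.pi fun _ => colLaw (Fin N))) = m ∧
    ∫ z, (qform (shiftRes B ρ τ t z.2) z.1 - m) ^ 2
      ∂((colLaw (Fin N)).prod (Measure.pi fun _ => colLaw (Fin N))) =
      ∫ X, reTr (shiftRes B ρ τ t X ^ 2) ∂(Measure.pi fun _ => colLaw (Fin N)) +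
      ∫ X, (reTr (shiftRes B ρ τ t X) - m) ^ 2 ∂(Measure.pi fun _ => colLaw (Fin N)) ∧
    ∫ z, (qform (shiftRes B ρ τ t z.2) z.1 - m) ^ 3
      ∂((colLaw (Fin N)).prod (Measure.pi fun _ => colLaw (Fin N))) =
      2 * ∫ X, reTr (shiftRes B ρ τ t X ^ 3) ∂(Measure.pi fun _ => colLaw (Fin N)) +
      3 * ∫ X, reTr (shiftRes B ρ τ t X ^ 2) * (reTr (shiftRes B ρ τ t X) - m)
        ∂(Measure.pi fun _ => colLaw (Fin N)) +
      ∫ X, (reTr (shiftRes B ρ τ t X) - m) ^ 3 ∂(Measure.pi fun _ => colLaw (Fin N)) := by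
  set μ := (Measure.pi fun _ : Fin K => colLaw (Fin N)) with hμ
  have h3 := h.memLp_qform_shiftRes ht
  have h3' : MemLp (fun z : (Fin N → ℂ) × (Fin K → Fin N → ℂ) =>
      qform (shiftRes B ρ τ t z.2) z.1 - m) 3 ((colLaw (Fin N)).prod μ) :=
    h3.sub (memLp_const m)
  have hφ := h.bddMeas_reTr ht
  have hφm := hφ.sub (BddMeas.const m)
  have b2 := h.bddMeas_reTr_pow ht 2 (by norm_num)
  have b3 := h.bddMeas_reTr_pow ht 3 (by norm_num)
  have hH := fun X => (h.posSemidef ht X).1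
  refine ⟨?_, ?_, ?_⟩
  · rw [integral_prod_symm _ (h3.integrable (by norm_num)), hm]
    exact integral_congr_ae (ae_of_all _ fun X => (integral_qform (hH X)).2)
  · rw [integral_prod_symm _ (h3'.mono_exponent (by norm_num : (2 : ℝ≥0∞) ≤ 3)).integrable_sq]
    rw [integral_congr_ae (ae_of_all _ fun X => (hasMean_qform_shift (hH X) m).1.2)]
    exact (((b2.integrable μ).hasMean).add ((hφm.pow 2).integrable μ).hasMean).2
  · rw [integral_prod_symm _ (MemLp.integrable_pow_three h3')]
    rw [integral_congr_ae (ae_of_all _ fun X => (hasMean_qform_shift (hH X) m).2.2)]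
    exact (((((b3.integrable μ).hasMean).const_mul 2).add
      (((b2.mul hφm).integrable μ).hasMean.const_mul 3)).add
        ((hφm.pow 3).integrable μ).hasMean).2

lemma shiftRes_zero_sub {t : ℝ} (ht : 0 ≤ t) (X : Fin K → Fin N → ℂ) :
    shiftRes B ρ τ 0 X - shiftRes B ρ τ t X =
      (t : ℂ) • (shiftRes B ρ τ 0 X * shiftRes B ρ τ t X) := by
  unfold shiftRes
  rw [resolv_sub h.herm h.ρ_pos (shift_posSemidef h.τ_nonneg le_rfl X)
    (shift_posSemidef h.τ_nonneg ht X)]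
  have e : gramSum τ X + (t : ℂ) • 1 - (gramSum τ X + ((0 : ℝ) : ℂ) • 1) = (t : ℂ) • 1 := by
    simp
  rw [e, Matrix.mul_smul, Matrix.mul_one, Matrix.smul_mul]

/-- Iterating this identity produces the Taylor expansion of Tr M_t at 0 with an exact remainder, so
the powers of M_0 are reached without differentiating. -/
lemma reTr_pow_mul_shiftRes {t : ℝ} (ht : 0 ≤ t) (X : Fin K → Fin N → ℂ) (k : ℕ) :
    reTr (shiftRes B ρ τ 0 X ^ k * shiftRes B ρ τ t X) =
      reTr (shiftRes B ρ τ 0 X ^ (k + 1)) -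
        t * reTr (shiftRes B ρ τ 0 X ^ (k + 1) * shiftRes B ρ τ t X) := by
  have e : shiftRes B ρ τ t X = shiftRes B ρ τ 0 X -
      (t : ℂ) • (shiftRes B ρ τ 0 X * shiftRes B ρ τ t X) := by
    rw [← h.shiftRes_zero_sub ht]; abel
  conv_lhs => rw [e]
  rw [Matrix.mul_sub, reTr_sub, Matrix.mul_smul, reTr_smul, ← Matrix.mul_assoc, ← pow_succ]

lemma abs_reTr_pow_mul_le {t : ℝ} (ht : 0 ≤ t) (X : Fin K → Fin N → ℂ) (k : ℕ) (hk : 0 < k) :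
    |reTr (shiftRes B ρ τ 0 X ^ k * shiftRes B ρ τ t X)| ≤ N * c ^ (k + 1) := by
  refine abs_reTr_le_of_norm_le ((norm_mul_le _ _).trans ?_)
  rw [pow_succ]
  exact mul_le_mul (norm_pow_le_pow (h.norm_shiftRes_le le_rfl X) k hk) (h.norm_shiftRes_le ht X)
    (norm_nonneg _) (pow_nonneg h.c_nonneg _)

/-- Second-order expansion of the mean trace in the shift. -/
lemma abs_integral_expansion_le {t : ℝ} (ht : 0 ≤ t) :
    |∫ X, reTr (shiftRes B ρ τ t X) ∂(Measure.pi fun _ => colLaw (Fin N)) -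
      (∫ X, reTr (shiftRes B ρ τ 0 X) ∂(Measure.pi fun _ => colLaw (Fin N)) -
        t * ∫ X, reTr (shiftRes B ρ τ 0 X ^ 2) ∂(Measure.pi fun _ => colLaw (Fin N)) +
        t ^ 2 * ∫ X, reTr (shiftRes B ρ τ 0 X ^ 3) ∂(Measure.pi fun _ => colLaw (Fin N)))| ≤
      t ^ 3 * (N * c ^ 4) := by
  set μ := (Measure.pi fun _ : Fin K => colLaw (Fin N)) with hμ
  have i0 := ((h.bddMeas_reTr ht).integrable μ).hasMean
  have i1 := ((h.bddMeas_reTr (t := 0) le_rfl).integrable μ).hasMean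
  have i2 := ((h.bddMeas_reTr_pow (t := 0) le_rfl 2 (by norm_num)).integrable μ).hasMean
  have i3 := ((h.bddMeas_reTr_pow (t := 0) le_rfl 3 (by norm_num)).integrable μ).hasMean
  have H := i0.sub ((i1.sub (i2.const_mul t)).add (i3.const_mul (t ^ 2)))
  rw [← H.2]
  refine abs_integral_le_const fun X => ?_
  have e0 := h.reTr_pow_mul_shiftRes ht X 0
  have e1 := h.reTr_pow_mul_shiftRes ht X 1
  have e2 := h.reTr_pow_mul_shiftRes ht X 2
  norm_num [pow_zero, Matrix.one_mul] at e0 e1 e2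
  have hb := h.abs_reTr_pow_mul_le ht X 3 (by norm_num)
  have e : reTr (shiftRes B ρ τ t X) - (reTr (shiftRes B ρ τ 0 X) -
      t * reTr (shiftRes B ρ τ 0 X ^ 2) + t ^ 2 * reTr (shiftRes B ρ τ 0 X ^ 3)) =
      -(t ^ 3 * reTr (shiftRes B ρ τ 0 X ^ 3 * shiftRes B ρ τ t X)) := by
    rw [e0, e1, e2]; ring
  rw [e, abs_neg, abs_mul, abs_of_nonneg (by positivity : 0 ≤ t ^ 3)]
  gcongr

/-- Covariance of the traces of the square and of the resolvent. -/
lemma abs_integral_cov_le {t : ℝ} (ht : 0 < t) {V m : ℝ}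
    (hm : m = ∫ X, reTr (shiftRes B ρ τ 0 X) ∂(Measure.pi fun _ => colLaw (Fin N)))
    (hV : K * (4 * τm ^ 2 * N * c ^ 4) ≤ V) :
    |∫ X, reTr (shiftRes B ρ τ 0 X ^ 2) * (reTr (shiftRes B ρ τ 0 X) - m)
        ∂(Measure.pi fun _ => colLaw (Fin N))| ≤ 2 * V / t + t * (N * c ^ 3) * (1 + V) := by
  set μ := (Measure.pi fun _ : Fin K => colLaw (Fin N)) with hμ
  set φ := fun X => reTr (shiftRes B ρ τ 0 X) with hφ
  set ψ := fun X => reTr (shiftRes B ρ τ t X) with hψ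
  have bφ : BddMeas φ := h.bddMeas_reTr le_rfl
  have bψ : BddMeas ψ := h.bddMeas_reTr ht.le
  set m' := ∫ X, ψ X ∂μ with hm'
  have v1 : ∫ X, (φ X - m) ^ 2 ∂μ ≤ V := by
    have := (h.moments_reTr (t := 0) le_rfl hV).1
    rwa [← hm] at this
  have v2 : ∫ X, (ψ X - m') ^ 2 ∂μ ≤ V := (h.moments_reTr ht.le hV).1
  have bφm := bφ.sub (BddMeas.const m)
  have bψm := bψ.sub (BddMeas.const m')
  have i1 := ((bφm.pow 2).integrable μ).hasMean
  have i2 := ((bψm.pow 2).integrable μ).hasMean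
  have z1 : HasMean μ (fun X => φ X - m) 0 :=
    ((bφ.integrable μ).hasMean.sub (HasMean.const m)).congr (fun _ => rfl) (by rw [hm]; simp [hφ, hμ])
  have bS := h.bddMeas_reTr_pow (t := 0) le_rfl 2 (by norm_num)
  have i3 := ((bS.mul bφm).integrable μ).hasMean
  -- Tr M² is close to the difference quotient (Tr M_0 − Tr M_t)/t, with mean about (m − m')/t.
  -- Subtracting that constant is free because φ − m is centred, and it leaves only products of
  -- centred traces, of size V/t. No separate variance bound for Tr M² is needed.
  have i4 := i3.sub (z1.const_mul ((m - m') / t))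
  have hpt : ∀ X, |reTr (shiftRes B ρ τ 0 X ^ 2) * (φ X - m) - (m - m') / t * (φ X - m)| ≤
      (3 / 2 / t + t * (N * c ^ 3)) * (φ X - m) ^ 2 + 1 / 2 / t * (ψ X - m') ^ 2 +
        t * (N * c ^ 3) := by
    intro X
    have e0 := h.reTr_pow_mul_shiftRes ht.le X 0
    have e1 := h.reTr_pow_mul_shiftRes ht.le X 1
    norm_num [pow_zero, Matrix.one_mul] at e0 e1
    have hb := h.abs_reTr_pow_mul_le ht.le X 2 (by norm_num)
    norm_num at hb
    set R := reTr (shiftRes B ρ τ 0 X ^ 2 * shiftRes B ρ τ t X)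
    have hN : 0 ≤ N * c ^ 3 := (abs_nonneg _).trans hb
    have e : reTr (shiftRes B ρ τ 0 X ^ 2) * (φ X - m) - (m - m') / t * (φ X - m) =
        1 / t * (φ X - m) ^ 2 - 1 / t * ((ψ X - m') * (φ X - m)) + t * (R * (φ X - m)) := by
      have e2 : reTr (shiftRes B ρ τ 0 X ^ 2) = (φ X - ψ X) / t + t * R := by
        rw [hφ, hψ]
        simp only
        rw [e0, e1]
        field_simp
        ring
      rw [e2]
      field_simp
      ring
    have ht' : 0 ≤ 1 / t := by positivity
    set x := φ X - m
    set y := ψ X - m'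
    have hx : |R * x| ≤ N * c ^ 3 * (x ^ 2 + 1) := by
      rw [abs_mul]
      refine mul_le_mul hb ?_ (abs_nonneg _) hN
      rw [abs_le]
      constructor <;> nlinarith [sq_nonneg (x - 1), sq_nonneg (x + 1)]
    have hyx : |y * x| ≤ 1 / 2 * x ^ 2 + 1 / 2 * y ^ 2 := by
      rw [abs_le]
      constructor <;> nlinarith [sq_nonneg (x - y), sq_nonneg (x + y)]
    rw [e]
    calc _ ≤ |1 / t * x ^ 2 - 1 / t * (y * x)| + |t * (R * x)| := abs_add_le _ _
      _ ≤ |1 / t * x ^ 2| + |1 / t * (y * x)| + |t * (R * x)| := by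
          gcongr; exact abs_sub _ _
      _ = 1 / t * x ^ 2 + 1 / t * |y * x| + t * |R * x| := by
          rw [abs_mul (1 / t) (y * x), abs_mul t, abs_of_nonneg ht', abs_of_pos ht,
            abs_of_nonneg (by positivity)]
      _ ≤ 1 / t * x ^ 2 + 1 / t * (1 / 2 * x ^ 2 + 1 / 2 * y ^ 2) +
          t * (N * c ^ 3 * (x ^ 2 + 1)) := by gcongr
      _ = _ := by ring
  have hR := ((i1.const_mul (3 / 2 / t + t * (N * c ^ 3))).add (i2.const_mul (1 / 2 / t))).add
    (HasMean.const (P := μ) (t * (N * c ^ 3)))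
  have hc := h.c_nonneg
  have e4 : ∫ X, reTr (shiftRes B ρ τ 0 X ^ 2) * (φ X - m) ∂μ =
      ∫ X, (reTr (shiftRes B ρ τ 0 X ^ 2) * (φ X - m) - (m - m') / t * (φ X - m)) ∂μ := by
    rw [i4.2]; ring
  rw [e4]
  refine abs_integral_le_integral_abs.trans ((integral_mono i4.1.abs hR.1 hpt).trans ?_)
  rw [hR.2]
  calc _ ≤ (3 / 2 / t + t * (N * c ^ 3)) * V + 1 / 2 / t * V + t * (N * c ^ 3) := by gcongr
    _ = _ := by field_simp; ring

end ResSetup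

end QuadraticFormMoments

end LMMSE

namespace LMMSE

open scoped Matrix.Norms.L2Operator

/-! ### Resolvents of scalar matrices, and recovery of coefficients. -/

section Spectral

variable {N : ℕ}

lemma norm_spectral_le (U : Matrix.unitaryGroup (Fin N) ℂ) {d : Fin N → ℝ} {dm : ℝ} (hdm : 0 ≤ dm)
    (hd : ∀ i, 0 ≤ d i) (hd' : ∀ i, d i ≤ dm) :
    ‖(U : Matrix (Fin N) (Fin N) ℂ) * Matrix.diagonal (fun i => (d i : ℂ)) *
      star (U : Matrix (Fin N) (Fin N) ℂ)‖ ≤ dm := by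
  have e : star (U : Matrix (Fin N) (Fin N) ℂ) = ((star U : Matrix.unitaryGroup (Fin N) ℂ) :
    Matrix (Fin N) (Fin N) ℂ) := rfl
  rw [e, CStarRing.norm_mul_coe_unitary, CStarRing.norm_coe_unitary_mul,
    Matrix.l2_opNorm_diagonal, pi_norm_le_iff_of_nonneg hdm]
  intro i
  rw [Complex.norm_real, Real.norm_of_nonneg (hd i)]
  exact hd' i

/-- At a scalar argument the resolvent is diagonal in the basis U, which identifies the normalised
trace with F. Only the product B·B has to be diagonalised. -/
lemma reTr_resolv_smul_one {B : Matrix (Fin N) (Fin N) ℂ} {U : Matrix.unitaryGroup (Fin N) ℂ}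
    {d : Fin N → ℝ} (hB : B * B = (U : Matrix (Fin N) (Fin N) ℂ) *
      Matrix.diagonal (fun i => (d i : ℂ)) * star (U : Matrix (Fin N) (Fin N) ℂ))
    (hd : ∀ i, 0 ≤ d i) {ρ x : ℝ} (hρ : 0 < ρ) (hx : 0 ≤ x) (s : ℝ) :
    s * reTr (resolv B ρ ((x : ℂ) • 1)) = stieltjesSum s ρ d x := by
  set V : Matrix (Fin N) (Fin N) ℂ := (U : Matrix (Fin N) (Fin N) ℂ) with hV
  have hU1 : V * star V = 1 := Unitary.mul_star_self_of_mem U.2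
  have hU2 : star V * V = 1 := Unitary.star_mul_self_of_mem U.2
  have hpos : ∀ i, (ρ + x * d i : ℝ) ≠ 0 := fun i => (add_mul_pos_of_nonneg hρ hd hx i).ne'
  have e1 : B * ((x : ℂ) • (1 : Matrix (Fin N) (Fin N) ℂ)) * B + (ρ : ℂ) • 1 =
      V * Matrix.diagonal (fun i => ((ρ + x * d i : ℝ) : ℂ)) * star V := by
    rw [Matrix.mul_smul, Matrix.mul_one, Matrix.smul_mul, hB]
    have : Matrix.diagonal (fun i => ((ρ + x * d i : ℝ) : ℂ)) =
        (x : ℂ) • Matrix.diagonal (fun i => (d i : ℂ)) + (ρ : ℂ) • 1 := by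
      ext i j
      by_cases hij : i = j
      · subst hij; simp; ring
      · simp [hij]
    rw [this, Matrix.mul_add, Matrix.add_mul, Matrix.mul_smul, Matrix.smul_mul, Matrix.mul_smul,
      Matrix.mul_one, Matrix.smul_mul, hU1]
  have e2 : (V * Matrix.diagonal (fun i => ((ρ + x * d i : ℝ) : ℂ)) * star V)⁻¹ =
      V * Matrix.diagonal (fun i => (((ρ + x * d i)⁻¹ : ℝ) : ℂ)) * star V := by
    refine Matrix.inv_eq_right_inv ?_
    calc _ = V * Matrix.diagonal (fun i => ((ρ + x * d i : ℝ) : ℂ)) * (star V * V) *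
          Matrix.diagonal (fun i => (((ρ + x * d i)⁻¹ : ℝ) : ℂ)) * star V := by
          simp only [Matrix.mul_assoc]
      _ = 1 := by
          rw [hU2, Matrix.mul_one, Matrix.mul_assoc V, Matrix.diagonal_mul_diagonal]
          have : (fun i => ((ρ + x * d i : ℝ) : ℂ) * (((ρ + x * d i)⁻¹ : ℝ) : ℂ)) = fun _ => 1 := by
            funext i
            rw [← Complex.ofReal_mul, mul_inv_cancel₀ (hpos i), Complex.ofReal_one]
          rw [this, Matrix.diagonal_one, Matrix.mul_one, hU1]
  have e3 : (resolv B ρ ((x : ℂ) • 1)).trace = ∑ i, ((d i / (ρ + x * d i) : ℝ) : ℂ) := by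
    rw [resolv, e1, e2, Matrix.mul_assoc, Matrix.trace_mul_comm, Matrix.mul_assoc, hB]
    calc _ = (V * (Matrix.diagonal (fun i => (((ρ + x * d i)⁻¹ : ℝ) : ℂ)) * (star V * V) *
          Matrix.diagonal (fun i => (d i : ℂ))) * star V).trace := by
          simp only [Matrix.mul_assoc]
      _ = _ := by
          rw [hU2, Matrix.mul_one, Matrix.trace_mul_comm, ← Matrix.mul_assoc, hU2, Matrix.one_mul,
            Matrix.diagonal_mul_diagonal, Matrix.trace_diagonal]
          refine Finset.sum_congr rfl fun i _ => ?_
          rw [← Complex.ofReal_mul, div_eq_inv_mul]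
  rw [reTr, e3, Complex.re_sum, stieltjesSum]
  simp only [Complex.ofReal_re]

end Spectral

/-- Three nearly vanishing values of a quadratic polynomial control its coefficients. -/
lemma coeff_bound_of_three_values {x₀ x₁ x₂ u C : ℝ} (hu : 0 < u) (hu1 : u ≤ 1)
    (h0 : |x₀| ≤ C * u ^ 4) (h1 : |x₀ - u * x₁ + u ^ 2 * x₂| ≤ C * (u ^ 4 + u ^ 3))
    (h2 : |x₀ - 2 * u * x₁ + (2 * u) ^ 2 * x₂| ≤ C * (u ^ 4 + (2 * u) ^ 3)) :
    |x₀| ≤ 20 * C * u ∧ |x₁| ≤ 20 * C * u ∧ |x₂| ≤ 20 * C * u := by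
  have hC : 0 ≤ C := by
    have := (abs_nonneg _).trans h0
    exact nonneg_of_mul_nonneg_left this (by positivity)
  have hp : C * u ^ 4 ≤ C * u ^ 3 := by
    have : u ^ 4 ≤ u ^ 3 := pow_le_pow_of_le_one hu.le hu1 (by norm_num)
    gcongr
  have hp2 : C * u ^ 3 ≤ C * u ^ 2 := by
    have : u ^ 3 ≤ u ^ 2 := pow_le_pow_of_le_one hu.le hu1 (by norm_num)
    gcongr
  have hp3 : C * u ^ 2 ≤ C * u := by
    have : u ^ 2 ≤ u := by nlinarith
    gcongr
  have hCu : 0 ≤ C * u := by positivity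
  rw [abs_le] at h0 h1 h2
  refine ⟨abs_le.mpr ⟨by linarith [h0.1], by linarith [h0.2]⟩, ?_, ?_⟩
  -- Eliminate as in divided differences: with v₁, v₂ the values at u and 2u, 2u x₁ = 3x₀ − 4v₁ +
  -- v₂, and below 2u² x₂ = x₀ − 2v₁ + v₂. The constant 20 is generous.
  · have k1 : u * x₁ ≤ u * (20 * C * u) := by nlinarith
    have k2 : u * (-(20 * C * u)) ≤ u * x₁ := by nlinarith
    exact abs_le.mpr ⟨le_of_mul_le_mul_left k2 hu, le_of_mul_le_mul_left k1 hu⟩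
  · have k1 : u ^ 2 * x₂ ≤ u ^ 2 * (20 * C * u) := by nlinarith
    have k2 : u ^ 2 * (-(20 * C * u)) ≤ u ^ 2 * x₂ := by nlinarith
    exact abs_le.mpr ⟨le_of_mul_le_mul_left k2 (by positivity),
      le_of_mul_le_mul_left k1 (by positivity)⟩

end LMMSE

namespace LMMSE

open scoped Matrix.Norms.L2Operator

/-! ### Uniform comparison of the moments with their deterministic equivalents. -/

section MomentBound

variable {N K : ℕ} {B : Matrix (Fin N) (Fin N) ℂ} {U : Matrix.unitaryGroup (Fin N) ℂ}
  {ρ dm pm c₀ S : ℝ} {d : Fin N → ℝ} {q : Fin K → ℝ}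

lemma Regime.resSetup (h : Regime ρ dm pm c₀ S (1 / K) d q) (hB : B.IsHermitian)
    (hBB : B * B = (U : Matrix (Fin N) (Fin N) ℂ) *
      Matrix.diagonal (fun i => (d i : ℂ)) * star (U : Matrix (Fin N) (Fin N) ℂ)) :
    ResSetup B ρ (dm / ρ) (pm / K) (fun k => q k / K) where
  herm := hB
  ρ_pos := h.r_pos
  norm_le := by
    have := norm_spectral_le U h.dm_nonneg h.d_nonneg h.d_le
    rw [← hBB] at this
    exact div_le_div_of_nonneg_right this h.r_pos.le
  τ_nonneg k := div_nonneg (h.q_nonneg k) (Nat.cast_nonneg _)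
  τ_le k := div_le_div_of_nonneg_right (h.q_le k) (Nat.cast_nonneg _)
  τm_nonneg := div_nonneg h.pm_nonneg (Nat.cast_nonneg _)

/-- Size of the residual in the fixed-point equation. -/
lemma residual_size_le {x n s c pm S v : ℝ} (hx : 1 ≤ x) (hs : 0 ≤ s)
    (hns : n = s ^ 2) (hnS : n ≤ S * x ^ 2) (hc : 0 ≤ c) (hpm : 0 ≤ pm) (hS : 0 ≤ S)
    (hv : 0 ≤ v) :
    pm / x ^ 2 * (s * c ^ 2 + c ^ 2 + n * c ^ 2 * (pm / x ^ 2 * (s * c + c + v))) ≤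
      (pm * (√S * c ^ 2 + c ^ 2 + S * c ^ 2 * (pm * (√S * c + c + v)))) * (1 / x) := by
  have hx0 : 0 < x := by linarith
  have hn : 0 ≤ n := hns ▸ sq_nonneg s
  have hsx : s ≤ √S * x := by
    refine abs_le_of_sq_le_sq' ?_ (by positivity) |>.2
    rw [← hns, mul_pow, Real.sq_sqrt hS]
    exact hnS
  have hb : s * c + c + v ≤ (√S * c + c + v) * x := by
    have h1 : s * c ≤ √S * x * c := by gcongr
    nlinarith
  have h2 : pm / x ^ 2 * (s * c + c + v) ≤ pm / x ^ 2 * ((√S * c + c + v) * x) := by gcongr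
  have h3 : n * c ^ 2 * (pm / x ^ 2 * (s * c + c + v)) ≤
      S * x ^ 2 * c ^ 2 * (pm / x ^ 2 * ((√S * c + c + v) * x)) := by gcongr
  have h4 : s * c ^ 2 + c ^ 2 ≤ (√S * c ^ 2 + c ^ 2) * x := by
    have h1 : s * c ^ 2 ≤ √S * x * c ^ 2 := by gcongr
    nlinarith [sq_nonneg c]
  calc _ ≤ pm / x ^ 2 * ((√S * c ^ 2 + c ^ 2) * x +
        S * x ^ 2 * c ^ 2 * (pm / x ^ 2 * ((√S * c + c + v) * x))) := by
        gcongr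
    _ = _ := by field_simp

set_option maxHeartbeats 400000 in
/-- Uniform bound on the distance between the first three moments of the quadratic form and
their deterministic equivalents. -/
theorem exists_moment_bound (hρ : 0 < ρ) (hdm : 0 ≤ dm) (hpm : 0 ≤ pm) (hc₀ : 0 < c₀)
    (hS : 0 ≤ S) :
    ∃ C : ℝ, 0 < C ∧ ∃ t₀ : ℝ, 0 < t₀ ∧ ∀ (N K : ℕ) (d : Fin N → ℝ) (q : Fin K → ℝ) (e : ℝ)
      (B : Matrix (Fin N) (Fin N) ℂ) (U : Matrix.unitaryGroup (Fin N) ℂ),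
      1 ≤ K → Regime ρ dm pm c₀ S (1 / K) d q → 0 ≤ e →
      e = stieltjesSum (1 / K) ρ d (stieltjesSum (1 / K) 1 q e) → B.IsHermitian →
      B * B = (U : Matrix (Fin N) (Fin N) ℂ) *
        Matrix.diagonal (fun i => (d i : ℂ)) * star (U : Matrix (Fin N) (Fin N) ℂ) →
      ∀ u : ℝ, 0 < u → 2 * u ≤ t₀ → u ^ 8 * K = 1 →
      linCoeff (1 / K) ρ d q e ∈ Set.Icc 0 C ∧ |quadCoeff (1 / K) ρ d q e| ≤ C ∧
      ∃ m : ℝ, ∫ z, qform (shiftRes B ρ (fun k => q k / K) 0 z.2) z.1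
          ∂((colLaw (Fin N)).prod (Measure.pi fun _ => colLaw (Fin N))) = m ∧
        |1 / K * m - e| ≤ C * u ∧
        |1 / K * ∫ z, (qform (shiftRes B ρ (fun k => q k / K) 0 z.2) z.1 - m) ^ 2
          ∂((colLaw (Fin N)).prod (Measure.pi fun _ => colLaw (Fin N))) -
            linCoeff (1 / K) ρ d q e| ≤ C * u ∧
        |1 / K * ∫ z, (qform (shiftRes B ρ (fun k => q k / K) 0 z.2) z.1 - m) ^ 3
          ∂((colLaw (Fin N)).prod (Measure.pi fun _ => colLaw (Fin N))) -
            2 * quadCoeff (1 / K) ρ d q e| ≤ C * u := by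
  obtain ⟨C₁, hC₁, t₀, ht₀, ht₀1, hexp⟩ := exists_expansion_bound hρ hdm hpm hc₀ hS
  obtain ⟨c, hc⟩ : ∃ c, c = dm / ρ := ⟨_, rfl⟩
  have hc0 : 0 ≤ c := hc ▸ div_nonneg hdm hρ.le
  obtain ⟨V, hV⟩ : ∃ V, V = 4 * pm ^ 2 * S * c ^ 4 := ⟨_, rfl⟩
  have hV0 : 0 ≤ V := by rw [hV]; positivity
  obtain ⟨A, hA⟩ : ∃ A, A = pm * (√S * c ^ 2 + c ^ 2 + S * c ^ 2 * (pm * (√S * c + c + √V))) :=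
    ⟨_, rfl⟩
  have hA0 : 0 ≤ A := by rw [hA]; positivity
  obtain ⟨C₂, hC₂⟩ : ∃ C₂, C₂ = C₁ * (A + 1) + S * c ^ 4 := ⟨_, rfl⟩
  have hC₂0 : 0 ≤ C₂ := by rw [hC₂]; positivity
  obtain ⟨C₃, hC₃⟩ : ∃ C₃, C₃ = 3 * (2 * V + S * c ^ 3 * (1 + V)) + V * (3 * (1 + V) + c) :=
    ⟨_, rfl⟩
  have hC₃0 : 0 ≤ C₃ := by rw [hC₃]; positivity
  refine ⟨C₁ + 40 * C₂ + V + C₃, by positivity, t₀, ht₀, ?_⟩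
  intro N K d q e B U hK hR he hfix hB hBB u hu hut huK
  have hK0 : (0 : ℝ) < K := by exact_mod_cast hK
  have hu1 : u ≤ 1 := by linarith
  have hset := hR.resSetup hB hBB
  rw [← hc] at hset
  -- Since u = K^{-1/8}, √K = 1/u⁴ and the O(K^{-1/2}) residual is O(u⁴). Dividing it by t² ≍ u² to
  -- extract the quadratic coefficient still leaves O(u²), whereas the O(t³) remainder leaves O(u).
  have hKu : (K : ℝ) = (1 / u ^ 4) ^ 2 := by
    field_simp
    linarith
  have hNS : (N : ℝ) ≤ S * K := by
    have := hR.card_le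
    rw [Fintype.card_fin, one_div, inv_mul_le_iff₀ hK0] at this
    linarith
  have hVle : K * (4 * (pm / K) ^ 2 * N * c ^ 4) ≤ V := by
    have : K * (4 * (pm / K) ^ 2 * N * c ^ 4) = 4 * pm ^ 2 * (N / K) * c ^ 4 := by
      field_simp
    rw [this, hV]
    have h2 : (N : ℝ) / K ≤ S := by rwa [div_le_iff₀ hK0]
    gcongr
  set μ := (Measure.pi fun _ : Fin K => colLaw (Fin N)) with hμ
  set τ : Fin K → ℝ := fun k => q k / K with hτ
  obtain ⟨f, hf⟩ : ∃ f : ℝ → ℝ, ∀ t, f t = 1 / K * ∫ X, reTr (shiftRes B ρ τ t X) ∂μ :=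
    ⟨_, fun _ => rfl⟩
  have hNc : 1 / K * (N * c) ≤ S * dm / ρ := by
    rw [one_div, inv_mul_le_iff₀ hK0, mul_div_assoc, ← hc, ← mul_assoc, mul_comm (K : ℝ)]
    gcongr
  have hfmem : ∀ t, 0 ≤ t → f t ∈ Set.Icc 0 (S * dm / ρ) := fun t ht => by
    rw [hf]
    constructor
    · exact mul_nonneg (by positivity) (integral_nonneg fun X =>
        (RCLike.nonneg_iff.mp (hset.posSemidef ht X).trace_nonneg).1)
    · refine le_trans ?_ hNc
      gcongr
      exact (le_abs_self _).trans (abs_integral_le_const fun X => hset.abs_reTr_shiftRes_le ht X)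
  have hres : ∀ t, 0 ≤ t → |f t - stieltjesSum (1 / K) ρ d (t + stieltjesSum (1 / K) 1 q (f t))| ≤
      A * u ^ 4 := fun t ht => by
    obtain ⟨m, hm⟩ : ∃ m, m = ∫ X, reTr (shiftRes B ρ τ t X) ∂μ := ⟨_, rfl⟩
    have h1 := hset.abs_reTr_resolv_sub_integral_le ht hm hVle
    have hg : ∑ k, τ k / (1 + τ k * m) = stieltjesSum (1 / K) 1 q (f t) := by
      rw [stieltjesSum, Finset.mul_sum]
      refine Finset.sum_congr rfl fun k _ => ?_
      have e1 : τ k * m = f t * q k := by rw [hf, ← hm, hτ]; simp only; field_simp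
      rw [e1, hτ]
      simp only
      ring
    rw [hg] at h1
    have hg0 : 0 ≤ t + stieltjesSum (1 / K) 1 q (f t) :=
      add_nonneg ht (hR.G_nonneg (hfmem t ht).1)
    generalize stieltjesSum (1 / K) 1 q (f t) = g at h1 hg0 ⊢
    have h2 := reTr_resolv_smul_one hBB hR.d_nonneg hρ hg0 (1 / K)
    rw [← h2, hf, ← hm, ← mul_sub, abs_mul, abs_of_nonneg (by positivity : (0 : ℝ) ≤ 1 / K),
      abs_sub_comm]
    have hx1 : 1 ≤ 1 / u ^ 4 := by
      rw [le_div_iff₀ (by positivity), one_mul]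
      exact pow_le_one₀ hu.le hu1
    have h3 := residual_size_le (v := √V) hx1 (Real.sqrt_nonneg (N : ℝ))
      (Real.sq_sqrt (Nat.cast_nonneg N)).symm (by rw [← hKu]; exact hNS) hc0 hpm hS
      (Real.sqrt_nonneg V)
    rw [← hKu, one_div_one_div, ← hA] at h3
    refine (mul_le_mul_of_nonneg_left h1 (by positivity)).trans ?_
    rw [← mul_assoc, one_div_mul_cancel hK0.ne', one_mul]
    exact h3
  obtain ⟨hlin, hquad, hkey⟩ := hexp N K (1 / K) e d q hR he hfix
  set L := linCoeff (1 / K) ρ d q e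
  set Q := quadCoeff (1 / K) ρ d q e
  set m := ∫ X, reTr (shiftRes B ρ τ 0 X) ∂μ with hm
  set m₂ := ∫ X, reTr (shiftRes B ρ τ 0 X ^ 2) ∂μ with hm₂
  set m₃ := ∫ X, reTr (shiftRes B ρ τ 0 X ^ 3) ∂μ with hm₃
  -- Two quadratic approximations of the same f(t) are subtracted: the expansion of the
  -- deterministic fixed point and the resolvent expansion of the mean trace.
  have hthree : ∀ t ∈ Set.Icc 0 t₀,
      |(1 / K * m - e) - t * (1 / K * m₂ - L) + t ^ 2 * (1 / K * m₃ - Q)| ≤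
        C₂ * (u ^ 4 + t ^ 3) := by
    intro t ht
    have h1 := hkey t ht (f t) (hfmem t ht.1) _ (hres t ht.1)
    have h2 := hset.abs_integral_expansion_le ht.1
    have h3 : |f t - (1 / K * m - t * (1 / K * m₂) + t ^ 2 * (1 / K * m₃))| ≤
        t ^ 3 * (S * c ^ 4) := by
      have e1 : f t - (1 / K * m - t * (1 / K * m₂) + t ^ 2 * (1 / K * m₃)) =
          1 / K * (∫ X, reTr (shiftRes B ρ τ t X) ∂μ - (m - t * m₂ + t ^ 2 * m₃)) := by
        rw [hf]; ring
      rw [e1, abs_mul, abs_of_nonneg (by positivity : (0 : ℝ) ≤ 1 / K)]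
      refine (mul_le_mul_of_nonneg_left h2 (by positivity)).trans ?_
      rw [one_div, inv_mul_le_iff₀ hK0]
      have := ht.1
      calc t ^ 3 * (N * c ^ 4) ≤ t ^ 3 * (S * K * c ^ 4) := by gcongr
        _ = _ := by ring
    have e2 : (1 / K * m - e) - t * (1 / K * m₂ - L) + t ^ 2 * (1 / K * m₃ - Q) =
        (f t - (e - L * t + Q * t ^ 2)) -
          (f t - (1 / K * m - t * (1 / K * m₂) + t ^ 2 * (1 / K * m₃))) := by ring
    rw [e2]
    refine (abs_sub _ _).trans ((add_le_add h1 h3).trans ?_)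
    have ht3 : 0 ≤ t ^ 3 := pow_nonneg ht.1 3
    have hu4 : 0 ≤ u ^ 4 := by positivity
    rw [hC₂]
    have k1 : 0 ≤ C₁ * A * t ^ 3 := by positivity
    have k2 : 0 ≤ C₁ * u ^ 4 := by positivity
    have k3 : 0 ≤ S * c ^ 4 * u ^ 4 := by positivity
    nlinarith
  have a0 := hthree 0 ⟨le_rfl, ht₀.le⟩
  have a1 := hthree u ⟨hu.le, by linarith⟩
  have a2 := hthree (2 * u) ⟨by linarith, hut⟩
  norm_num at a0
  rw [← one_div] at a0
  obtain ⟨b0, b1, b2⟩ := coeff_bound_of_three_values hu hu1 a0 a1 a2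
  obtain ⟨p1, p2, p3⟩ := hset.moments_qform (t := 0) le_rfl hm
  obtain ⟨v2, v3⟩ := hset.moments_reTr (t := 0) le_rfl hVle
  rw [← hμ, ← hm] at v2 v3
  -- The shift t = u⁴ = K^{-1/2} balances V/t against tN, making the covariance O(√K), negligible
  -- after division by K.
  have hcov := hset.abs_integral_cov_le (t := u ^ 4) (by positivity) hm hVle
  rw [← hμ] at p1 p2 p3 hcov
  have hKinv : 1 / (K : ℝ) = u ^ 8 := by
    rw [div_eq_iff hK0.ne', huK]
  have hu8 : u ^ 8 ≤ u := pow_le_of_le_one hu.le hu1 (by norm_num)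
  have hu4 : u ^ 4 ≤ u := pow_le_of_le_one hu.le hu1 (by norm_num)
  refine ⟨⟨hlin.1, hlin.2.trans (by linarith)⟩, hquad.trans (by linarith), m, p1, ?_, ?_, ?_⟩
  · exact b0.trans (mul_le_mul_of_nonneg_right (by linarith) hu.le)
  · rw [p2, mul_add]
    have w0 : 0 ≤ ∫ X, (reTr (shiftRes B ρ τ 0 X) - m) ^ 2 ∂μ :=
      integral_nonneg fun X => sq_nonneg _
    have w1 : |1 / K * ∫ X, (reTr (shiftRes B ρ τ 0 X) - m) ^ 2 ∂μ| ≤ V * u := by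
      rw [abs_mul, abs_of_nonneg w0, hKinv, abs_of_pos (by positivity : 0 < u ^ 8), mul_comm]
      gcongr
    rw [add_sub_right_comm]
    refine (abs_add_le _ _).trans ((add_le_add b1 w1).trans ?_)
    rw [← add_mul]
    exact mul_le_mul_of_nonneg_right (by linarith) hu.le
  · rw [p3]
    set cov := ∫ X, reTr (shiftRes B ρ τ 0 X ^ 2) * (reTr (shiftRes B ρ τ 0 X) - m) ∂μ
    set thd := ∫ X, (reTr (shiftRes B ρ τ 0 X) - m) ^ 3 ∂μ
    have w1 : |1 / K * cov| ≤ (2 * V + S * c ^ 3 * (1 + V)) * u := by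
      rw [abs_mul, abs_of_nonneg (by positivity : (0 : ℝ) ≤ 1 / K)]
      calc _ ≤ 1 / K * (2 * V / u ^ 4 + u ^ 4 * (S * K * c ^ 3) * (1 + V)) := by
            refine mul_le_mul_of_nonneg_left (hcov.trans ?_) (by positivity)
            gcongr
        _ = u ^ 8 * (2 * V / u ^ 4) + u ^ 4 * (S * c ^ 3) * (1 + V) := by
            rw [mul_add, ← hKinv]
            field_simp
        _ = (2 * V + S * c ^ 3 * (1 + V)) * u ^ 4 := by field_simp
        _ ≤ _ := by gcongr
    have w2 : |1 / K * thd| ≤ (V * (3 * (1 + V) + c)) * u := by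
      rw [abs_mul, hKinv, abs_of_pos (by positivity : 0 < u ^ 8), mul_comm]
      gcongr
    have e3 : 1 / K * (2 * m₃ + 3 * cov + thd) - 2 * Q =
        2 * (1 / K * m₃ - Q) + (3 * (1 / K * cov) + 1 / K * thd) := by ring
    rw [e3]
    refine (abs_add_le _ _).trans ((add_le_add le_rfl (abs_add_le _ _)).trans ?_)
    rw [abs_mul, abs_mul]
    norm_num only [abs_two, Nat.abs_ofNat]
    have k1 : 2 * |1 / K * m₃ - Q| ≤ 2 * (20 * C₂ * u) := by gcongr
    have k2 : 3 * |1 / K * cov| ≤ 3 * ((2 * V + S * c ^ 3 * (1 + V)) * u) := by gcongr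
    have k3 : 0 ≤ C₁ * u := by positivity
    have k4 : 0 ≤ V * u := by positivity
    rw [hC₃]
    linarith

end MomentBound

end LMMSE

namespace LMMSE

/-! ### Second-order statistics of symbols and noise. -/

section SecondOrder

variable {Ω' : Type*} [MeasurableSpace Ω'] {Q : Measure Ω'}

/-- Mean square of a linear combination of orthogonal variables. -/
lemma integral_norm_sq_sum {ι : Type*} [Fintype ι] [DecidableEq ι] {v : ι → Ω' → ℂ} {w : ι → ℝ}
    (hv : ∀ i, MemLp (v i) 2 Q)
    (hcov : ∀ i j, ∫ ω, v i ω * star (v j ω) ∂Q = if i = j then (w i : ℂ) else 0) (a : ι → ℂ) :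
    ∫ ω, ‖∑ i, a i * v i ω‖ ^ 2 ∂Q = ∑ i, ‖a i‖ ^ 2 * w i := by
  have hI : ∀ i j, Integrable (fun ω => v i ω * star (v j ω)) Q := fun i j =>
    (hv i).integrable_mul (hv j).star
  have hI2 : ∀ i, Integrable (fun ω => ∑ j, a i * star (a j) * (v i ω * star (v j ω))) Q :=
    fun i => integrable_finsetSum _ fun j _ => (hI i j).const_mul _
  have e : ∀ ω, ‖∑ i, a i * v i ω‖ ^ 2 =
      RCLike.re (∑ i, ∑ j, a i * star (a j) * (v i ω * star (v j ω))) := fun ω => by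
    have h1 : ∑ i, ∑ j, a i * star (a j) * (v i ω * star (v j ω)) =
        (∑ i, a i * v i ω) * star (∑ i, a i * v i ω) := by
      rw [star_sum, Finset.sum_mul_sum]
      refine Finset.sum_congr rfl fun i _ => Finset.sum_congr rfl fun j _ => ?_
      rw [star_mul']
      ring
    rw [h1]
    have := RCLike.mul_conj (∑ i, a i * v i ω)
    rw [← starRingEnd_apply, this]
    norm_cast
  simp_rw [e]
  rw [integral_re (integrable_finsetSum _ fun i _ => hI2 i), integral_finsetSum _ fun i _ => hI2 i]
  simp_rw [integral_finsetSum _ fun j _ => (hI _ j).const_mul _, integral_const_mul, hcov]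
  simp only [mul_ite, mul_zero, Finset.sum_ite_eq, Finset.mem_univ, if_true, map_sum]
  refine Finset.sum_congr rfl fun i _ => ?_
  have h2 : a i * star (a i) = ((‖a i‖ ^ 2 : ℝ) : ℂ) := by
    rw [← starRingEnd_apply, RCLike.mul_conj]
    norm_cast
  rw [h2, ← Complex.ofReal_mul]
  exact Complex.ofReal_re _

variable {K N : ℕ} {ρ : ℝ} {s : Ω' → Fin (K + 1) → ℂ} {n : Ω' → Fin N → ℂ}

/-- Symbols and noise together form one orthogonal family indexed by a disjoint sum, with weights 1
and ρ. The remaining cross covariance is the conjugate of the assumed one. -/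
lemma IsSignalNoise.integral_norm_sq (h : IsSignalNoise ρ s n Q) (a : Fin (K + 1) → ℂ)
    (b : Fin N → ℂ) :
    ∫ ω, ‖∑ k, a k * s ω k + ∑ i, b i * n ω i‖ ^ 2 ∂Q =
      ∑ k, ‖a k‖ ^ 2 + ρ * ∑ i, ‖b i‖ ^ 2 := by
  have := integral_norm_sq_sum (Q := Q) (ι := Fin (K + 1) ⊕ Fin N)
    (v := Sum.elim (fun k ω => s ω k) (fun i ω => n ω i))
    (w := Sum.elim (fun _ => 1) (fun _ => ρ)) ?_ ?_ (Sum.elim a b)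
  · simp only [Fintype.sum_sum_type, Sum.elim_inl, Sum.elim_inr, mul_one] at this
    rw [this, Finset.mul_sum]
    simp_rw [mul_comm ρ]
  · rintro (k | i)
    · exact h.memLp_signal k
    · exact h.memLp_noise i
  · rintro (k | i) (l | j)
    · simpa using h.signal_cov k l
    · simpa using h.cross_cov k j
    · have := h.cross_cov l i
      simp only [Sum.elim_inl, Sum.elim_inr, reduceCtorEq, if_false]
      have e : ∀ ω, n ω i * star (s ω l) = star (s ω l * star (n ω i)) := fun ω => by
        rw [star_mul', star_star, mul_comm]
      simp_rw [e]
      have h2 := integral_conj (μ := Q) (f := fun ω => s ω l * star (n ω i))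
      simp only [starRingEnd_apply] at h2
      rw [h2, this, star_zero]
    · simpa using h.noise_cov i j

end SecondOrder

/-- The output power ratio of a minimiser of `‖a - 1‖ ^ 2 + D`. -/
lemma norm_sq_div_eq_of_minimal {a : ℂ} {D η : ℝ} (hη : 0 ≤ η) (hcs : ‖a‖ ^ 2 ≤ η * D)
    (hmin : ‖a - 1‖ ^ 2 + D ≤ 1 / (1 + η)) : ‖a‖ ^ 2 / D = η := by
  rcases hη.eq_or_lt with rfl | hη
  · have : ‖a‖ ^ 2 = 0 := le_antisymm (by linarith) (sq_nonneg _)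
    rw [this, zero_div]
  rw [Complex.sq_norm, Complex.normSq_apply] at hcs hmin ⊢
  simp only [Complex.sub_re, Complex.one_re, Complex.sub_im, Complex.one_im, sub_zero] at hmin
  set x := a.re
  set y := a.im
  have h1 : 0 < 1 + η := by linarith
  rw [le_div_iff₀ h1] at hmin
  -- Multiply the minimality bound by η(1 + η) and insert ηD ≥ |a|²: completing the square leaves
  -- |(1 + η)a − η|² ≤ 0, which forces a = η/(1 + η).
  have h2 : ((1 + η) * x - η) ^ 2 + ((1 + η) * y) ^ 2 ≤ 0 := by nlinarith
  have hx : (1 + η) * x = η := by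
    have : ((1 + η) * x - η) ^ 2 = 0 := le_antisymm (by nlinarith [sq_nonneg ((1 + η) * y)])
      (sq_nonneg _)
    linarith [pow_eq_zero_iff (two_ne_zero) |>.mp this]
  have hy : y = 0 := by
    have : ((1 + η) * y) ^ 2 = 0 := le_antisymm (by nlinarith [sq_nonneg ((1 + η) * x - η)])
      (sq_nonneg _)
    have := pow_eq_zero_iff (two_ne_zero) |>.mp this
    exact (mul_eq_zero.mp this).resolve_left h1.ne'
  have hx' : x = η / (1 + η) := by rw [eq_div_iff h1.ne']; linarith
  rw [hy, hx'] at hcs hmin ⊢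
  have hD1 : η / (1 + η) ^ 2 ≤ D := by
    have : η * (η / (1 + η) ^ 2) ≤ η * D := by
      refine le_trans (le_of_eq ?_) hcs
      field_simp
      ring
    exact le_of_mul_le_mul_left this hη
  have hD2 : D ≤ η / (1 + η) ^ 2 := by
    have e : (η / (1 + η) - 1) * (η / (1 + η) - 1) = 1 / (1 + η) ^ 2 := by
      field_simp
      ring
    rw [e] at hmin
    have e2 : (1 / (1 + η) ^ 2 + 0 * 0 + D) * (1 + η) = 1 / (1 + η) + D * (1 + η) := by
      field_simp
      ring
    rw [e2] at hmin
    have e3 : η / (1 + η) ^ 2 * (1 + η) = 1 - 1 / (1 + η) := by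
      field_simp
      ring
    exact le_of_mul_le_mul_right (by linarith : D * (1 + η) ≤ _) h1
  rw [le_antisymm hD2 hD1]
  field_simp
  ring

/-! ### The LMMSE receiver and its output SNR. -/

section Receiver

variable {K N : ℕ}

/-- Cauchy–Schwarz for the form of a positive definite matrix. -/
lemma norm_dotProduct_sq_le {A : Matrix (Fin N) (Fin N) ℂ} (hA : A.PosDef) (h y : Fin N → ℂ) :
    ‖star h ⬝ᵥ y‖ ^ 2 ≤ qform A⁻¹ y * qform A h := by
  have hdet := (Matrix.isUnit_iff_isUnit_det _).mp hA.isUnit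
  obtain ⟨v, hv⟩ : ∃ v, v = A⁻¹ *ᵥ y := ⟨_, rfl⟩
  have hAv : A *ᵥ v = y := by
    rw [hv, Matrix.mulVec_mulVec, Matrix.mul_nonsing_inv _ hdet, Matrix.one_mulVec]
  set a := star h ⬝ᵥ y with ha
  have hη : qform A⁻¹ y = qform A v := by
    rw [← hAv, ← qform_mul_self_eq hA.1, Matrix.mul_nonsing_inv _ hdet, Matrix.one_mul]
  have hva : star v ⬝ᵥ A *ᵥ h = star a := by
    rw [ha, ← hAv, ← Matrix.star_dotProduct_star, star_star, Matrix.star_mulVec, hA.1.eq,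
      ← Matrix.dotProduct_mulVec]
  -- The usual discriminant argument; the phase star a makes the polynomial in the real variable t
  -- have real coefficients.
  have key : ∀ t : ℝ, qform A (h - ((t : ℂ) * star a) • v) =
      qform A v * ‖a‖ ^ 2 * (t * t) + (-2 * ‖a‖ ^ 2) * t + qform A h := by
    intro t
    have e : star (h - ((t : ℂ) * star a) • v) ⬝ᵥ A *ᵥ (h - ((t : ℂ) * star a) • v) =
        star h ⬝ᵥ A *ᵥ h - 2 * t * (star a * a) + t * t * (star a * a) * (star v ⬝ᵥ A *ᵥ v) := by
      have hstar : star ((t : ℂ) * star a) = t * a := by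
        rw [star_mul', star_star]
        congr 1
        exact Complex.conj_ofReal t
      rw [star_sub, star_smul, hstar, Matrix.mulVec_sub, Matrix.mulVec_smul, sub_dotProduct,
        dotProduct_sub, dotProduct_sub, smul_dotProduct, smul_dotProduct, dotProduct_smul,
        dotProduct_smul, hva, hAv, ← ha]
      simp only [smul_eq_mul]
      ring
    have h2 : star a * a = ((‖a‖ ^ 2 : ℝ) : ℂ) := by
      rw [← starRingEnd_apply, RCLike.conj_mul]
      norm_cast
    have h3 : (qform A (h - ((t : ℂ) * star a) • v) : ℂ) =
        ((qform A v * ‖a‖ ^ 2 * (t * t) + (-2 * ‖a‖ ^ 2) * t + qform A h : ℝ) : ℂ) := by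
      rw [coe_qform hA.1, e, h2, ← coe_qform hA.1, ← coe_qform hA.1]
      push_cast
      ring
    exact_mod_cast h3
  have hd := discrim_le_zero fun t => (key t).symm ▸ qform_nonneg hA.posSemidef _
  rw [discrim] at hd
  have hn : 0 ≤ qform A v * qform A h :=
    mul_nonneg (qform_nonneg hA.posSemidef _) (qform_nonneg hA.posSemidef _)
  rw [hη]
  by_contra hlt
  push Not at hlt
  have hpos : 0 < ‖a‖ ^ 2 := hn.trans_lt hlt
  nlinarith [mul_lt_mul_of_pos_left hlt hpos]

lemma qform_outer (w x : Fin N → ℂ) : qform (outer w) x = ‖star x ⬝ᵥ w‖ ^ 2 := by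
  have : star x ⬝ᵥ outer w *ᵥ x = ((‖star x ⬝ᵥ w‖ ^ 2 : ℝ) : ℂ) := by
    rw [outer, Matrix.vecMulVec_mulVec, op_smul_eq_smul, dotProduct_smul, smul_eq_mul,
      ← star_star (star w ⬝ᵥ x), ← Matrix.star_dotProduct_star, star_star, ← starRingEnd_apply,
      RCLike.conj_mul]
    norm_cast
  rw [qform, this, Complex.ofReal_re]

variable {Ω' : Type*} [MeasurableSpace Ω'] {Q : Measure Ω'} {ρ : ℝ}
  {s : Ω' → Fin (K + 1) → ℂ} {n : Ω' → Fin N → ℂ}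

/-- Power of the interference and of the noise at the output of the receiver `g`. -/
noncomputable def interference (ρ : ℝ) (S : Matrix (Fin N) (Fin (K + 1)) ℂ) (g : Fin N → ℂ) : ℝ :=
  ∑ k : Fin K, ‖star g ⬝ᵥ fun i => S i k.succ‖ ^ 2 + ρ * ∑ i, ‖g i‖ ^ 2

lemma star_dotProduct_received (S : Matrix (Fin N) (Fin (K + 1)) ℂ) (g : Fin N → ℂ)
    (x : Fin (K + 1) → ℂ) (z : Fin N → ℂ) :
    star g ⬝ᵥ received S x z = (star g ⬝ᵥ signature S) * x 0 +
      ∑ k : Fin K, (star g ⬝ᵥ fun i => S i k.succ) * x k.succ + ∑ i, star (g i) * z i := by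
  rw [received, dotProduct_add, Matrix.dotProduct_mulVec, dotProduct, Fin.sum_univ_succ]
  rfl

/-- The free scalar a serves twice: a = 1 gives the mean-square error, and a = g*y removes the
useful signal and leaves the interference power. -/
lemma IsSignalNoise.integral_norm_sq_output (h : IsSignalNoise ρ s n Q)
    (S : Matrix (Fin N) (Fin (K + 1)) ℂ) (g : Fin N → ℂ) (a : ℂ) :
    ∫ ω, ‖star g ⬝ᵥ received S (s ω) (n ω) - a * s ω 0‖ ^ 2 ∂Q =
      ‖star g ⬝ᵥ signature S - a‖ ^ 2 + interference ρ S g := by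
  have := h.integral_norm_sq (Fin.cons (star g ⬝ᵥ signature S - a)
    fun k => star g ⬝ᵥ fun i => S i k.succ) (star g)
  rw [Fin.sum_univ_succ] at this
  simp only [Fin.cons_zero, Fin.cons_succ, Pi.star_apply, norm_star] at this
  rw [interference, ← add_assoc, ← this]
  refine integral_congr_ae (ae_of_all _ fun ω => ?_)
  simp only
  congr 2
  rw [star_dotProduct_received, Fin.sum_univ_succ]
  simp only [Fin.cons_zero, Fin.cons_succ]
  ring

lemma mse_eq (h : IsSignalNoise ρ s n Q) (S : Matrix (Fin N) (Fin (K + 1)) ℂ) (g : Fin N → ℂ) :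
    mse Q s n S g = ‖star g ⬝ᵥ signature S - 1‖ ^ 2 + interference ρ S g := by
  rw [← h.integral_norm_sq_output, mse]
  simp_rw [one_mul]

lemma outputSNR_eq (h : IsSignalNoise ρ s n Q) (S : Matrix (Fin N) (Fin (K + 1)) ℂ)
    (g : Fin N → ℂ) :
    outputSNR Q s n S g = ‖star g ⬝ᵥ signature S‖ ^ 2 / interference ρ S g := by
  have := h.integral_norm_sq_output S g (star g ⬝ᵥ signature S)
  rw [sub_self, norm_zero, zero_pow two_ne_zero, zero_add] at this
  rw [outputSNR, ← this]
  simp_rw [dotProduct_sub, dotProduct_smul, smul_eq_mul, mul_comm]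

/-- Output SNR of the LMMSE receiver, for an interference given by a positive definite form. -/
lemma IsLMMSE.outputSNR_eq_qform (h : IsSignalNoise ρ s n Q) {S : Matrix (Fin N) (Fin (K + 1)) ℂ}
    {A : Matrix (Fin N) (Fin N) ℂ} (hA : A.PosDef) (hSA : ∀ g, interference ρ S g = qform A g)
    {g : Fin N → ℂ} (hg : IsLMMSE Q s n S g) :
    outputSNR Q s n S g = qform A⁻¹ (signature S) := by
  have hdet := (Matrix.isUnit_iff_isUnit_det _).mp hA.isUnit
  rw [outputSNR_eq h]
  set y := signature S with hy
  set η := qform A⁻¹ y with hη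
  have hη0 : 0 ≤ η := qform_nonneg hA.posSemidef.inv y
  have h1 : 0 < 1 + η := by linarith
  refine norm_sq_div_eq_of_minimal hη0 (by rw [hSA]; exact norm_dotProduct_sq_le hA g y) ?_
  rw [← mse_eq h]
  -- The competitor (1 + η)⁻¹A⁻¹y attains the error 1/(1 + η). Minimality is used only against it,
  -- so the minimiser itself need not be computed.
  refine (hg (((1 / (1 + η) : ℝ) : ℂ) • A⁻¹ *ᵥ y)).trans (le_of_eq ?_)
  rw [mse_eq h, hSA]
  have hc : (η : ℂ) = star y ⬝ᵥ A⁻¹ *ᵥ y := coe_qform hA.1.inv y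
  have hstar : star (((1 / (1 + η) : ℝ) : ℂ)) = ((1 / (1 + η) : ℝ) : ℂ) := Complex.conj_ofReal _
  have e1 : star (((1 / (1 + η) : ℝ) : ℂ) • A⁻¹ *ᵥ y) ⬝ᵥ y = ((1 / (1 + η) * η : ℝ) : ℂ) := by
    rw [star_smul, hstar, smul_dotProduct, Matrix.star_mulVec, hA.1.inv.eq,
      ← Matrix.dotProduct_mulVec, ← hc, smul_eq_mul, Complex.ofReal_mul]
  have e2 : qform A (((1 / (1 + η) : ℝ) : ℂ) • A⁻¹ *ᵥ y) = (1 / (1 + η)) ^ 2 * η := by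
    rw [qform, star_smul, hstar, Matrix.mulVec_smul, Matrix.mulVec_mulVec,
      Matrix.mul_nonsing_inv _ hdet, Matrix.one_mulVec, smul_dotProduct, dotProduct_smul,
      Matrix.star_mulVec, hA.1.inv.eq, ← Matrix.dotProduct_mulVec, ← hc, smul_eq_mul, smul_eq_mul,
      ← Complex.ofReal_mul, ← Complex.ofReal_mul, Complex.ofReal_re]
    ring
  rw [← hy, e1, e2, ← Complex.ofReal_one, ← Complex.ofReal_sub, Complex.norm_real, Real.norm_eq_abs,
    sq_abs]
  field_simp
  ring

lemma channel_col {Ψ : Matrix (Fin N) (Fin N) ℂ} (p : Fin (K + 1) → ℝ)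
    (W : Matrix (Fin N) (Fin (K + 1)) ℂ) (k : Fin (K + 1)) :
    (fun i => channel Ψ p W i k) =
      ((√(p k) / √K : ℝ) : ℂ) • CFC.sqrt Ψ *ᵥ fun i => W i k := by
  funext i
  rw [channel, Matrix.smul_apply, Matrix.mul_diagonal, Pi.smul_apply, Matrix.mul_apply,
    Matrix.mulVec, dotProduct]
  simp only [smul_eq_mul]
  push_cast
  ring

lemma isHermitian_sqrt (Ψ : Matrix (Fin N) (Fin N) ℂ) : (CFC.sqrt Ψ).IsHermitian :=
  (CFC.sqrt_nonneg Ψ).isSelfAdjoint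

lemma interference_channel {Ψ : Matrix (Fin N) (Fin N) ℂ} {p : Fin (K + 1) → ℝ}
    (hp : ∀ k, 0 ≤ p k) (W : Matrix (Fin N) (Fin (K + 1)) ℂ) (g : Fin N → ℂ) :
    interference ρ (channel Ψ p W) g =
      qform (CFC.sqrt Ψ * gramSum (fun k => p k.succ / K) (fun k i => W i k.succ) * CFC.sqrt Ψ +
        (ρ : ℂ) • 1) g := by
  have hB := isHermitian_sqrt Ψ
  rw [qform_add, qform_smul, qform_mul_self_eq hB, interference]
  congr 1
  · have e : ∀ (τ : Fin K → ℝ) (X : Fin K → Fin N → ℂ) (x : Fin N → ℂ),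
        qform (gramSum τ X) x = ∑ k, τ k * qform (outer (X k)) x := fun τ X x => by
      rw [gramSum, qform, Matrix.sum_mulVec, dotProduct_sum, Complex.re_sum]
      refine Finset.sum_congr rfl fun k _ => ?_
      rw [← qform_smul, qform]
    rw [e]
    refine Finset.sum_congr rfl fun k _ => ?_
    rw [channel_col, qform_outer, dotProduct_smul, Matrix.dotProduct_mulVec, smul_eq_mul, norm_mul,
      mul_pow, Complex.norm_real, Real.norm_eq_abs, sq_abs, div_pow, Real.sq_sqrt (hp _),
      Real.sq_sqrt (Nat.cast_nonneg K), Matrix.star_mulVec, hB.eq]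
  · rw [qform, Matrix.one_mulVec, dotProduct, Complex.re_sum]
    congr 1
    refine Finset.sum_congr rfl fun i _ => ?_
    rw [Pi.star_apply, ← starRingEnd_apply, RCLike.conj_mul]
    norm_cast

/-- The output SNR of the LMMSE receiver as a quadratic form in the first column of `W`. -/
theorem outputSNR_channel (h : IsSignalNoise ρ s n Q) (hρ : 0 < ρ) {Ψ : Matrix (Fin N) (Fin N) ℂ}
    {p : Fin (K + 1) → ℝ} (hp₀ : 0 < p 0) (hp : ∀ k, 0 ≤ p k)
    {W : Matrix (Fin N) (Fin (K + 1)) ℂ} {g : Fin N → ℂ}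
    (hg : IsLMMSE Q s n (channel Ψ p W) g) :
    outputSNR Q s n (channel Ψ p W) g / p 0 =
      1 / K * qform (shiftRes (CFC.sqrt Ψ) ρ (fun k => p k.succ / K) 0 (fun k i => W i k.succ))
        (fun i => W i 0) := by
  have hB := isHermitian_sqrt Ψ
  have hG : (gramSum (fun k => p k.succ / (K : ℝ)) fun k i => W i k.succ).PosSemidef :=
    gramSum_posSemidef (fun k => div_nonneg (hp _) (Nat.cast_nonneg _)) _
  have hA := resolv_aux_posDef hB hρ hG
  rw [hg.outputSNR_eq_qform h hA (interference_channel hp W)]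
  have hy : signature (channel Ψ p W) = _ := channel_col p W 0
  have hscale : ∀ (A : Matrix (Fin N) (Fin N) ℂ) (r : ℝ) (x : Fin N → ℂ),
      qform A ((r : ℂ) • x) = r ^ 2 * qform A x := fun A r x => by
    have : star (r : ℂ) = r := Complex.conj_ofReal r
    rw [qform, star_smul, this, Matrix.mulVec_smul, smul_dotProduct, dotProduct_smul, smul_eq_mul,
      smul_eq_mul, ← mul_assoc, ← Complex.ofReal_mul, Complex.re_ofReal_mul, qform, sq]
  rw [hy, hscale, ← qform_mul_self_eq hB, div_pow, Real.sq_sqrt hp₀.le,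
    Real.sq_sqrt (Nat.cast_nonneg K), shiftRes, resolv, Complex.ofReal_zero, zero_smul, add_zero]
  field_simp

end Receiver

end LMMSE

namespace LMMSE

/-! ### The law of the columns and transport of moments. -/

section Law

variable {Ω : Type*} [MeasurableSpace Ω] {P : Measure Ω} [IsProbabilityMeasure P] {N K : ℕ}

/-- The columns of a standard Gaussian matrix are independent standard Gaussian vectors. -/
lemma IsStdGaussianMatrix.hasLaw_columns {W : Ω → Matrix (Fin N) (Fin K) ℂ}
    (h : IsStdGaussianMatrix W P) :
    HasLaw (fun ω k i => W ω i k) (Measure.pi fun _ : Fin K => colLaw (Fin N)) P := by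
  have hae : ∀ z : Fin K × Fin N, AEMeasurable (fun ω => W ω z.2 z.1) P := fun z =>
    (h.hasLaw z.2 z.1).aemeasurable
  have hind : iIndepFun (fun (z : Fin K × Fin N) ω => W ω z.2 z.1) P :=
    h.indep.precomp (g := Prod.swap) Prod.swap_injective
  have hmap := (iIndepFun_iff_map_fun_eq_pi_map hae).mp hind
  have hlaw : ∀ z : Fin K × Fin N, P.map (fun ω => W ω z.2 z.1) = stdComplexGaussian := fun z =>
    (h.hasLaw z.2 z.1).map_eq
  simp_rw [hlaw] at hmap
  have hcurry := Measure.infinitePi_map_curry (X := ℂ)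
    (fun (_ : Fin K) (_ : Fin N) => stdComplexGaussian)
  simp_rw [Measure.infinitePi_eq_pi] at hcurry
  refine ⟨aemeasurable_pi_lambda _ fun k => aemeasurable_pi_lambda _ fun i => hae (k, i), ?_⟩
  have e : (fun ω k i => W ω i k) = (MeasurableEquiv.curry (Fin K) (Fin N) ℂ) ∘
      fun ω (z : Fin K × Fin N) => W ω z.2 z.1 := rfl
  rw [e, ← AEMeasurable.map_map_of_aemeasurable
    (MeasurableEquiv.measurable _).aemeasurable (aemeasurable_pi_lambda _ hae), hmap, hcurry]
  rfl

/-- Separates the signature column of the user of interest from the interferers, on which alone the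
resolvent depends. -/
lemma IsStdGaussianMatrix.hasLaw_split {W : Ω → Matrix (Fin N) (Fin (K + 1)) ℂ}
    (h : IsStdGaussianMatrix W P) :
    HasLaw (fun ω => ((fun i => W ω i 0, fun k i => W ω i k.succ) :
        (Fin N → ℂ) × (Fin K → Fin N → ℂ)))
      ((colLaw (Fin N)).prod (Measure.pi fun _ => colLaw (Fin N))) P := by
  have hcol := h.hasLaw_columns
  set T : (Fin (K + 1) → Fin N → ℂ) → (Fin N → ℂ) × (Fin K → Fin N → ℂ) :=
    fun X => (X 0, fun k => X k.succ) with hT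
  have hTm : Measurable T := (measurable_pi_apply 0).prodMk
    (measurable_pi_lambda _ fun k => measurable_pi_apply k.succ)
  have e : (fun ω => ((fun i => W ω i 0, fun k i => W ω i k.succ) :
      (Fin N → ℂ) × (Fin K → Fin N → ℂ))) = T ∘ fun ω k i => W ω i k := rfl
  refine ⟨e ▸ hTm.comp_aemeasurable hcol.aemeasurable, ?_⟩
  have hc := measurePreserving_cons (colLaw (Fin N)) K
  rw [e, ← AEMeasurable.map_map_of_aemeasurable hTm.aemeasurable hcol.aemeasurable, hcol.map_eq,
    ← hc.map_eq, Measure.map_map hTm hc.measurable]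
  have : T ∘ (fun z : (Fin N → ℂ) × (Fin K → Fin N → ℂ) =>
      (Fin.cons z.1 z.2 : Fin (K + 1) → Fin N → ℂ)) = id := rfl
  rw [this, Measure.map_id]

omit [IsProbabilityMeasure P] in
/-- Central moments of a scaled quadratic form, transported to the law of its arguments. -/
lemma scaled_moments {α : Type*} [MeasurableSpace α] {ν : Measure α} {Z : Ω → α}
    (hZ : HasLaw Z ν P) (hK : 1 ≤ K) {F : α → ℝ} (hF : MemLp F 3 ν) (hFm : Measurable F) {m : ℝ}
    (hm : ∫ z, F z ∂ν = m) {b : Ω → ℝ} (hb : ∀ ω, b ω = 1 / K * F (Z ω)) :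
    MemLp b 3 P ∧ ∫ ω, b ω ∂P = 1 / K * m ∧
    K * ∫ ω, (b ω - ∫ ω', b ω' ∂P) ^ 2 ∂P = 1 / K * ∫ z, (F z - m) ^ 2 ∂ν ∧
    (K : ℝ) ^ 2 * ∫ ω, (b ω - ∫ ω', b ω' ∂P) ^ 3 ∂P = 1 / K * ∫ z, (F z - m) ^ 3 ∂ν := by
  have hK0 : (0 : ℝ) < K := by exact_mod_cast hK
  obtain rfl : b = fun ω => 1 / K * F (Z ω) := funext hb
  have hint : ∀ G : α → ℝ, Measurable G → ∫ ω, G (Z ω) ∂P = ∫ z, G z ∂ν := fun G hG => by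
    rw [← hZ.map_eq, integral_map hZ.aemeasurable hG.aestronglyMeasurable]
  have h1 : ∫ ω, 1 / (K : ℝ) * F (Z ω) ∂P = 1 / K * m := by
    rw [integral_const_mul, hint F hFm, hm]
  refine ⟨?_, h1, ?_, ?_⟩
  · refine MemLp.const_mul (f := fun ω => F (Z ω)) ?_ _
    rw [← hZ.map_eq] at hF
    exact (memLp_map_measure_iff hFm.aestronglyMeasurable hZ.aemeasurable).mp hF
  · rw [h1]
    have e : ∀ ω, (1 / (K : ℝ) * F (Z ω) - 1 / K * m) ^ 2 = 1 / (K : ℝ) ^ 2 * (F (Z ω) - m) ^ 2 :=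
      fun ω => by field_simp
    simp_rw [e]
    rw [integral_const_mul, hint (fun z => (F z - m) ^ 2) ((hFm.sub_const m).pow_const 2)]
    field_simp
  · rw [h1]
    have e : ∀ ω, (1 / (K : ℝ) * F (Z ω) - 1 / K * m) ^ 3 = 1 / (K : ℝ) ^ 3 * (F (Z ω) - m) ^ 3 :=
      fun ω => by field_simp
    simp_rw [e]
    rw [integral_const_mul, hint (fun z => (F z - m) ^ 3) ((hFm.sub_const m).pow_const 3)]
    field_simp

end Law

/-! ### Checking the hypotheses of the deterministic system. -/

section Parameters

variable {N K : ℕ}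

open scoped Matrix.Norms.L2Operator in
lemma abs_le_specNorm_diagonal (d : Fin N → ℝ) (i : Fin N) :
    |d i| ≤ specNorm (Matrix.diagonal d) := by
  rw [specNorm, ← Matrix.cstar_norm_def, Matrix.l2_opNorm_diagonal, ← Real.norm_eq_abs]
  exact norm_le_pi_norm d i

/-- The decomposition is a given one, so the sign of its entries is recovered by conjugating back
with U. -/
lemma spectral_nonneg {Ψ : Matrix (Fin N) (Fin N) ℂ} (hΨ : Ψ.PosSemidef)
    {U : Matrix.unitaryGroup (Fin N) ℂ} {d : Fin N → ℝ}
    (hspec : Ψ = (U : Matrix (Fin N) (Fin N) ℂ) * Matrix.diagonal (fun i => (d i : ℂ)) *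
      star (U : Matrix (Fin N) (Fin N) ℂ)) (i : Fin N) : 0 ≤ d i := by
  have h := hΨ.conjTranspose_mul_mul_same (U : Matrix (Fin N) (Fin N) ℂ)
  have hU : star (U : Matrix (Fin N) (Fin N) ℂ) * (U : Matrix (Fin N) (Fin N) ℂ) = 1 :=
    Unitary.star_mul_self_of_mem U.2
  have e : (U : Matrix (Fin N) (Fin N) ℂ)ᴴ * Ψ * (U : Matrix (Fin N) (Fin N) ℂ) =
      Matrix.diagonal (fun i => (d i : ℂ)) := by
    rw [hspec, ← Matrix.star_eq_conjTranspose]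
    calc _ = (star (U : Matrix (Fin N) (Fin N) ℂ) * (U : Matrix (Fin N) (Fin N) ℂ)) *
          Matrix.diagonal (fun i => (d i : ℂ)) *
          (star (U : Matrix (Fin N) (Fin N) ℂ) * (U : Matrix (Fin N) (Fin N) ℂ)) := by
          simp only [Matrix.mul_assoc]
      _ = _ := by rw [hU, Matrix.one_mul, Matrix.mul_one]
  rw [e, Matrix.posSemidef_diagonal_iff] at h
  exact_mod_cast h i

/-- Existence and uniqueness of the positive solution of the deterministic system. -/
theorem existsUnique_isPosSolution {ρ dm pm c c' S : ℝ} {d : Fin N → ℝ} {q : Fin K → ℝ}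
    (h : Regime ρ dm pm c S (1 / K) d q) (hc' : 0 < c') (hq : c' ≤ 1 / K * ∑ k, q k) :
    ∃! z : ℝ × ℝ, IsPosSolution (1 / ρ) (Matrix.diagonal d) (Matrix.diagonal q) z.1 z.2 := by
  have hρ := h.r_pos
  obtain ⟨e, he, hfix⟩ := exists_fixedPoint (s := 1 / (K : ℝ)) h.s_nonneg hρ h.d_nonneg h.q_nonneg
  have hepos : 0 < e := (div_pos h.c_pos h.den_pos).trans_le (h.le_fixedPoint he hfix)
  have hGpos : 0 < stieltjesSum (1 / K) 1 q e := by
    refine lt_of_lt_of_le ?_ (stieltjesSum_ge h.s_nonneg one_pos h.q_nonneg h.q_le hq he le_rfl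
      h.pm_nonneg)
    have := mul_nonneg he h.pm_nonneg
    positivity
  have hsol : IsPosSolution (1 / ρ) (Matrix.diagonal d) (Matrix.diagonal q) (ρ * e)
      (stieltjesSum (1 / K) 1 q e) := by
    rw [isPosSolution_iff hρ h.d_nonneg h.q_nonneg (by positivity) hGpos.le,
      mul_div_cancel_left₀ e hρ.ne']
    exact ⟨by positivity, hGpos, hfix, rfl⟩
  refine ⟨(ρ * e, stieltjesSum (1 / K) 1 q e), hsol, ?_⟩
  rintro ⟨δ, δ'⟩ hδ
  simp only at hδ
  obtain ⟨h1, h2, h3, h4⟩ := (isPosSolution_iff hρ h.d_nonneg h.q_nonneg hδ.pos.le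
    hδ.pos'.le).mp hδ
  have hδρ : 0 ≤ δ / ρ := (div_pos h1 hρ).le
  -- Two exact solutions have zero residuals, so stability forces them to coincide.
  have hst := stieltjesSum_stability (E := max e (δ / ρ)) (t := 0) (r₁ := 0) (r₂ := 0)
    (X := stieltjesSum (1 / K) 1 q 0) h.s_nonneg hρ h.d_nonneg h.d_le h.dm_nonneg h.q_nonneg h.c_le
    le_rfl (by rw [zero_add]) he (le_max_left _ _) hδρ (le_max_right _ _)
    (by rw [zero_add, ← hfix, sub_self, abs_zero])
    (by rw [zero_add, ← h4, ← h3, sub_self, abs_zero])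
  rw [add_zero, mul_zero] at hst
  have hG0 := stieltjesSum_nonneg (s := 1 / (K : ℝ)) (x := 0) h.s_nonneg one_pos h.q_nonneg le_rfl
  have hκ : 0 < c * ρ / (ρ + stieltjesSum (1 / K) 1 q 0 * dm) ^ 2 := by
    have := mul_nonneg hG0 h.dm_nonneg
    have := h.c_pos
    positivity
  have heq : e = δ / ρ := by
    have : |e - δ / ρ| = 0 := le_antisymm (by
      by_contra hcon
      push Not at hcon
      exact absurd hst (not_le.mpr (mul_pos hκ hcon))) (abs_nonneg _)
    linarith [abs_eq_zero.mp this]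
  refine Prod.ext ?_ ?_
  · simp only
    rw [heq]
    field_simp
  · simp only
    rw [heq, ← h4]

end Parameters

end LMMSE

/-! ### Asymptotic bookkeeping and the final theorem. -/

namespace LMMSE

/-- A positive lower limit of `K / N` bounds `N` by a multiple of `K`. -/
lemma exists_eventually_le_mul {N : ℕ → ℕ}
    (h : 0 < liminf (fun K : ℕ => (K : ℝ≥0∞) / (N K : ℝ≥0∞)) atTop) :
    ∃ S : ℝ, 0 ≤ S ∧ ∀ᶠ K : ℕ in atTop, (N K : ℝ) ≤ S * K := by
  obtain ⟨a, ha0, ha⟩ := ENNReal.lt_iff_exists_nnreal_btwn.mp h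
  have ha0' : (0 : ℝ) < a := by exact_mod_cast ha0
  refine ⟨1 / a, by positivity, ?_⟩
  filter_upwards [eventually_lt_of_lt_liminf ha] with K hK
  have h1 : (a : ℝ≥0∞) * N K ≤ K := ENNReal.mul_le_of_le_div hK.le
  have h2 : (a : ℝ) * N K ≤ K := by exact_mod_cast h1
  rw [one_div, ← div_eq_inv_mul, le_div_iff₀ ha0']
  linarith

lemma tendsto_of_eventually_abs_le {C : ℝ} {x u : ℕ → ℝ} (hu : Tendsto u atTop (𝓝 0))
    (h : ∀ᶠ K in atTop, |x K| ≤ C * u K) : Tendsto x atTop (𝓝 0) := by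
  refine squeeze_zero_norm' (a := fun K => C * u K) h ?_
  simpa using hu.const_mul C

lemma isBigO_one_of_eventually_abs_le {C : ℝ} {x : ℕ → ℝ} (h : ∀ᶠ K in atTop, |x K| ≤ C) :
    x =O[atTop] (fun _ => (1 : ℝ)) :=
  IsBigO.of_bound C (h.mono fun K hK => by simpa using hK)

end LMMSE

theorem theorem1
    -- the probability space of the channel
    {Ω : Type*} [MeasurableSpace Ω] (P : Measure Ω) [IsProbabilityMeasure P]
    -- the probability space of the transmitted symbols and the noise
    {Ω' : Type*} [MeasurableSpace Ω'] (Q : Measure Ω') [IsProbabilityMeasure Q]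
    (ρ : ℝ) (hρ : 0 < ρ)
    -- asymptotic regime
    (N : ℕ → ℕ) (hN : Tendsto N atTop atTop)
    (hliminf : 0 < liminf (fun K : ℕ => (K : ℝ≥0∞) / (N K : ℝ≥0∞)) atTop)
    (hlimsup : limsup (fun K : ℕ => (K : ℝ≥0∞) / (N K : ℝ≥0∞)) atTop < ⊤)
    -- receive correlation and its spectral decomposition
    (Ψ : ∀ K, Matrix (Fin (N K)) (Fin (N K)) ℂ) (hΨ : ∀ K, (Ψ K).PosSemidef)
    (U : ∀ K, Matrix.unitaryGroup (Fin (N K)) ℂ) (d : ∀ K, Fin (N K) → ℝ)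
    (hspec : ∀ K, Ψ K =
      (U K : Matrix (Fin (N K)) (Fin (N K)) ℂ) * Matrix.diagonal (fun i => (d K i : ℂ)) *
        star (U K : Matrix (Fin (N K)) (Fin (N K)) ℂ))
    -- powers
    (p : ∀ K, Fin (K + 1) → ℝ) (hp₀ : ∀ K, 0 < p K 0) (hp : ∀ K k, 0 ≤ p K k)
    -- the matrices `D` and `D̃`
    (D : ∀ K, Matrix (Fin (N K)) (Fin (N K)) ℝ) (hD : ∀ K, D K = Matrix.diagonal (d K))
    (D' : ∀ K, Matrix (Fin K) (Fin K) ℝ)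
    (hD' : ∀ K, D' K = Matrix.diagonal (fun k : Fin K => p K k.succ))
    -- bounded spectral norms
    (hbdd : ∃ dmax : ℝ, ∀ K, 1 ≤ K → specNorm (D K) ≤ dmax)
    (hbdd' : ∃ dmax : ℝ, ∀ K, 1 ≤ K → specNorm (D' K) ≤ dmax)
    -- normalized traces bounded away from zero
    (htr : ∃ c : ℝ, 0 < c ∧ ∀ K : ℕ, 1 ≤ K → c ≤ 1 / (K : ℝ) * (D K).trace)
    (htr' : ∃ c : ℝ, 0 < c ∧ ∀ K : ℕ, 1 ≤ K → c ≤ 1 / (K : ℝ) * (D' K).trace)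
    -- the Gaussian matrix, the symbols and the noise
    (W : ∀ K, Ω → Matrix (Fin (N K)) (Fin (K + 1)) ℂ)
    (hW : ∀ K, IsStdGaussianMatrix (W K) P)
    (s : ∀ K, Ω' → Fin (K + 1) → ℂ) (n : ∀ K, Ω' → Fin (N K) → ℂ)
    (hsn : ∀ K, IsSignalNoise ρ (s K) (n K) Q)
    -- the LMMSE receiver and its output SNR
    (g : ∀ K, Ω → Fin (N K) → ℂ)
    (hg : ∀ K ω, IsLMMSE Q (s K) (n K) (channel (Ψ K) (p K) (W K ω)) (g K ω))
    (β : ℕ → Ω → ℝ)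
    (hβ : ∀ K ω, β K ω =
      outputSNR Q (s K) (n K) (channel (Ψ K) (p K) (W K ω)) (g K ω)) :
    -- the deterministic system has exactly one positive solution
    (∀ K, 1 ≤ K → ∃! q : ℝ × ℝ, IsPosSolution (1 / ρ) (D K) (D' K) q.1 q.2) ∧
    -- the first three moments of the SNR exist
    (∀ K, 1 ≤ K → MemLp (fun ω => β K ω / p K 0) 3 P) ∧
    ∀ δ δ' : ℕ → ℝ, (∀ K, 1 ≤ K → IsPosSolution (1 / ρ) (D K) (D' K) (δ K) (δ' K)) →
      -- first asymptotic moment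
      ((fun K => δ K / ρ) =O[atTop] (fun _ => (1 : ℝ)) ∧
        Tendsto (fun K => (∫ ω, β K ω / p K 0 ∂P) - δ K / ρ) atTop (𝓝 0)) ∧
      -- second asymptotic moment
      ((fun K => √(omegaSq ρ (D K) (D' K) (δ K) (δ' K))) =O[atTop] (fun _ => (1 : ℝ)) ∧
        Tendsto (fun K : ℕ =>
          (K : ℝ) * (∫ ω, (β K ω / p K 0 - ∫ ω', β K ω' / p K 0 ∂P) ^ 2 ∂P)
            - omegaSq ρ (D K) (D' K) (δ K) (δ' K)) atTop (𝓝 0)) ∧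
      -- third asymptotic moment
      ((fun K => nu ρ (D K) (D' K) (δ K) (δ' K)) =O[atTop] (fun _ => (1 : ℝ)) ∧
        Tendsto (fun K : ℕ =>
          (K : ℝ) ^ 2 * (∫ ω, (β K ω / p K 0 - ∫ ω', β K ω' / p K 0 ∂P) ^ 3 ∂P)
            - nu ρ (D K) (D' K) (δ K) (δ' K)) atTop (𝓝 0)) := by
  obtain ⟨dm₀, hdm₀⟩ := hbdd
  obtain ⟨pm₀, hpm₀⟩ := hbdd'
  obtain ⟨c, hc, hcK⟩ := htr
  obtain ⟨c', hc', hcK'⟩ := htr'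
  obtain ⟨S, hS, hNS⟩ := exists_eventually_le_mul hliminf
  obtain ⟨dm, hdm⟩ : ∃ dm, dm = max dm₀ 0 := ⟨_, rfl⟩
  obtain ⟨pm, hpm⟩ : ∃ pm, pm = max pm₀ 0 := ⟨_, rfl⟩
  have hdm0 : 0 ≤ dm := hdm ▸ le_max_right _ _
  have hpm0 : 0 ≤ pm := hpm ▸ le_max_right _ _
  -- The bound S' is left free: N ≤ S·K is known only eventually, whereas existence, uniqueness and
  -- finite moments are claimed for every K ≥ 1 and use S' = N/K.
  have hregime : ∀ (K : ℕ) (S' : ℝ), 1 ≤ K → (N K : ℝ) ≤ S' * K →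
      Regime ρ dm pm c S' (1 / K) (d K) (fun k : Fin K => p K k.succ) := by
    intro K S' hK hN'
    have hK0 : (0 : ℝ) < K := by exact_mod_cast hK
    refine ⟨by positivity, spectral_nonneg (hΨ K) (hspec K), fun i => ?_, fun k => hp K _,
      fun k => ?_, ?_, ?_, ?_, hρ, hdm0, hpm0, hc⟩
    · have h1 := abs_le_specNorm_diagonal (d K) i
      have h2 := hdm₀ K hK
      rw [hD K] at h2
      exact hdm ▸ (le_abs_self _).trans (h1.trans (h2.trans (le_max_left _ _)))
    · have h1 := abs_le_specNorm_diagonal (fun k : Fin K => p K k.succ) k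
      have h2 := hpm₀ K hK
      rw [hD' K] at h2
      exact hpm ▸ (le_abs_self _).trans (h1.trans (h2.trans (le_max_left _ _)))
    · have := hcK K hK
      rwa [hD K, Matrix.trace_diagonal] at this
    · rw [Fintype.card_fin, one_div, inv_mul_le_iff₀ hK0]
      linarith
    · rw [Fintype.card_fin, one_div, inv_mul_cancel₀ hK0.ne']
  have hregime' : ∀ K : ℕ, 1 ≤ K →
      Regime ρ dm pm c (N K / K) (1 / K) (d K) (fun k : Fin K => p K k.succ) := fun K hK => by
    have hK0 : (0 : ℝ) < K := by exact_mod_cast hK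
    exact hregime K _ hK (by rw [div_mul_cancel₀ _ hK0.ne'])
  have hBB : ∀ K, CFC.sqrt (Ψ K) * CFC.sqrt (Ψ K) =
      (U K : Matrix (Fin (N K)) (Fin (N K)) ℂ) * Matrix.diagonal (fun i => (d K i : ℂ)) *
        star (U K : Matrix (Fin (N K)) (Fin (N K)) ℂ) := fun K => by
    rw [← hspec K]
    exact CFC.sqrt_mul_sqrt_self (Ψ K) (hΨ K).nonneg
  have hsetup := fun K hK => (hregime' K hK).resSetup (isHermitian_sqrt (Ψ K)) (hBB K)
  have hmom := fun (K : ℕ) (hK : 1 ≤ K) => scaled_moments (P := P) (hW K).hasLaw_split hK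
    ((hsetup K hK).memLp_qform_shiftRes le_rfl)
    ((hsetup K hK).continuous_qform_shiftRes le_rfl).measurable rfl
    (b := fun ω => β K ω / p K 0) fun ω => by
      rw [hβ K ω, outputSNR_channel (hsn K) hρ (hp₀ K) (hp K) (hg K ω)]
  refine ⟨fun K hK => ?_, fun K hK => (hmom K hK).1, fun δ δ' hsol => ?_⟩
  · rw [hD K, hD' K]
    refine existsUnique_isPosSolution (hregime' K hK) hc' ?_
    have := hcK' K hK
    rwa [hD' K, Matrix.trace_diagonal] at this
  obtain ⟨C, hC, t₀, ht₀, hbound⟩ := exists_moment_bound (c₀ := c) (S := S) hρ hdm0 hpm0 hc hS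
  -- The scale K^{-1/8} is the one at which the expansion is sampled; it is also the rate of
  -- convergence obtained for all three moments.
  obtain ⟨u, hu⟩ : ∃ u : ℕ → ℝ, ∀ K, u K = (K : ℝ) ^ (-(1 / 8) : ℝ) := ⟨_, fun _ => rfl⟩
  have hu0 : Tendsto u atTop (𝓝 0) := by
    rw [funext hu]
    exact (tendsto_rpow_neg_atTop (by norm_num : (0 : ℝ) < 1 / 8)).comp
      tendsto_natCast_atTop_atTop
  have hsmall : ∀ᶠ K in atTop, 2 * u K ≤ t₀ := by
    have : Tendsto (fun K => 2 * u K) atTop (𝓝 0) := by simpa using hu0.const_mul 2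
    exact (this.eventually (gt_mem_nhds ht₀)).mono fun K hK => hK.le
  have hmain : ∀ᶠ K : ℕ in atTop,
      |δ K / ρ| ≤ S * dm / ρ ∧
      |(∫ ω, β K ω / p K 0 ∂P) - δ K / ρ| ≤ C * u K ∧
      |√(omegaSq ρ (D K) (D' K) (δ K) (δ' K))| ≤ √C ∧
      |(K : ℝ) * (∫ ω, (β K ω / p K 0 - ∫ ω', β K ω' / p K 0 ∂P) ^ 2 ∂P) -
        omegaSq ρ (D K) (D' K) (δ K) (δ' K)| ≤ C * u K ∧
      |nu ρ (D K) (D' K) (δ K) (δ' K)| ≤ 2 * C ∧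
      |(K : ℝ) ^ 2 * (∫ ω, (β K ω / p K 0 - ∫ ω', β K ω' / p K 0 ∂P) ^ 3 ∂P) -
        nu ρ (D K) (D' K) (δ K) (δ' K)| ≤ C * u K := by
    filter_upwards [eventually_ge_atTop 1, hNS, hsmall] with K hK hNK huK
    have hK0 : (0 : ℝ) < K := by exact_mod_cast hK
    have hR := hregime K S hK hNK
    have hs := hsol K hK
    have hδ := hs.pos
    have hδ' := hs.pos'
    rw [hD K, hD' K, isPosSolution_iff hρ hR.d_nonneg hR.q_nonneg hδ.le hδ'.le] at hs
    obtain ⟨-, -, h3, h4⟩ := hs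
    have he : 0 ≤ δ K / ρ := (div_pos hδ hρ).le
    have hfix := h3
    rw [h4] at hfix
    have hu1 : 0 < u K := by rw [hu]; positivity
    have hu8 : u K ^ 8 * K = 1 := by
      rw [hu, ← Real.rpow_natCast, ← Real.rpow_mul hK0.le]
      norm_num
      rw [Real.rpow_neg_one, inv_mul_cancel₀ hK0.ne']
    obtain ⟨hlin, hquad, m, hm, b1, b2, b3⟩ := hbound (N K) K (d K) (fun k => p K k.succ)
      (δ K / ρ) (CFC.sqrt (Ψ K)) (U K) hK hR he hfix (isHermitian_sqrt (Ψ K)) (hBB K) (u K) hu1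
      huK hu8
    obtain ⟨-, m1, m2, m3⟩ := hmom K hK
    rw [hm] at m1 m2 m3
    have hgap := hR.gap he hfix
    have hepos : 0 < δ K / ρ := div_pos hδ hρ
    have hF := hR.F_le hδ'.le
    rw [← h3] at hF
    have hne : 1 - stieltjesCoeff 1 (1 / K) ρ (d K) (δ' K) *
        stieltjesCoeff 1 (1 / K) 1 (fun k : Fin K => p K k.succ) (δ K / ρ) ≠ 0 := by
      rw [← h4] at hgap
      refine (lt_of_lt_of_le ?_ hgap).ne'
      exact div_pos (div_pos (mul_pos hc hρ) (pow_pos hR.den_pos 2)) (hepos.trans_le hF)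
    have hω := omegaSq_eq_linCoeff hρ hR.d_nonneg hR.q_nonneg hδ.le hδ'.le h4 hne
    have hν := nu_eq_quadCoeff hρ hR.d_nonneg hR.q_nonneg hδ.le hδ'.le h4 hne
    rw [hD K, hD' K, hω, hν]
    refine ⟨(abs_of_pos hepos).trans_le hF, ?_, ?_, ?_, ?_, ?_⟩
    · rw [m1]
      exact b1
    · rw [abs_of_nonneg (Real.sqrt_nonneg _)]
      exact Real.sqrt_le_sqrt hlin.2
    · rw [m2]
      exact b2
    · rw [abs_mul, abs_two]
      linarith
    · rw [m3]
      exact b3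
  refine ⟨⟨isBigO_one_of_eventually_abs_le (hmain.mono fun K h => h.1),
      tendsto_of_eventually_abs_le hu0 (hmain.mono fun K h => h.2.1)⟩,
    ⟨isBigO_one_of_eventually_abs_le (hmain.mono fun K h => h.2.2.1),
      tendsto_of_eventually_abs_le hu0 (hmain.mono fun K h => h.2.2.2.1)⟩,
    ⟨isBigO_one_of_eventually_abs_le (hmain.mono fun K h => h.2.2.2.2.1),
      tendsto_of_eventually_abs_le hu0 (hmain.mono fun K h => h.2.2.2.2.2)⟩⟩
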